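/- Let $d\in\mathbb N=\{0,1,2,\dots\}$ and $s>1$. For $V\subset\mathbb R^d$, $A,C>0$ and a complex-valued function $u$ that is smooth near $V$, write $u\in B_s(A,C;V)$ if $|\partial^\alpha u(x)|\le A\,C^{|\alpha|}\alpha!^{\,s}$ for all $\alpha\in\mathbb N^d$ and $x\in V$. For $W\subset\mathbb R^d$ open, the Gevrey class $\mathcal G^s(W)$ is the set of $u\in C^\infty(W;\mathbb C)$ such that for every compact $K\subset W$ there are $A,C>0$ with $u\in B_s(A,C;K)$. Let $W\subset\mathbb R^d$ be open, $x_0\in W$, and let $f\in\mathcal G^s(W)$ satisfy $f(x_0)=0$, $f'(x_0)=0$ and $\operatorname{Im}f''(x_0)$ positive definite. Put $$g_{x_0}(x)=f(x)-\tfrac12 f''(x_0)(x-x_0)\cdot(x-x_0),$$ and for $u\in\mathcal G^s(W)$ and $j\in\mathbb N$ $$L_ju=\sum_{\substack{\mu,\nu\ge0,\ \nu-\mu=j\\ 2\nu\ge3\mu}}\frac{i^{\mu+\nu}}{2^\nu\mu!\,\nu!}\,\bigl(f''(x_0)^{-1}\partial\cdot\partial\bigr)^\nu\bigl(g_{x_0}^\mu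 u\bigr)(x_0).$$ (i) There are an open neighborhood $U$ of $x_0$ whose closure is a compact subset of $W$, and $h_0>0$, both independent of $u$, such that for all $u\in\mathcal G^s(W)$, $k\in\mathbb N$ and $0<h<h_0$, $$\biggl|\int_U e^{\frac ihf(x)}u(x)\,dx-\Bigl(\det\frac{f''(x_0)}{2\pi ih}\Bigr)^{-1/2}\sum_{j<k}h^jL_ju\biggr|\le C^{k+1}\,k!^{\,2s-1}\,h^{k+\frac d2}.$$ Here $C$ depends only on $d$, $s$, on constants $A_u,C_u,A_f,C_f>0$ with $u\in B_s(A_u,C_u;U)$, $f\in B_s(A_f,C_f;U)$, and on a constant $c>0$ with $\operatorname{Im}f''(x_0)v\cdot v\ge c|v|^2$ for all $v\in\mathbb R^d$. The matrix $f''(x_0)/(2\pi ih)$ is symmetric with positive definite real part, and $\det^{-1/2}$ is the branch that is continuous on the set of such matrices and positive on the real ones, i.e. the product of the principal values $\lambda^{-1/2}$ over the eigenvalues $\lambda$, counted with multiplicity. (ii) If $u\in\mathcal G^s(W)$, $u\in B_s(A_u,C_u;\{x_0\})$, $f\in B_s(A_f,C_f;\{x_0\})$, and $c_0>0$ bounds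 the absolute values of the entries of $f''(x_0)^{-1}$, then $$|L_ju|\le A\,C^j\,j!^{\,2s-1}\quad(j\in\mathbb N),\qquad A=2A_u,$$ where $C$ depends only on $d,s,C_u,A_f,C_f,c_0$. -/

import Mathlib

open MeasureTheory
open scoped ContDiff

noncomputable section

namespace GevreyPhase

variable {d : ℕ}

/-- The partial derivative `∂ᵢ u` of a complex-valued function on `ℝᵈ`. -/
def pderiv (i : Fin d) (u : EuclideanSpace ℝ (Fin d) → ℂ) : EuclideanSpace ℝ (Fin d) → ℂ :=
  fun x => fderiv ℝ u x (EuclideanSpace.single i 1)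

/-- The iterated partial derivative `∂^α u = ∂₀^(α 0) ∂₁^(α 1) ⋯ u`, for a multi-index `α ∈ ℕᵈ`. -/
def mderiv (α : Fin d → ℕ) (u : EuclideanSpace ℝ (Fin d) → ℂ) : EuclideanSpace ℝ (Fin d) → ℂ :=
  (List.finRange d).foldr (fun i v => (pderiv i)^[α i] v) u

/-- The bounds `|∂^α u(x)| ≤ A C^|α| α!^s` for all multi-indices `α` and all `x ∈ V`. -/
def GevreyBoundOn (s A C : ℝ) (V : Set (EuclideanSpace ℝ (Fin d)))
    (u : EuclideanSpace ℝ (Fin d) → ℂ) : Prop :=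
  ∀ α : Fin d → ℕ, ∀ x ∈ V,
    ‖mderiv α u x‖ ≤ A * C ^ (∑ i, α i) * ((∏ i, (α i).factorial : ℕ) : ℝ) ^ s

/-- The Gevrey class `G^s(W)` of an open set `W ⊆ ℝᵈ`: smooth functions on `W` that satisfy
Gevrey bounds on every compact subset of `W`. Values outside `W` play no role. -/
def IsGevrey (s : ℝ) (W : Set (EuclideanSpace ℝ (Fin d)))
    (u : EuclideanSpace ℝ (Fin d) → ℂ) : Prop :=
  ContDiffOn ℝ ∞ u W ∧
    ∀ K : Set (EuclideanSpace ℝ (Fin d)), IsCompact K → K ⊆ W →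
      ∃ A > 0, ∃ C > 0, GevreyBoundOn s A C K u

/-- The Hessian matrix `f''(x)`. -/
def hess (f : EuclideanSpace ℝ (Fin d) → ℂ) (x : EuclideanSpace ℝ (Fin d)) :
    Matrix (Fin d) (Fin d) ℂ :=
  Matrix.of fun i j => pderiv i (pderiv j f) x

/-- `g_{x₀}(x) = f(x) - ½ f''(x₀)(x - x₀)·(x - x₀)`. -/
def gRem (f : EuclideanSpace ℝ (Fin d) → ℂ) (x₀ : EuclideanSpace ℝ (Fin d)) :
    EuclideanSpace ℝ (Fin d) → ℂ :=
  fun x => f x - (1 / 2) * ∑ i, ∑ j, hess f x₀ i j * ((x i - x₀ i : ℝ) : ℂ) * ((x j - x₀ j : ℝ) : ℂ)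

/-- The constant-coefficient second order operator `B∂·∂ = ∑ B_{ij} ∂ᵢ ∂ⱼ`. -/
def quadOp (B : Matrix (Fin d) (Fin d) ℂ) (v : EuclideanSpace ℝ (Fin d) → ℂ) :
    EuclideanSpace ℝ (Fin d) → ℂ :=
  fun x => ∑ i, ∑ j, B i j * pderiv i (pderiv j v) x

/-- The coefficients
`L_j u = ∑_{ν-μ=j} ∑_{2ν≥3μ} i^(μ+ν) / (2^ν μ! ν!) (f''(x₀)⁻¹∂·∂)^ν (g_{x₀}^μ u)(x₀)`.
For `ν = j + μ` the condition `2ν ≥ 3μ` says `μ ≤ 2j`, so the sum runs over `0 ≤ μ ≤ 2j`. -/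
def Lop (f : EuclideanSpace ℝ (Fin d) → ℂ) (x₀ : EuclideanSpace ℝ (Fin d)) (j : ℕ)
    (u : EuclideanSpace ℝ (Fin d) → ℂ) : ℂ :=
  ∑ μ ∈ Finset.range (2 * j + 1),
    Complex.I ^ (μ + (j + μ)) /
        ((2 : ℂ) ^ (j + μ) * (μ.factorial : ℂ) * ((j + μ).factorial : ℂ)) *
      (quadOp (hess f x₀)⁻¹)^[j + μ] (fun x => gRem f x₀ x ^ μ * u x) x₀

/-- `(det B)^(-1/2)` for a complex symmetric matrix `B` whose real part is positive definite: the
product of `λ^(-1/2)`, principal branch, over the eigenvalues `λ` of `B` with multiplicity. All of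
these have positive real part, so this is the branch which is continuous on the (convex) set of such
matrices and positive on the real ones; it is in general not the principal power of `det B`. -/
def detInvSqrt (B : Matrix (Fin d) (Fin d) ℂ) : ℂ :=
  (B.charpoly.roots.map fun z => z ^ (-(1 / 2) : ℂ)).prod

end GevreyPhase

end

/-! Put `H = f''(x₀)`, `A = -iH/h`, `y = x - x₀`, and let `g` be the remainder of `f` beyond its
quadratic part. Then `e^{if/h}` is the complex Gaussian `exp(-½ Ay·y)` times `e^{ig/h}`. The
Gaussian forces `|y| ~ √h`, so the part of `(i/h)^μ g^μ u / μ!` of Taylor degree `3μ + l` has size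
`h^{(μ+l)/2}`; lower degrees vanish because `g` vanishes to third order. `approxPoly` keeps exactly
the parts with `μ + l < 2k`.

Main term: integration by parts against the Gaussian lowers the Taylor degree by two and applies
`A⁻¹∂·∂`. Hence odd degrees integrate to zero, degree `2ν` yields `(A⁻¹∂·∂)^ν/(2^ν ν!)` at `x₀`
(`integral_gauss_tay_even`), and grouping by `j = ν - μ` gives the `L_j` exactly
(`integral_gauss_mul_approxPoly`). The total mass of the Gaussian is found by deforming the matrix
to the identity (`integral_gauss_eq_detInvSqrt`).

Error near `x₀`: Taylor coefficients of Gevrey functions have size `Yⁿ n!^{s-1}`, and multiplying by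
`g` repeatedly costs only a geometric factor (`HasGevreyExpansion.pow_mul`). So the remainder of
`g^μ u` past degree `3μ + l` is at most a geometric factor times `l!^{s-1} |y|^{3μ+l}`. Part of the
Gaussian decay pays for `e^{|g|/h}`, as `|g| ≤ ¼ Im Hy·y` on a small ball; another part turns `|y|ⁿ`
into `√n! (C√h)ⁿ`. Together with the `1/μ!` of the exponential series this leaves `(μ+l)!^{s-1/2}
√h^{μ+l}` (`factorial_quotient_le`, `termSize_mul_exp_le`), and `μ + l = 2k` gives `k!^{2s-1} h^k`.

Error away from `x₀`: only the polynomial contributes. The Gaussian supplies a factor `e^{-δ/h}`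
there, which makes up for every missing power of `√h` (`exists_exp_neg_div_le`); it is here that `s
> 1`, and not just `s ≥ 1`, is needed.

The bound on `L_j` is the same count of factorials, with majorant power series for the derivatives
at `x₀` in place of integrals (`norm_Lop_le`). Cutting off near `x₀` reduces everything to functions
smooth on the whole space. -/

noncomputable section

namespace GevreyPhase

variable {d : ℕ}

local notation "𝔼" => EuclideanSpace ℝ (Fin d)

/-! ### Partial derivatives, their commutation, and locality. -/

section Calculus

theorem contDiff_pderiv {F : 𝔼 → ℂ} (hF : ContDiff ℝ ∞ F) (i : Fin d) :
    ContDiff ℝ ∞ (pderiv i F) :=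
  (hF.fderiv_right (m := ∞) (by simp)).clm_apply contDiff_const

theorem pderiv_add {F G : 𝔼 → ℂ} (hF : ContDiff ℝ ∞ F) (hG : ContDiff ℝ ∞ G) (i : Fin d) :
    pderiv i (fun x => F x + G x) = fun x => pderiv i F x + pderiv i G x := by
  funext x
  have h1 := (hF.differentiable (by simp)).differentiableAt (x := x)
  have h2 := (hG.differentiable (by simp)).differentiableAt (x := x)
  simp [pderiv, fderiv_fun_add h1 h2]

theorem pderiv_mul {F G : 𝔼 → ℂ} (hF : ContDiff ℝ ∞ F) (hG : ContDiff ℝ ∞ G) (i : Fin d) :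
    pderiv i (fun x => F x * G x) = fun x => pderiv i F x * G x + F x * pderiv i G x := by
  funext x
  have h1 := (hF.differentiable (by simp)).differentiableAt (x := x)
  have h2 := (hG.differentiable (by simp)).differentiableAt (x := x)
  simp [pderiv, fderiv_fun_mul h1 h2]
  ring

theorem pderiv_const (a : ℂ) (i : Fin d) : pderiv i (fun _ : 𝔼 => a) = fun _ => 0 := by
  funext x
  simp [pderiv]

theorem pderiv_const_mul {F : 𝔼 → ℂ} (hF : ContDiff ℝ ∞ F) (a : ℂ) (i : Fin d) :
    pderiv i (fun x => a * F x) = fun x => a * pderiv i F x := by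
  rw [pderiv_mul contDiff_const hF, pderiv_const]
  simp

theorem pderiv_sum {ι : Type*} (S : Finset ι) {F : ι → 𝔼 → ℂ} (hF : ∀ j, ContDiff ℝ ∞ (F j))
    (i : Fin d) :
    pderiv i (fun x => ∑ j ∈ S, F j x) = fun x => ∑ j ∈ S, pderiv i (F j) x := by
  classical
  induction S using Finset.induction_on with
  | empty => simpa using pderiv_const 0 i
  | insert a S ha ih =>
    simp only [Finset.sum_insert ha]
    rw [pderiv_add (hF a) (ContDiff.sum fun j _ => hF j), ih]

theorem pderiv_coord (i j : Fin d) (a : ℝ) :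
    pderiv i (fun x : 𝔼 => ((x j - a : ℝ) : ℂ)) = fun _ => if i = j then 1 else 0 := by
  funext x
  have h : HasFDerivAt (fun x : 𝔼 => ((x j - a : ℝ) : ℂ))
      (Complex.ofRealCLM.comp (EuclideanSpace.proj j : 𝔼 →L[ℝ] ℝ)) x :=
    Complex.ofRealCLM.hasFDerivAt.comp x
      (((EuclideanSpace.proj j : 𝔼 →L[ℝ] ℝ).hasFDerivAt).sub_const a)
  rw [pderiv, h.fderiv]
  by_cases hij : i = j <;> simp [hij, Ne.symm]

theorem pderiv_comm {F : 𝔼 → ℂ} (hF : ContDiff ℝ ∞ F) (i j : Fin d) :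
    pderiv i (pderiv j F) = pderiv j (pderiv i F) := by
  have key : ∀ (a b : Fin d) (x : 𝔼), pderiv a (pderiv b F) x =
      fderiv ℝ (fderiv ℝ F) x (EuclideanSpace.single a 1) (EuclideanSpace.single b 1) := by
    intro a b x
    have h1 : DifferentiableAt ℝ (fderiv ℝ F) x :=
      ((hF.fderiv_right (m := ∞) (by simp)).differentiable (by simp)).differentiableAt
    unfold pderiv
    rw [fderiv_clm_apply h1 (differentiableAt_const _)]
    simp
  funext x
  rw [key, key]
  exact (hF.contDiffAt.isSymmSndFDerivAt (by
    simpa using (WithTop.coe_le_coe.2 (le_top : (2 : ℕ∞) ≤ ⊤) : (2 : WithTop ℕ∞) ≤ ∞))) _ _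

theorem pderiv_congr {F G : 𝔼 → ℂ} {x : 𝔼} (h : F =ᶠ[nhds x] G) (i : Fin d) :
    pderiv i F =ᶠ[nhds x] pderiv i G :=
  (h.fderiv (𝕜 := ℝ)).mono fun y hy => by simp only [pderiv, hy]

theorem pderiv_iterate_congr {F G : 𝔼 → ℂ} {x : 𝔼} (h : F =ᶠ[nhds x] G) (i : Fin d) (n : ℕ) :
    (pderiv i)^[n] F =ᶠ[nhds x] (pderiv i)^[n] G := by
  induction n with
  | zero => exact h
  | succ n ih =>
    rw [Function.iterate_succ_apply', Function.iterate_succ_apply']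
    exact pderiv_congr ih i

theorem mderiv_congr {F G : 𝔼 → ℂ} {x : 𝔼} (h : F =ᶠ[nhds x] G) (α : Fin d → ℕ) :
    mderiv α F =ᶠ[nhds x] mderiv α G := by
  unfold mderiv
  induction List.finRange d with
  | nil => exact h
  | cons a l ih => exact pderiv_iterate_congr ih a _

theorem hess_congr {F G : 𝔼 → ℂ} {x : 𝔼} (h : F =ᶠ[nhds x] G) : hess F x = hess G x := by
  ext i j
  exact (pderiv_congr (pderiv_congr h j) i).eq_of_nhds

theorem quadOp_congr {F G : 𝔼 → ℂ} {x : 𝔼} (h : F =ᶠ[nhds x] G) (B : Matrix (Fin d) (Fin d) ℂ) :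
    quadOp B F =ᶠ[nhds x] quadOp B G := by
  have : ∀ i j, ∀ᶠ y in nhds x, pderiv i (pderiv j F) y = pderiv i (pderiv j G) y :=
    fun i j => pderiv_congr (pderiv_congr h j) i
  have h2 : ∀ᶠ y in nhds x, ∀ i j, pderiv i (pderiv j F) y = pderiv i (pderiv j G) y :=
    Filter.eventually_all.2 fun i => Filter.eventually_all.2 fun j => this i j
  exact h2.mono fun y hy => by simp only [quadOp, hy]

theorem quadOp_iterate_congr {F G : 𝔼 → ℂ} {x : 𝔼} (h : F =ᶠ[nhds x] G)
    (B : Matrix (Fin d) (Fin d) ℂ) (n : ℕ) :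
    (quadOp B)^[n] F =ᶠ[nhds x] (quadOp B)^[n] G := by
  induction n with
  | zero => exact h
  | succ n ih =>
    rw [Function.iterate_succ_apply', Function.iterate_succ_apply']
    exact quadOp_congr ih B

/-- Only germs at `x₀` enter, so `f` and `u` may later be replaced by cut-off versions. -/
theorem Lop_congr {f f' u u' : 𝔼 → ℂ} {x₀ : 𝔼} (hf : f =ᶠ[nhds x₀] f') (hu : u =ᶠ[nhds x₀] u')
    (j : ℕ) : Lop f x₀ j u = Lop f' x₀ j u' := by
  unfold Lop
  refine Finset.sum_congr rfl fun μ _ => ?_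
  rw [hess_congr hf]
  congr 1
  refine (quadOp_iterate_congr ?_ _ _).eq_of_nhds
  filter_upwards [hf, hu] with y hy hy'
  simp only [gRem, hess_congr hf, hy, hy']

theorem hess_symm {f : 𝔼 → ℂ} (hf : ContDiff ℝ ∞ f) (x : 𝔼) (i j : Fin d) :
    hess f x i j = hess f x j i :=
  congrFun (pderiv_comm hf i j) x

theorem contDiff_quadOp {F : 𝔼 → ℂ} (hF : ContDiff ℝ ∞ F) (B : Matrix (Fin d) (Fin d) ℂ) :
    ContDiff ℝ ∞ (quadOp B F) :=
  ContDiff.sum fun i _ => ContDiff.sum fun j _ =>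
    contDiff_const.mul (contDiff_pderiv (contDiff_pderiv hF j) i)

/-- The iterated partial derivative along a word of coordinate directions. -/
def wderiv (w : List (Fin d)) (F : 𝔼 → ℂ) : 𝔼 → ℂ :=
  w.foldl (fun G i => pderiv i G) F

@[simp] theorem wderiv_nil (F : 𝔼 → ℂ) : wderiv [] F = F := rfl

@[simp] theorem wderiv_cons (i : Fin d) (w : List (Fin d)) (F : 𝔼 → ℂ) :
    wderiv (i :: w) F = wderiv w (pderiv i F) := rfl

theorem wderiv_add {F G : 𝔼 → ℂ} (hF : ContDiff ℝ ∞ F) (hG : ContDiff ℝ ∞ G) (w : List (Fin d)) :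
    wderiv w (fun x => F x + G x) = fun x => wderiv w F x + wderiv w G x := by
  induction w generalizing F G with
  | nil => rfl
  | cons i w ih =>
    simp only [wderiv_cons]
    rw [pderiv_add hF hG, ih (contDiff_pderiv hF i) (contDiff_pderiv hG i)]

theorem contDiff_pderiv_iterate {F : 𝔼 → ℂ} (hF : ContDiff ℝ ∞ F) (i : Fin d) (n : ℕ) :
    ContDiff ℝ ∞ ((pderiv i)^[n] F) := by
  induction n with
  | zero => exact hF
  | succ n ih => rw [Function.iterate_succ_apply']; exact contDiff_pderiv ih i

theorem pderiv_iterate_comm {F : 𝔼 → ℂ} (hF : ContDiff ℝ ∞ F) (i j : Fin d) (n : ℕ) :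
    (pderiv i)^[n] (pderiv j F) = pderiv j ((pderiv i)^[n] F) := by
  induction n with
  | zero => rfl
  | succ n ih =>
    rw [Function.iterate_succ_apply', Function.iterate_succ_apply', ih,
      pderiv_comm (contDiff_pderiv_iterate hF i n)]

theorem foldr_pderiv_comm {F : 𝔼 → ℂ} (hF : ContDiff ℝ ∞ F) (α : Fin d → ℕ) (j : Fin d)
    (l : List (Fin d)) :
    ContDiff ℝ ∞ (l.foldr (fun i v => (pderiv i)^[α i] v) F) ∧
    l.foldr (fun i v => (pderiv i)^[α i] v) (pderiv j F) =
      pderiv j (l.foldr (fun i v => (pderiv i)^[α i] v) F) := by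
  induction l with
  | nil => exact ⟨hF, rfl⟩
  | cons a l ih =>
    refine ⟨contDiff_pderiv_iterate ih.1 a _, ?_⟩
    simp only [List.foldr_cons, ih.2]
    exact pderiv_iterate_comm ih.1 a j _

/-- Commutation moves the extra `∂ⱼ` outermost; `Nodup` ensures that it is picked up only once. -/
theorem foldr_pderiv_add_single {F : 𝔼 → ℂ} (hF : ContDiff ℝ ∞ F) (α : Fin d → ℕ) (j : Fin d)
    (l : List (Fin d)) (hl : l.Nodup) :
    l.foldr (fun i v => (pderiv i)^[(α + Pi.single j 1 : Fin d → ℕ) i] v) F =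
      if j ∈ l then pderiv j (l.foldr (fun i v => (pderiv i)^[α i] v) F)
      else l.foldr (fun i v => (pderiv i)^[α i] v) F := by
  induction l with
  | nil => rfl
  | cons a l ih =>
    obtain ⟨ha, hl'⟩ := List.nodup_cons.1 hl
    simp only [List.foldr_cons, ih hl', List.mem_cons]
    have hs := (foldr_pderiv_comm hF α j l).1
    by_cases hja : j = a
    · subst hja
      simp [ha, Function.iterate_succ_apply']
    · have : (Pi.single j 1 : Fin d → ℕ) a = 0 := by simp [Ne.symm hja]
      simp only [Pi.add_apply, this, add_zero, hja, false_or]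
      by_cases hjl : j ∈ l
      · simp only [hjl, if_true]; exact pderiv_iterate_comm hs a j _
      · simp [hjl]

theorem mderiv_pderiv {F : 𝔼 → ℂ} (hF : ContDiff ℝ ∞ F) (α : Fin d → ℕ) (j : Fin d) :
    mderiv α (pderiv j F) = mderiv (α + Pi.single j 1) F := by
  unfold mderiv
  rw [foldr_pderiv_add_single hF α j _ (List.nodup_finRange d), (foldr_pderiv_comm hF α j _).2]
  simp

/-- Words suit inductions that peel off one derivative at a time; this transfers to them the
hypotheses on multi-indices. -/
theorem exists_mderiv_eq_wderiv {F : 𝔼 → ℂ} (hF : ContDiff ℝ ∞ F) (w : List (Fin d)) :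
    ∃ α : Fin d → ℕ, ∑ i, α i = w.length ∧ wderiv w F = mderiv α F := by
  induction w generalizing F with
  | nil =>
    refine ⟨0, by simp, ?_⟩
    unfold mderiv
    simp only [Pi.zero_apply, Function.iterate_zero, id_eq, wderiv_nil]
    induction List.finRange d with
    | nil => rfl
    | cons a l ih => simp
  | cons i w ih =>
    obtain ⟨α, h1, h2⟩ := ih (contDiff_pderiv hF i)
    refine ⟨α + Pi.single i 1, ?_, ?_⟩
    · simp [Finset.sum_add_distrib, h1]
    · rw [wderiv_cons, h2, mderiv_pderiv hF]

theorem GevreyBoundOn.norm_wderiv_le {s A C : ℝ} {V : Set 𝔼} {F : 𝔼 → ℂ} (hs : 0 ≤ s) (hA : 0 ≤ A)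
    (hC : 0 ≤ C) (h : GevreyBoundOn s A C V F) (hF : ContDiff ℝ ∞ F) (w : List (Fin d)) {x : 𝔼}
    (hx : x ∈ V) : ‖wderiv w F x‖ ≤ A * C ^ w.length * (w.length.factorial : ℝ) ^ s := by
  obtain ⟨α, h1, h2⟩ := exists_mderiv_eq_wderiv hF w
  rw [h2, ← h1]
  refine (h α x hx).trans ?_
  gcongr
  exact Nat.le_of_dvd (Nat.factorial_pos _) (Nat.prod_factorial_dvd_factorial_sum _ _)

theorem GevreyBoundOn.congr {s A C : ℝ} {V : Set 𝔼} {F G : 𝔼 → ℂ} (h : GevreyBoundOn s A C V F)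
    (hFG : ∀ x ∈ V, F =ᶠ[nhds x] G) : GevreyBoundOn s A C V G := fun α x hx => by
  rw [← (mderiv_congr (hFG x hx) α).eq_of_nhds]
  exact h α x hx

end Calculus

/-! ### Homogeneous Taylor components, formal Taylor series along rays, remainders. -/

section Taylor

open PowerSeries

/-- The homogeneous component of degree `n` of the Taylor expansion at `x₀`, evaluated at the
increment `x`. -/
def tay (x₀ : 𝔼) : ℕ → (𝔼 → ℂ) → 𝔼 → ℂ
  | 0, F, _ => F x₀
  | n + 1, F, x => ((n : ℂ) + 1)⁻¹ * ∑ i, (x i : ℂ) * tay x₀ n (pderiv i F) x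

variable (x₀ : EuclideanSpace ℝ (Fin d))

theorem succ_mul_tay (n : ℕ) (F : 𝔼 → ℂ) (x : 𝔼) :
    ((n : ℂ) + 1) * tay x₀ (n + 1) F x = ∑ i, (x i : ℂ) * tay x₀ n (pderiv i F) x := by
  rw [tay, mul_inv_cancel_left₀ (Nat.cast_add_one_ne_zero n)]

theorem tay_add {F G : 𝔼 → ℂ} (hF : ContDiff ℝ ∞ F) (hG : ContDiff ℝ ∞ G) (n : ℕ) (x : 𝔼) :
    tay x₀ n (fun y => F y + G y) x = tay x₀ n F x + tay x₀ n G x := by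
  induction n generalizing F G with
  | zero => rfl
  | succ n ih =>
    simp only [tay]
    rw [← mul_add, ← Finset.sum_add_distrib]
    congr 1
    refine Finset.sum_congr rfl fun i _ => ?_
    rw [pderiv_add hF hG, ih (contDiff_pderiv hF i) (contDiff_pderiv hG i), mul_add]

theorem tay_const_mul {F : 𝔼 → ℂ} (hF : ContDiff ℝ ∞ F) (a : ℂ) (n : ℕ) (x : 𝔼) :
    tay x₀ n (fun y => a * F y) x = a * tay x₀ n F x := by
  induction n generalizing F with
  | zero => rfl
  | succ n ih =>
    simp only [tay]
    rw [mul_left_comm]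
    congr 1
    rw [Finset.mul_sum]
    refine Finset.sum_congr rfl fun i _ => ?_
    rw [pderiv_const_mul hF, ih (contDiff_pderiv hF i), mul_left_comm]

theorem tay_zero (n : ℕ) (x : 𝔼) : tay x₀ n (fun _ => 0) x = 0 := by
  simpa using tay_const_mul x₀ (contDiff_const (c := (0 : ℂ))) 0 n x

theorem tay_sum {ι : Type*} (S : Finset ι) {F : ι → 𝔼 → ℂ} (hF : ∀ j, ContDiff ℝ ∞ (F j)) (n : ℕ)
    (x : 𝔼) : tay x₀ n (fun y => ∑ j ∈ S, F j y) x = ∑ j ∈ S, tay x₀ n (F j) x := by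
  classical
  induction S using Finset.induction_on with
  | empty => simpa using tay_zero x₀ n x
  | insert a S ha ih =>
    simp only [Finset.sum_insert ha]
    rw [tay_add x₀ (hF a) (ContDiff.sum fun j _ => hF j), ih]

theorem tay_quadOp {F : 𝔼 → ℂ} (hF : ContDiff ℝ ∞ F) (B : Matrix (Fin d) (Fin d) ℂ) (n : ℕ)
    (x : 𝔼) :
    tay x₀ n (quadOp B F) x = ∑ i, ∑ j, B i j * tay x₀ n (pderiv i (pderiv j F)) x := by
  have h2 : ∀ i j, ContDiff ℝ ∞ (pderiv i (pderiv j F)) :=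
    fun i j => contDiff_pderiv (contDiff_pderiv hF j) i
  refine (tay_sum x₀ Finset.univ (F := fun i x => ∑ j, B i j * pderiv i (pderiv j F) x)
    (fun i => ContDiff.sum fun j _ => contDiff_const.mul (h2 i j)) n x).trans ?_
  refine Finset.sum_congr rfl fun i _ => ?_
  refine (tay_sum x₀ Finset.univ (F := fun j x => B i j * pderiv i (pderiv j F) x)
    (fun j => contDiff_const.mul (h2 i j)) n x).trans ?_
  exact Finset.sum_congr rfl fun j _ => tay_const_mul x₀ (h2 i j) _ _ _

/-- The Taylor expansion at `x₀` along the ray with direction `x`, as a formal power series. -/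
def taySeries (F : 𝔼 → ℂ) (x : 𝔼) : ℂ⟦X⟧ := PowerSeries.mk fun n => tay x₀ n F x

theorem coeff_taySeries (F : 𝔼 → ℂ) (x : 𝔼) (n : ℕ) :
    coeff n (taySeries x₀ F x) = tay x₀ n F x := coeff_mk _ _

theorem derivative_taySeries (F : 𝔼 → ℂ) (x : 𝔼) :
    d⁄dX ℂ (taySeries x₀ F x) = ∑ i, C (x i : ℂ) * taySeries x₀ (pderiv i F) x := by
  ext n
  rw [coeff_derivative, coeff_taySeries, mul_comm, succ_mul_tay, map_sum]
  simp [coeff_C_mul, coeff_taySeries]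

/-- Both sides have the same constant term and obey the Leibniz rule for the radial derivative. This
reduces degree `n + 1` for `(F, G)` to degree `n` for the pairs `(∂ᵢF, G)` and `(F, ∂ᵢG)`, so the
induction runs over all pairs at once. -/
theorem taySeries_mul {F G : 𝔼 → ℂ} (hF : ContDiff ℝ ∞ F) (hG : ContDiff ℝ ∞ G) (x : 𝔼) :
    taySeries x₀ (fun y => F y * G y) x = taySeries x₀ F x * taySeries x₀ G x := by
  ext n
  induction n generalizing F G with
  | zero => simp [taySeries, tay, coeff_mul]
  | succ n ih =>
    have hn : ((n : ℂ) + 1) ≠ 0 := Nat.cast_add_one_ne_zero n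
    refine mul_right_cancel₀ hn ?_
    rw [← coeff_derivative, ← coeff_derivative, Derivation.leibniz, derivative_taySeries,
      derivative_taySeries, derivative_taySeries, smul_eq_mul, smul_eq_mul, Finset.mul_sum,
      Finset.mul_sum, ← Finset.sum_add_distrib, map_sum, map_sum]
    refine Finset.sum_congr rfl fun i _ => ?_
    have hFi := contDiff_pderiv hF i
    have hGi := contDiff_pderiv hG i
    rw [pderiv_mul hF hG, coeff_C_mul, coeff_taySeries, tay_add x₀ (hFi.mul hG) (hF.mul hGi),
      ← coeff_taySeries, ← coeff_taySeries, ih hFi hG, ih hF hGi, ← map_add, ← coeff_C_mul]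
    congr 1
    ring

theorem taySeries_pow_mul {F G : 𝔼 → ℂ} (hF : ContDiff ℝ ∞ F) (hG : ContDiff ℝ ∞ G) (μ : ℕ)
    (x : 𝔼) :
    taySeries x₀ (fun y => F y ^ μ * G y) x = taySeries x₀ F x ^ μ * taySeries x₀ G x := by
  induction μ with
  | zero => simp
  | succ μ ih =>
    have : (fun y => F y ^ (μ + 1) * G y) = fun y => F y * (F y ^ μ * G y) := by
      funext y; ring
    rw [this, taySeries_mul x₀ hF ((hF.pow μ).mul hG), ih]
    ring

theorem contDiff_tay (n : ℕ) (F : 𝔼 → ℂ) : ContDiff ℝ ∞ (tay x₀ n F) := by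
  induction n generalizing F with
  | zero => exact contDiff_const
  | succ n ih =>
    refine contDiff_const.mul (ContDiff.sum fun i _ => ?_)
    exact (Complex.ofRealCLM.contDiff.comp (EuclideanSpace.proj i : 𝔼 →L[ℝ] ℝ).contDiff).mul (ih _)

theorem tay_smul (n : ℕ) (F : 𝔼 → ℂ) (t : ℝ) (x : 𝔼) :
    tay x₀ n F (t • x) = (t : ℂ) ^ n * tay x₀ n F x := by
  induction n generalizing F with
  | zero => simp [tay]
  | succ n ih =>
    simp only [tay, ih]
    rw [mul_left_comm]
    congr 1
    rw [Finset.mul_sum]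
    refine Finset.sum_congr rfl fun i _ => ?_
    simp
    ring

theorem pderiv_tay_zero (i : Fin d) (F : 𝔼 → ℂ) : pderiv i (tay x₀ 0 F) = fun _ => 0 :=
  pderiv_const _ i

theorem pderiv_tay_succ {F : 𝔼 → ℂ} (hF : ContDiff ℝ ∞ F) (n : ℕ) (i : Fin d) :
    pderiv i (tay x₀ (n + 1) F) = tay x₀ n (pderiv i F) := by
  have hc : ∀ j : Fin d, ContDiff ℝ ∞ fun x : 𝔼 => (x j : ℂ) := fun j =>
    Complex.ofRealCLM.contDiff.comp (EuclideanSpace.proj j : 𝔼 →L[ℝ] ℝ).contDiff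
  have hcd : ∀ j : Fin d, pderiv i (fun x : 𝔼 => (x j : ℂ)) = fun _ => if i = j then 1 else 0 := by
    intro j
    simpa using pderiv_coord i j 0
  -- Product rule in the recursion for `tay`. By induction the last sum is `n` copies of the first
  -- term, so the factor `n + 1` cancels.
  have hstep : ∀ (n : ℕ) (F : 𝔼 → ℂ) (x : 𝔼), ((n : ℂ) + 1) * pderiv i (tay x₀ (n + 1) F) x =
      tay x₀ n (pderiv i F) x + ∑ j, (x j : ℂ) * pderiv i (tay x₀ n (pderiv j F)) x := by
    intro n F x
    have h : tay x₀ (n + 1) F =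
        fun x => ((n : ℂ) + 1)⁻¹ * ∑ j, (x j : ℂ) * tay x₀ n (pderiv j F) x := rfl
    rw [h, pderiv_const_mul (ContDiff.sum fun j _ => (hc j).mul (contDiff_tay x₀ n _)),
      pderiv_sum _ fun j => (hc j).mul (contDiff_tay x₀ n _),
      mul_inv_cancel_left₀ (Nat.cast_add_one_ne_zero n)]
    simp only [pderiv_mul (hc _) (contDiff_tay x₀ n _), hcd, Finset.sum_add_distrib]
    simp
  induction n generalizing F with
  | zero =>
    funext x
    simpa [pderiv_tay_zero] using hstep 0 F x
  | succ n ih =>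
    funext x
    refine mul_left_cancel₀ (Nat.cast_add_one_ne_zero (n + 1) : (((n + 1 : ℕ) : ℂ) + 1) ≠ 0) ?_
    rw [hstep]
    simp only [fun j => ih (contDiff_pderiv hF j), pderiv_comm hF i, ← succ_mul_tay]
    push_cast
    ring

theorem hasDerivAt_ray {F : 𝔼 → ℂ} (hF : ContDiff ℝ ∞ F) (x : 𝔼) (t : ℝ) :
    HasDerivAt (fun t : ℝ => F (x₀ + t • x)) (∑ i, (x i : ℂ) * pderiv i F (x₀ + t • x)) t := by
  have h1 : HasFDerivAt F (fderiv ℝ F (x₀ + t • x)) (x₀ + t • x) :=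
    ((hF.differentiable (by simp)).differentiableAt).hasFDerivAt
  have h2 : HasDerivAt (fun t : ℝ => x₀ + t • x) x t := by
    simpa using ((hasDerivAt_id t).smul_const x).const_add x₀
  have h3 := h1.comp_hasDerivAt t h2
  have hx : x = ∑ i, x i • EuclideanSpace.single i (1 : ℝ) := by
    ext j
    simp [Finset.sum_apply, Pi.single_apply]
  have : fderiv ℝ F (x₀ + t • x) x = ∑ i, (x i : ℂ) * pderiv i F (x₀ + t • x) := by
    conv_lhs => arg 2; rw [hx]
    rw [map_sum]
    refine Finset.sum_congr rfl fun i _ => ?_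
    rw [map_smul]; simp [pderiv]
  rw [this] at h3
  exact h3

theorem hasDerivAt_tay_succ (n : ℕ) (F : 𝔼 → ℂ) (x : 𝔼) (t : ℝ) :
    HasDerivAt (fun t : ℝ => tay x₀ (n + 1) F (t • x))
      (∑ i, (x i : ℂ) * tay x₀ n (pderiv i F) (t • x)) t := by
  simp only [tay_smul]
  have h : HasDerivAt (fun t : ℝ => (t : ℂ) ^ (n + 1)) (((n + 1 : ℕ) : ℂ) * (t : ℂ) ^ n) t := by
    simpa using (hasDerivAt_pow (n + 1) (t : ℂ)).comp_ofReal
  refine (h.mul_const (tay x₀ (n + 1) F x)).congr_deriv ?_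
  have h2 := succ_mul_tay x₀ n F x
  push_cast
  rw [mul_right_comm, h2, Finset.sum_mul]
  exact Finset.sum_congr rfl fun i _ => by ring

theorem sum_abs_coord_le (x : 𝔼) : ∑ i, |x i| ≤ d * ‖x‖ := by
  calc ∑ i, |x i| ≤ ∑ _i : Fin d, ‖x‖ := Finset.sum_le_sum fun i _ => by
        simpa using PiLp.norm_apply_le x i
    _ = d * ‖x‖ := by simp

theorem norm_sum_coord_mul_le (x : 𝔼) (z : Fin d → ℂ) {M : ℝ} (hz : ∀ i, ‖z i‖ ≤ M) (hM : 0 ≤ M) :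
    ‖∑ i, (x i : ℂ) * z i‖ ≤ d * ‖x‖ * M := by
  calc ‖∑ i, (x i : ℂ) * z i‖ ≤ ∑ i, |x i| * M := norm_sum_le_of_le _ fun i _ => by
        rw [norm_mul, Complex.norm_real, Real.norm_eq_abs]
        exact mul_le_mul_of_nonneg_left (hz i) (abs_nonneg _)
    _ = (∑ i, |x i|) * M := by rw [Finset.sum_mul]
    _ ≤ _ := mul_le_mul_of_nonneg_right (sum_abs_coord_le x) hM

theorem norm_tay_le (n : ℕ) (F : 𝔼 → ℂ) {M : ℝ} (hM : 0 ≤ M)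
    (h : ∀ w : List (Fin d), w.length = n → ‖wderiv w F x₀‖ ≤ M) (x : 𝔼) :
    ‖tay x₀ n F x‖ ≤ M * (d * ‖x‖) ^ n / n.factorial := by
  induction n generalizing F with
  | zero => simpa [tay] using h [] rfl
  | succ n ih =>
    have h1 : ∀ i, ‖tay x₀ n (pderiv i F) x‖ ≤ M * (d * ‖x‖) ^ n / n.factorial := fun i =>
      ih _ fun w hw => h (i :: w) (by simp [hw])
    have h2 := norm_sum_coord_mul_le x (fun i => tay x₀ n (pderiv i F) x) h1 (by positivity)
    rw [tay, norm_mul, norm_inv, ← Nat.cast_succ, Complex.norm_natCast, Nat.factorial_succ]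
    rw [inv_mul_le_iff₀ (by positivity)]
    refine h2.trans (le_of_eq ?_)
    push_cast
    field_simp
    ring

/-- The `t`-derivative of the remainder of order `N + 1` along the ray is `∑ xᵢ` times the
remainders of order `N` of `∂ᵢF`. The bound is then integrated in `t` by comparison with a function
that has the matching derivative. -/
theorem norm_sub_sum_tay_le (N : ℕ) {F : 𝔼 → ℂ} (hF : ContDiff ℝ ∞ F) {M : ℝ} (hM : 0 ≤ M) (x : 𝔼)
    (h : ∀ w : List (Fin d), w.length = N → ∀ t ∈ Set.Icc (0 : ℝ) 1, ‖wderiv w F (x₀ + t • x)‖ ≤ M)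
    {t : ℝ} (ht : t ∈ Set.Icc (0 : ℝ) 1) :
    ‖F (x₀ + t • x) - ∑ n ∈ Finset.range N, tay x₀ n F (t • x)‖ ≤
      M * (d * ‖x‖) ^ N * t ^ N / N.factorial := by
  induction N generalizing F t with
  | zero => simpa using h [] rfl t ht
  | succ N ih =>
    have h1 : ∀ i, ∀ t ∈ Set.Icc (0 : ℝ) 1, ‖pderiv i F (x₀ + t • x) -
        ∑ n ∈ Finset.range N, tay x₀ n (pderiv i F) (t • x)‖ ≤
        M * (d * ‖x‖) ^ N * t ^ N / N.factorial := fun i t ht =>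
      ih (contDiff_pderiv hF i) (fun w hw => h (i :: w) (by simp [hw])) ht
    set φ : ℝ → ℂ := fun t => F (x₀ + t • x) - ∑ n ∈ Finset.range (N + 1), tay x₀ n F (t • x)
    have hφ : ∀ t, HasDerivAt φ (∑ i, (x i : ℂ) * (pderiv i F (x₀ + t • x) -
        ∑ n ∈ Finset.range N, tay x₀ n (pderiv i F) (t • x))) t := by
      intro t
      have e1 := hasDerivAt_ray x₀ hF x t
      have e2 : HasDerivAt (fun t : ℝ => ∑ n ∈ Finset.range (N + 1), tay x₀ n F (t • x))
          (∑ n ∈ Finset.range N, ∑ i, (x i : ℂ) * tay x₀ n (pderiv i F) (t • x)) t := by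
        simp only [Finset.sum_range_succ']
        refine (HasDerivAt.fun_sum fun n _ => hasDerivAt_tay_succ x₀ n F x t).add_const _
      refine (e1.sub e2).congr_deriv ?_
      simp only [mul_sub, Finset.sum_sub_distrib, Finset.mul_sum]
      rw [Finset.sum_comm]
    have hB : ∀ t : ℝ, HasDerivAt
        (fun t : ℝ => M * (d * ‖x‖) ^ (N + 1) * t ^ (N + 1) / (N + 1).factorial)
        (d * ‖x‖ * (M * (d * ‖x‖) ^ N * t ^ N / N.factorial)) t := by
      intro t
      have := ((hasDerivAt_pow (N + 1) t).const_mul (M * (d * ‖x‖) ^ (N + 1))).div_const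
        ((N + 1).factorial : ℝ)
      refine this.congr_deriv ?_
      rw [Nat.factorial_succ]
      push_cast
      field_simp
      ring
    refine image_norm_le_of_norm_deriv_right_le_deriv_boundary (a := 0) (b := 1) (f := φ)
      (fun t _ => (hφ t).continuousAt.continuousWithinAt)
      (fun t _ => (hφ t).hasDerivWithinAt) ?_ hB (fun t ht => ?_) ht
    · simp only [φ, Finset.sum_range_succ', tay_smul]
      simp [tay]
    · have ht' : t ∈ Set.Icc (0 : ℝ) 1 := ⟨ht.1, ht.2.le⟩
      have := ht.1
      exact norm_sum_coord_mul_le x _ (fun i => h1 i t ht') (by positivity)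

end Taylor

/-! ### Moments of complex Gaussians by integration by parts. -/

section Gaussian

/-- The quadratic form `Ax·x` of a complex matrix on `ℝᵈ`. -/
def quad (A : Matrix (Fin d) (Fin d) ℂ) (x : 𝔼) : ℂ :=
  ∑ i, ∑ j, A i j * (x i : ℂ) * (x j : ℂ)

/-- The complex Gaussian `exp(-½ Ax·x)`. -/
def gauss (A : Matrix (Fin d) (Fin d) ℂ) (x : 𝔼) : ℂ := Complex.exp (-(1 / 2) * quad A x)

/-- Functions of at most polynomial growth. -/
def PolyGrowth (R : 𝔼 → ℂ) : Prop := ∃ (C : ℝ) (n : ℕ), 0 ≤ C ∧ ∀ x, ‖R x‖ ≤ C * (1 + ‖x‖) ^ n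

theorem PolyGrowth.const (a : ℂ) : PolyGrowth (fun _ : 𝔼 => a) :=
  ⟨‖a‖, 0, norm_nonneg _, by simp⟩

theorem PolyGrowth.coord (i : Fin d) : PolyGrowth (fun x : 𝔼 => (x i : ℂ)) :=
  ⟨1, 1, zero_le_one, fun x => by
    have := PiLp.norm_apply_le x i
    simp only [Complex.norm_real, one_mul, pow_one]
    linarith⟩

theorem PolyGrowth.mul {R S : 𝔼 → ℂ} (hR : PolyGrowth R) (hS : PolyGrowth S) :
    PolyGrowth (fun x => R x * S x) := by
  obtain ⟨C, n, hC, h⟩ := hR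
  obtain ⟨C', n', hC', h'⟩ := hS
  refine ⟨C * C', n + n', by positivity, fun x => ?_⟩
  rw [norm_mul, pow_add, mul_mul_mul_comm]
  exact mul_le_mul (h x) (h' x) (norm_nonneg _) (by positivity)

theorem PolyGrowth.add {R S : 𝔼 → ℂ} (hR : PolyGrowth R) (hS : PolyGrowth S) :
    PolyGrowth (fun x => R x + S x) := by
  obtain ⟨C, n, hC, h⟩ := hR
  obtain ⟨C', n', hC', h'⟩ := hS
  refine ⟨C + C', n + n', by positivity, fun x => ?_⟩
  have h1 : (1 : ℝ) ≤ 1 + ‖x‖ := by linarith [norm_nonneg x]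
  calc ‖R x + S x‖ ≤ C * (1 + ‖x‖) ^ n + C' * (1 + ‖x‖) ^ n' :=
        (norm_add_le _ _).trans (add_le_add (h x) (h' x))
    _ ≤ C * (1 + ‖x‖) ^ (n + n') + C' * (1 + ‖x‖) ^ (n + n') := by
        gcongr <;> first | exact h1 | omega
    _ = _ := by ring

theorem PolyGrowth.sum {ι : Type*} (S : Finset ι) {R : ι → 𝔼 → ℂ} (hR : ∀ j, PolyGrowth (R j)) :
    PolyGrowth (fun x => ∑ j ∈ S, R j x) := by
  classical
  induction S using Finset.induction_on with
  | empty => simpa using PolyGrowth.const 0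
  | insert a S ha ih =>
    simp only [Finset.sum_insert ha]
    exact (hR a).add ih

theorem polyGrowth_tay (x₀ : EuclideanSpace ℝ (Fin d)) (n : ℕ) (F : 𝔼 → ℂ) :
    PolyGrowth (tay x₀ n F) := by
  induction n generalizing F with
  | zero => exact PolyGrowth.const _
  | succ n ih => exact (PolyGrowth.const _).mul (PolyGrowth.sum _ fun i => (PolyGrowth.coord i).mul (ih _))

theorem integrable_exp_neg_mul_sq_norm {b : ℝ} (hb : 0 < b) :
    Integrable (fun x : 𝔼 => Real.exp (-b * ‖x‖ ^ 2)) := by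
  have h := (GaussianFourier.integrable_cexp_neg_mul_sq_norm_add (V := EuclideanSpace ℝ (Fin d))
    (b := (b : ℂ)) (by simpa using hb) 0 0).norm
  refine h.congr (Filter.Eventually.of_forall fun x => ?_)
  simp [Complex.norm_exp, ← Complex.ofReal_pow]

theorem integrable_pow_mul_exp {b : ℝ} (hb : 0 < b) (n : ℕ) :
    Integrable (fun x : 𝔼 => (1 + ‖x‖) ^ n * Real.exp (-b * ‖x‖ ^ 2)) := by
  refine Integrable.mono' ((integrable_exp_neg_mul_sq_norm (d := d) (half_pos hb)).const_mul
    (n.factorial * Real.exp (1 + 1 / (2 * b)))) (by fun_prop) ?_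
  refine Filter.Eventually.of_forall fun x => ?_
  have hx := norm_nonneg x
  have h1 : (1 + ‖x‖) ^ n ≤ n.factorial * Real.exp (1 + ‖x‖) := by
    have := Real.pow_div_factorial_le_exp (1 + ‖x‖) (by positivity) n
    rwa [div_le_iff₀' (by positivity)] at this
  have h2 : ‖x‖ ≤ b / 2 * ‖x‖ ^ 2 + 1 / (2 * b) := by
    have : 0 ≤ (b * ‖x‖ - 1) ^ 2 / (2 * b) := by positivity
    have e : (b * ‖x‖ - 1) ^ 2 / (2 * b) = b / 2 * ‖x‖ ^ 2 + 1 / (2 * b) - ‖x‖ := by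
      field_simp; ring
    linarith
  rw [Real.norm_of_nonneg (by positivity), mul_assoc, ← Real.exp_add]
  calc _ ≤ n.factorial * Real.exp (1 + ‖x‖) * Real.exp (-b * ‖x‖ ^ 2) := by gcongr
    _ = n.factorial * Real.exp (1 + ‖x‖ + -b * ‖x‖ ^ 2) := by rw [mul_assoc, ← Real.exp_add]
    _ ≤ _ := mul_le_mul_of_nonneg_left (Real.exp_le_exp.2 (by linarith)) (by positivity)

theorem contDiff_coord (i : Fin d) : ContDiff ℝ ∞ fun x : 𝔼 => (x i : ℂ) :=
  Complex.ofRealCLM.contDiff.comp (EuclideanSpace.proj i : 𝔼 →L[ℝ] ℝ).contDiff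

theorem contDiff_quad (A : Matrix (Fin d) (Fin d) ℂ) : ContDiff ℝ ∞ (quad A) :=
  ContDiff.sum fun i _ => ContDiff.sum fun j _ =>
    (contDiff_const.mul (contDiff_coord i)).mul (contDiff_coord j)

theorem contDiff_gauss (A : Matrix (Fin d) (Fin d) ℂ) : ContDiff ℝ ∞ (gauss A) :=
  (contDiff_const.mul (contDiff_quad A)).cexp

theorem norm_gauss (A : Matrix (Fin d) (Fin d) ℂ) (x : 𝔼) :
    ‖gauss A x‖ = Real.exp (-(1 / 2) * (quad A x).re) := by
  have : (-(1 / 2) * quad A x).re = -(1 / 2) * (quad A x).re := by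
    simp
  rw [gauss, Complex.norm_exp, this]

variable {A : Matrix (Fin d) (Fin d) ℂ} {a : ℝ}

theorem norm_gauss_le (hA : ∀ x : 𝔼, a * ‖x‖ ^ 2 ≤ (quad A x).re) (x : 𝔼) :
    ‖gauss A x‖ ≤ Real.exp (-(a / 2) * ‖x‖ ^ 2) := by
  rw [norm_gauss, Real.exp_le_exp]
  linarith [hA x]

theorem integrable_gauss_mul (ha : 0 < a) (hA : ∀ x : 𝔼, a * ‖x‖ ^ 2 ≤ (quad A x).re) {R : 𝔼 → ℂ}
    (hR : PolyGrowth R) (hRc : Continuous R) : Integrable fun x => gauss A x * R x := by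
  obtain ⟨C, n, hC, h⟩ := hR
  refine Integrable.mono' ((integrable_pow_mul_exp (d := d) (half_pos ha) n).const_mul C)
    ((contDiff_gauss A).continuous.mul hRc).aestronglyMeasurable ?_
  refine Filter.Eventually.of_forall fun x => ?_
  rw [norm_mul, mul_comm, ← mul_assoc]
  exact mul_le_mul (h x) (norm_gauss_le hA x) (norm_nonneg _) (by positivity)

theorem pderiv_coord_zero (i j : Fin d) :
    pderiv i (fun x : 𝔼 => (x j : ℂ)) = fun _ => if i = j then 1 else 0 := by
  simpa using pderiv_coord i j 0

theorem pderiv_quad (hs : ∀ i j, A i j = A j i) (l : Fin d) :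
    pderiv l (quad A) = fun x => 2 * ∑ i, A l i * (x i : ℂ) := by
  have h : quad A = fun x : 𝔼 => ∑ i, ∑ j, A i j * ((x i : ℂ) * (x j : ℂ)) := by
    funext x; simp only [quad, mul_assoc]
  have hm : ∀ i j : Fin d, ContDiff ℝ ∞ fun x : 𝔼 => (x i : ℂ) * (x j : ℂ) :=
    fun i j => (contDiff_coord i).mul (contDiff_coord j)
  rw [h, pderiv_sum _ (F := fun i (x : 𝔼) => ∑ j, A i j * ((x i : ℂ) * (x j : ℂ)))
    fun i => ContDiff.sum fun j _ => contDiff_const.mul (hm i j)]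
  funext x
  have : ∀ i, pderiv l (fun x : 𝔼 => ∑ j, A i j * ((x i : ℂ) * (x j : ℂ))) x =
      ∑ j, A i j * ((if l = i then 1 else 0) * (x j : ℂ) + (x i : ℂ) * (if l = j then 1 else 0)) := by
    intro i
    rw [pderiv_sum _ (F := fun j (x : 𝔼) => A i j * ((x i : ℂ) * (x j : ℂ)))
      fun j => contDiff_const.mul (hm i j)]
    refine Finset.sum_congr rfl fun j _ => ?_
    rw [pderiv_const_mul (hm i j), pderiv_mul (contDiff_coord i) (contDiff_coord j),
      pderiv_coord_zero, pderiv_coord_zero]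
  simp only [this, mul_add, Finset.sum_add_distrib]
  rw [two_mul]
  congr 1
  · simp [Finset.sum_ite_eq]
  · simp [hs _ l]

theorem pderiv_gauss (hs : ∀ i j, A i j = A j i) (l : Fin d) :
    pderiv l (gauss A) = fun x => -(∑ i, A l i * (x i : ℂ)) * gauss A x := by
  funext x
  have hq := contDiff_const (c := (-(1 / 2) : ℂ)).mul (contDiff_quad A)
  have h := ((hq.differentiable (by simp)).differentiableAt (x := x)).hasFDerivAt.cexp
  have h2 : pderiv l (fun x => -(1 / 2) * quad A x) x = -∑ i, A l i * (x i : ℂ) := by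
    rw [pderiv_const_mul (contDiff_quad A), pderiv_quad hs]
    ring
  have h3 : pderiv l (gauss A) x = gauss A x * pderiv l (fun x => -(1 / 2) * quad A x) x := by
    unfold pderiv
    rw [show fderiv ℝ (gauss A) x = _ from h.fderiv]
    rfl
  rw [h3, h2]
  ring

/-- Integration by parts, as `∂ₗ` of the Gaussian is `-(Ax)ₗ` times the Gaussian. -/
theorem integral_gauss_pderiv (ha : 0 < a) (hA : ∀ x : 𝔼, a * ‖x‖ ^ 2 ≤ (quad A x).re)
    (hs : ∀ i j, A i j = A j i) {R : 𝔼 → ℂ} (hR : ContDiff ℝ ∞ R) (hRg : PolyGrowth R) (l : Fin d)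
    (hRl : PolyGrowth (pderiv l R)) :
    ∫ x, gauss A x * pderiv l R x = ∑ i, A l i * ∫ x, gauss A x * ((x i : ℂ) * R x) := by
  have hcd : ∀ i, PolyGrowth (fun x : 𝔼 => (x i : ℂ) * R x) := fun i => (PolyGrowth.coord i).mul hRg
  have hint : ∀ i, Integrable fun x : 𝔼 => gauss A x * ((x i : ℂ) * R x) := fun i =>
    integrable_gauss_mul ha hA (hcd i) ((contDiff_coord i).mul hR).continuous
  have hsum : (fun x => pderiv l (gauss A) x * R x) =
      fun x => -∑ i, A l i * (gauss A x * ((x i : ℂ) * R x)) := by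
    funext x
    rw [pderiv_gauss hs]
    simp only [neg_mul, Finset.sum_mul]
    congr 1
    exact Finset.sum_congr rfl fun i _ => by ring
  have hsi : Integrable fun x => pderiv l (gauss A) x * R x := by
    rw [hsum]
    exact (integrable_finsetSum _ fun i _ => (hint i).const_mul _).neg
  have h := integral_mul_fderiv_eq_neg_fderiv_mul_of_integrable (μ := volume) (f := gauss A) (g := R)
    (v := EuclideanSpace.single l (1 : ℝ)) hsi
    (integrable_gauss_mul ha hA hRl (contDiff_pderiv hR l).continuous)
    (integrable_gauss_mul ha hA hRg hR.continuous)
    (fun x _ => ((contDiff_gauss A).differentiable (by simp)).differentiableAt)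
    (fun x _ => (hR.differentiable (by simp)).differentiableAt)
  refine h.trans ?_
  change -∫ x, pderiv l (gauss A) x * R x = _
  rw [hsum, integral_neg, neg_neg, integral_finsetSum _ fun i _ => (hint i).const_mul _]
  simp only [integral_const_mul]

theorem integral_gauss_coord_mul (ha : 0 < a) (hA : ∀ x : 𝔼, a * ‖x‖ ^ 2 ≤ (quad A x).re)
    (hs : ∀ i j, A i j = A j i) {B : Matrix (Fin d) (Fin d) ℂ} (hB : B * A = 1)
    {R : 𝔼 → ℂ} (hR : ContDiff ℝ ∞ R) (hRg : PolyGrowth R) (hRl : ∀ l, PolyGrowth (pderiv l R))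
    (i : Fin d) :
    ∫ x, gauss A x * ((x i : ℂ) * R x) = ∑ l, B i l * ∫ x, gauss A x * pderiv l R x := by
  simp only [fun l => integral_gauss_pderiv ha hA hs hR hRg l (hRl l), Finset.mul_sum, ← mul_assoc]
  rw [Finset.sum_comm]
  simp only [← Finset.sum_mul, ← Matrix.mul_apply, hB, Matrix.one_apply]
  simp

theorem polyGrowth_pderiv_tay (x₀ : EuclideanSpace ℝ (Fin d)) (n : ℕ) {F : 𝔼 → ℂ}
    (hF : ContDiff ℝ ∞ F) (l : Fin d) : PolyGrowth (pderiv l (tay x₀ n F)) := by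
  cases n with
  | zero => rw [pderiv_tay_zero]; exact PolyGrowth.const 0
  | succ n => rw [pderiv_tay_succ x₀ hF]; exact polyGrowth_tay x₀ n _

theorem integrable_gauss_mul_tay (ha : 0 < a) (hA : ∀ x : 𝔼, a * ‖x‖ ^ 2 ≤ (quad A x).re)
    (x₀ : EuclideanSpace ℝ (Fin d)) (n : ℕ) (F : 𝔼 → ℂ) :
    Integrable fun x => gauss A x * tay x₀ n F x :=
  integrable_gauss_mul ha hA (polyGrowth_tay x₀ n F) (contDiff_tay x₀ n F).continuous

theorem succ_mul_integral_gauss_tay (ha : 0 < a) (hA : ∀ x : 𝔼, a * ‖x‖ ^ 2 ≤ (quad A x).re)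
    (hs : ∀ i j, A i j = A j i) {B : Matrix (Fin d) (Fin d) ℂ} (hB : B * A = 1)
    (x₀ : EuclideanSpace ℝ (Fin d)) (n : ℕ) {F : 𝔼 → ℂ} (hF : ContDiff ℝ ∞ F) :
    ((n : ℂ) + 1) * ∫ x, gauss A x * tay x₀ (n + 1) F x =
      ∑ i, ∑ l, B i l * ∫ x, gauss A x * pderiv l (tay x₀ n (pderiv i F)) x := by
  have h1 : ∀ x : 𝔼, ((n : ℂ) + 1) * (gauss A x * tay x₀ (n + 1) F x) =
      ∑ i, gauss A x * ((x i : ℂ) * tay x₀ n (pderiv i F) x) := by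
    intro x
    rw [mul_left_comm, succ_mul_tay, Finset.mul_sum]
  rw [← integral_const_mul]
  simp only [h1]
  rw [integral_finsetSum _ fun i _ => integrable_gauss_mul ha hA
    ((PolyGrowth.coord i).mul (polyGrowth_tay x₀ n _))
    ((contDiff_coord i).mul (contDiff_tay x₀ n _)).continuous]
  exact Finset.sum_congr rfl fun i _ => integral_gauss_coord_mul ha hA hs hB (contDiff_tay x₀ n _)
    (polyGrowth_tay x₀ n _) (polyGrowth_pderiv_tay x₀ n (contDiff_pderiv hF i)) i

/-- Euler's identity writes degree `n + 2` as coordinates times degree `n + 1`; under the Gaussian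
each coordinate becomes the derivative `(B∂)ᵢ`, which passes onto `F` since `∂` commutes with taking
Taylor components. This recursion is the source of the operators in `Lop`. -/
theorem integral_gauss_tay_add_two (ha : 0 < a) (hA : ∀ x : 𝔼, a * ‖x‖ ^ 2 ≤ (quad A x).re)
    (hs : ∀ i j, A i j = A j i) {B : Matrix (Fin d) (Fin d) ℂ} (hB : B * A = 1)
    (x₀ : EuclideanSpace ℝ (Fin d)) (n : ℕ) {F : 𝔼 → ℂ} (hF : ContDiff ℝ ∞ F) :
    ((n : ℂ) + 2) * ∫ x, gauss A x * tay x₀ (n + 2) F x =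
      ∫ x, gauss A x * tay x₀ n (quadOp B F) x := by
  have h := succ_mul_integral_gauss_tay ha hA hs hB x₀ (n + 1) hF
  rw [show ((n : ℂ) + 2) = ((n + 1 : ℕ) : ℂ) + 1 by push_cast; ring, h]
  simp only [tay_quadOp x₀ hF, Finset.mul_sum, fun i => pderiv_tay_succ x₀ (contDiff_pderiv hF i)]
  have hint : ∀ i j, Integrable fun x =>
      gauss A x * (B i j * tay x₀ n (pderiv i (pderiv j F)) x) := fun i j => by
    simp only [mul_left_comm (gauss A _)]
    exact (integrable_gauss_mul_tay ha hA x₀ n _).const_mul _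
  rw [integral_finsetSum _ fun i _ => integrable_finsetSum _ fun j _ => hint i j]
  refine Finset.sum_congr rfl fun i _ => ?_
  rw [integral_finsetSum _ fun j _ => hint i j]
  refine Finset.sum_congr rfl fun j _ => ?_
  rw [← integral_const_mul, pderiv_comm hF j i]
  congr 1
  funext x
  ring

theorem integral_gauss_tay_odd (ha : 0 < a) (hA : ∀ x : 𝔼, a * ‖x‖ ^ 2 ≤ (quad A x).re)
    (hs : ∀ i j, A i j = A j i) {B : Matrix (Fin d) (Fin d) ℂ} (hB : B * A = 1)
    (x₀ : EuclideanSpace ℝ (Fin d)) (ν : ℕ) {F : 𝔼 → ℂ} (hF : ContDiff ℝ ∞ F) :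
    ∫ x, gauss A x * tay x₀ (2 * ν + 1) F x = 0 := by
  induction ν generalizing F with
  | zero =>
    have h := succ_mul_integral_gauss_tay ha hA hs hB x₀ 0 hF
    simpa [pderiv_tay_zero] using h
  | succ ν ih =>
    have h := integral_gauss_tay_add_two ha hA hs hB x₀ (2 * ν + 1) hF
    rw [ih (contDiff_quadOp hF B)] at h
    refine (mul_eq_zero.1 h).resolve_left ?_
    exact_mod_cast (by omega : 2 * ν + 1 + 2 ≠ 0)

/-- The factors `1/(2ν + 2)` of the recursion multiply up to `1/(2^ν ν!)`. -/
theorem integral_gauss_tay_even (ha : 0 < a) (hA : ∀ x : 𝔼, a * ‖x‖ ^ 2 ≤ (quad A x).re)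
    (hs : ∀ i j, A i j = A j i) {B : Matrix (Fin d) (Fin d) ℂ} (hB : B * A = 1)
    (x₀ : EuclideanSpace ℝ (Fin d)) (ν : ℕ) {F : 𝔼 → ℂ} (hF : ContDiff ℝ ∞ F) :
    ∫ x, gauss A x * tay x₀ (2 * ν) F x =
      (∫ x, gauss A x) * ((2 ^ ν * (ν.factorial : ℂ))⁻¹ * (quadOp B)^[ν] F x₀) := by
  induction ν generalizing F with
  | zero => simp [tay, integral_mul_const]
  | succ ν ih =>
    have h := integral_gauss_tay_add_two ha hA hs hB x₀ (2 * ν) hF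
    rw [ih (contDiff_quadOp hF B)] at h
    have h2 : ((2 * ν : ℕ) : ℂ) + 2 ≠ 0 := by exact_mod_cast (by omega : 2 * ν + 2 ≠ 0)
    refine mul_left_cancel₀ h2 (h.trans ?_)
    rw [Function.iterate_succ_apply, Nat.factorial_succ, pow_succ]
    have h3 : ((ν : ℂ) + 1) ≠ 0 := Nat.cast_add_one_ne_zero ν
    have h4 : (ν.factorial : ℂ) ≠ 0 := by exact_mod_cast ν.factorial_ne_zero
    push_cast
    field_simp

end Gaussian

/-! ### The Gaussian integral and the branch of the inverse square root of the determinant. -/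

section GaussianIntegral

theorem quad_add (A B : Matrix (Fin d) (Fin d) ℂ) (x : 𝔼) : quad (A + B) x = quad A x + quad B x := by
  simp [quad, add_mul, Finset.sum_add_distrib]

theorem quad_smul (t : ℂ) (A : Matrix (Fin d) (Fin d) ℂ) (x : 𝔼) : quad (t • A) x = t * quad A x := by
  simp [quad, Finset.mul_sum, mul_assoc]

theorem quad_one (x : 𝔼) : quad 1 x = ((‖x‖ ^ 2 : ℝ) : ℂ) := by
  rw [EuclideanSpace.real_norm_sq_eq]
  simp [quad, Matrix.one_apply, sq]

theorem norm_quad_le (A : Matrix (Fin d) (Fin d) ℂ) (x : 𝔼) :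
    ‖quad A x‖ ≤ (∑ i, ∑ j, ‖A i j‖) * ‖x‖ ^ 2 := by
  simp only [Finset.sum_mul]
  refine norm_sum_le_of_le _ fun i _ => norm_sum_le_of_le _ fun j _ => ?_
  rw [norm_mul, norm_mul, Complex.norm_real, Complex.norm_real, mul_assoc, sq]
  exact mul_le_mul_of_nonneg_left (mul_le_mul (PiLp.norm_apply_le x i) (PiLp.norm_apply_le x j)
    (norm_nonneg _) (norm_nonneg _)) (norm_nonneg _)

variable {B : Matrix (Fin d) (Fin d) ℂ} {b : ℝ}

/-- For an eigenvector `v = p + iq`, symmetry of `B` cancels the cross terms in `v̄·Bv`, so `z|v|² =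
Bp·p + Bq·q`; take real parts. -/
theorem re_pos_of_isRoot_charpoly (hb : 0 < b) (hB : ∀ x : 𝔼, b * ‖x‖ ^ 2 ≤ (quad B x).re)
    (hs : ∀ i j, B i j = B j i) {z : ℂ} (hz : B.charpoly.IsRoot z) : 0 < z.re := by
  rw [Polynomial.IsRoot, Matrix.eval_charpoly] at hz
  obtain ⟨v, hv0, hv⟩ := Matrix.exists_mulVec_eq_zero_iff.2 hz
  have hBv : ∀ i, ∑ j, B i j * v j = z * v i := by
    intro i
    have := congrFun hv i
    rw [Matrix.sub_mulVec, Pi.sub_apply, Pi.zero_apply, sub_eq_zero] at this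
    simpa [Matrix.mulVec, dotProduct, Matrix.scalar_apply, Matrix.diagonal_apply] using this.symm
  let p : 𝔼 := WithLp.toLp 2 fun i => (v i).re
  let q : 𝔼 := WithLp.toLp 2 fun i => (v i).im
  have h1 : ∑ i, (starRingEnd ℂ) (v i) * ∑ j, B i j * v j = quad B p + quad B q := by
    have hv' : ∀ i, v i = (p i : ℂ) + (q i : ℂ) * Complex.I := fun i => (Complex.re_add_im (v i)).symm
    have e : ∀ i j, (starRingEnd ℂ) (v i) * (B i j * v j) =
        (B i j * (p i : ℂ) * (p j : ℂ) + B i j * (q i : ℂ) * (q j : ℂ)) +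
          Complex.I * (B i j * (p i : ℂ) * (q j : ℂ) - B i j * (q i : ℂ) * (p j : ℂ)) := by
      intro i j
      rw [hv' i, hv' j]
      simp only [map_add, map_mul, Complex.conj_ofReal, Complex.conj_I]
      linear_combination (-(B i j) * (q i : ℂ) * (q j : ℂ)) * Complex.I_sq
    have e2 : ∑ i, ∑ j, B i j * (q i : ℂ) * (p j : ℂ) = ∑ i, ∑ j, B i j * (p i : ℂ) * (q j : ℂ) := by
      rw [Finset.sum_comm]
      refine Finset.sum_congr rfl fun i _ => Finset.sum_congr rfl fun j _ => ?_
      rw [hs j i]; ring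
    simp only [Finset.mul_sum, e, Finset.sum_add_distrib]
    simp only [← Finset.mul_sum, Finset.sum_sub_distrib, e2, sub_self, mul_zero, add_zero, quad]
  have h2 : ∑ i, (starRingEnd ℂ) (v i) * ∑ j, B i j * v j = z * ((∑ i, ‖v i‖ ^ 2 : ℝ) : ℂ) := by
    simp only [hBv]
    push_cast
    rw [Finset.mul_sum]
    refine Finset.sum_congr rfl fun i _ => ?_
    rw [← Complex.conj_mul']
    ring
  have h3 : z.re * (∑ i, ‖v i‖ ^ 2) = (quad B p).re + (quad B q).re := by
    have := congrArg Complex.re (h2.symm.trans h1)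
    rwa [Complex.re_mul_ofReal, Complex.add_re] at this
  have h4 : ‖p‖ ^ 2 + ‖q‖ ^ 2 = ∑ i, ‖v i‖ ^ 2 := by
    rw [EuclideanSpace.real_norm_sq_eq, EuclideanSpace.real_norm_sq_eq, ← Finset.sum_add_distrib]
    refine Finset.sum_congr rfl fun i _ => ?_
    rw [← Complex.normSq_eq_norm_sq, Complex.normSq_apply]
    simp only [p, q]
    ring
  have h5 : 0 < ∑ i, ‖v i‖ ^ 2 := by
    obtain ⟨i, hi⟩ := Function.ne_iff.1 hv0
    exact Finset.sum_pos' (fun i _ => by positivity) ⟨i, Finset.mem_univ _, by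
      have := norm_pos_iff.2 hi; positivity⟩
  have h6 : 0 < z.re * (∑ i, ‖v i‖ ^ 2) := by
    rw [h3]
    have := hB p
    have := hB q
    have : 0 < b * (‖p‖ ^ 2 + ‖q‖ ^ 2) := by rw [h4]; positivity
    linarith
  exact pos_of_mul_pos_left h6 h5.le

/-- For `t ≠ 0` this is the factored characteristic polynomial at `(t - 1)/t`, rescaled by `(-t)^d`.
-/
theorem det_one_add_smul_sub_one (B : Matrix (Fin d) (Fin d) ℂ) (t : ℂ) :
    (1 + t • (B - 1)).det = (B.charpoly.roots.map fun z => 1 + t * (z - 1)).prod := by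
  have hsp : B.charpoly.Splits := IsAlgClosed.splits _
  have hcard : B.charpoly.roots.card = d := by
    rw [← hsp.natDegree_eq_card_roots, Matrix.charpoly_natDegree_eq_dim, Fintype.card_fin]
  by_cases ht : t = 0
  · simp [ht]
  have h1 : 1 + t • (B - 1) = (-t) • (Matrix.scalar (Fin d) ((t - 1) / t) - B) := by
    ext i j
    by_cases hij : i = j
    · subst hij
      simp
      field_simp
      ring
    · simp [hij]
  have h2 : B.charpoly.eval ((t - 1) / t) =
      (B.charpoly.roots.map fun z => (t - 1) / t - z).prod := by
    conv_lhs => rw [hsp.eq_prod_roots_of_monic (Matrix.charpoly_monic B)]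
    rw [Polynomial.eval_multiset_prod, Multiset.map_map]
    simp
  rw [h1, Matrix.det_smul, Fintype.card_fin, ← Matrix.eval_charpoly, h2]
  rw [show (-t) ^ d = (B.charpoly.roots.map fun _ => -t).prod by simp [hcard],
    ← Multiset.prod_map_mul]
  refine congrArg _ (Multiset.map_congr rfl fun z _ => ?_)
  field_simp
  ring

theorem hasDerivAt_multiset_prod_cpow (m : Multiset ℂ) (t : ℝ)
    (h : ∀ z ∈ m, 1 + (t : ℂ) * (z - 1) ∈ Complex.slitPlane) :
    HasDerivAt (fun t : ℝ => (m.map fun z => (1 + (t : ℂ) * (z - 1)) ^ (-(1 / 2) : ℂ)).prod)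
      (-(1 / 2) * (m.map fun z => (z - 1) / (1 + (t : ℂ) * (z - 1))).sum *
        (m.map fun z => (1 + (t : ℂ) * (z - 1)) ^ (-(1 / 2) : ℂ)).prod) t := by
  induction m using Multiset.induction_on with
  | empty => simpa using hasDerivAt_const t (1 : ℂ)
  | cons z m ih =>
    have hz := h z (Multiset.mem_cons_self z m)
    have ih' := ih fun w hw => h w (Multiset.mem_cons_of_mem hw)
    have hlin : HasDerivAt (fun t : ℝ => 1 + (t : ℂ) * (z - 1)) (z - 1) t := by
      simpa using ((Complex.ofRealCLM.hasDerivAt (x := t)).mul_const (z - 1)).const_add 1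
    have hpow : HasDerivAt (fun t : ℝ => (1 + (t : ℂ) * (z - 1)) ^ (-(1 / 2) : ℂ))
        (-(1 / 2) * (1 + (t : ℂ) * (z - 1)) ^ (-(1 / 2) - 1 : ℂ) * (z - 1)) t := by
      have := ((Complex.hasStrictDerivAt_cpow_const (c := -(1 / 2)) hz).hasDerivAt).comp t hlin
      exact this
    simp only [Multiset.map_cons, Multiset.prod_cons, Multiset.sum_cons]
    refine (hpow.mul ih').congr_deriv ?_
    have h0 := Complex.slitPlane_ne_zero hz
    rw [Complex.cpow_sub _ _ h0, Complex.cpow_one]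
    field_simp
    ring

theorem hasDerivAt_multiset_prod (m : Multiset ℂ) (t : ℝ)
    (h : ∀ z ∈ m, 1 + (t : ℂ) * (z - 1) ≠ 0) :
    HasDerivAt (fun t : ℝ => (m.map fun z => (1 + (t : ℂ) * (z - 1))).prod)
      ((m.map fun z => (z - 1) / (1 + (t : ℂ) * (z - 1))).sum *
        (m.map fun z => (1 + (t : ℂ) * (z - 1))).prod) t := by
  induction m using Multiset.induction_on with
  | empty => simpa using hasDerivAt_const t (1 : ℂ)
  | cons z m ih =>
    have hz := h z (Multiset.mem_cons_self z m)
    have ih' := ih fun w hw => h w (Multiset.mem_cons_of_mem hw)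
    have hlin : HasDerivAt (fun t : ℝ => 1 + (t : ℂ) * (z - 1)) (z - 1) t := by
      simpa using ((Complex.ofRealCLM.hasDerivAt (x := t)).mul_const (z - 1)).const_add 1
    simp only [Multiset.map_cons, Multiset.prod_cons, Multiset.sum_cons]
    refine (hlin.mul ih').congr_deriv ?_
    generalize (m.map fun z => (z - 1) / (1 + (t : ℂ) * (z - 1))).sum = S₁
    generalize (m.map fun z => (1 + (t : ℂ) * (z - 1))).prod = P₁
    linear_combination (-P₁) * div_mul_cancel₀ (z - 1) hz

theorem hasDerivAt_det_one_add_smul (M : Matrix (Fin d) (Fin d) ℂ) :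
    HasDerivAt (fun t : ℝ => (1 + (t : ℂ) • M).det) M.trace 0 := by
  rw [funext fun t : ℝ => Matrix.det_one_add_smul (t : ℂ) M]
  set P := (Matrix.det (1 + (Polynomial.X : Polynomial ℂ) • M.map Polynomial.C)).divX.divX
  have h : HasDerivAt (fun t : ℂ => 1 + M.trace * t + P.eval t * t ^ 2) M.trace ((0 : ℝ) : ℂ) := by
    have h1 := ((hasDerivAt_id ((0 : ℝ) : ℂ)).const_mul M.trace).const_add 1
    have h2 := (P.hasDerivAt ((0 : ℝ) : ℂ)).mul (hasDerivAt_pow 2 ((0 : ℝ) : ℂ))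
    refine (h1.add h2).congr_deriv ?_
    simp
  exact h.comp_ofReal

/-- Both sides are the logarithmic derivative of `det(1 + t(B - 1))`: once from its factorisation
over the eigenvalues, once from Jacobi's formula at the identity after factoring out the matrix at
`t`. -/
theorem sum_roots_eq_trace (B : Matrix (Fin d) (Fin d) ℂ) (t : ℝ)
    (h : ∀ z ∈ B.charpoly.roots, 1 + (t : ℂ) * (z - 1) ≠ 0) {Bi : Matrix (Fin d) (Fin d) ℂ}
    (hBi : Bi * (1 + (t : ℂ) • (B - 1)) = 1) :
    (B.charpoly.roots.map fun z => (z - 1) / (1 + (t : ℂ) * (z - 1))).sum =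
      (Bi * (B - 1)).trace := by
  set m := B.charpoly.roots
  set S := (m.map fun z => (z - 1) / (1 + (t : ℂ) * (z - 1))).sum
  set D := (1 + (t : ℂ) • (B - 1)).det with hD
  have hD0 : D ≠ 0 := by
    intro h0
    have := congrArg Matrix.det hBi
    rw [Matrix.det_mul, ← hD, h0] at this
    simp at this
  have h1 : HasDerivAt (fun τ : ℝ => (1 + (τ : ℂ) • (B - 1)).det) (S * D) t := by
    simp only [hD, det_one_add_smul_sub_one]
    exact hasDerivAt_multiset_prod m t h
  have h2 : HasDerivAt (fun ε : ℝ => (1 + ((t + ε : ℝ) : ℂ) • (B - 1)).det) (S * D) 0 := by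
    have : HasDerivAt (fun ε : ℝ => t + ε) 1 0 := by simpa using (hasDerivAt_id (0 : ℝ)).const_add t
    have h1' : HasDerivAt (fun τ : ℝ => (1 + (τ : ℂ) • (B - 1)).det) (S * D) (t + 0) := by
      simpa using h1
    exact (HasDerivAt.scomp (0 : ℝ) h1' this).congr_deriv (one_smul _ _)
  have h3 : (fun ε : ℝ => (1 + ((t + ε : ℝ) : ℂ) • (B - 1)).det) =
      fun ε : ℝ => D * (1 + (ε : ℂ) • (Bi * (B - 1))).det := by
    funext ε
    rw [hD, ← Matrix.det_mul]
    congr 1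
    have hBi' := mul_eq_one_comm.1 hBi
    rw [mul_add, mul_one, Matrix.mul_smul, ← mul_assoc, hBi', one_mul]
    push_cast
    rw [add_smul, add_assoc]
  rw [h3] at h2
  have h4 := (hasDerivAt_det_one_add_smul (Bi * (B - 1))).const_mul D
  have := h2.unique h4
  rw [mul_comm] at this
  exact mul_left_cancel₀ hD0 this

/-- The path `1 + t(B - 1)` from the identity to `B`. -/
def segOne (B : Matrix (Fin d) (Fin d) ℂ) (t : ℝ) : Matrix (Fin d) (Fin d) ℂ := 1 + (t : ℂ) • (B - 1)

theorem segOne_symm (hs : ∀ i j, B i j = B j i) (t : ℝ) (i j : Fin d) :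
    segOne B t i j = segOne B t j i := by
  simp [segOne, hs i j, Matrix.one_apply, eq_comm]

theorem quad_segOne (t : ℝ) (x : 𝔼) : quad (segOne B t) x = quad 1 x + t * quad (B - 1) x := by
  rw [segOne, quad_add, quad_smul]

theorem re_quad_segOne (t : ℝ) (x : 𝔼) :
    (quad (segOne B t) x).re = (1 - t) * ‖x‖ ^ 2 + t * (quad B x).re := by
  have h : quad B x = quad 1 x + quad (B - 1) x := by rw [← quad_add]; congr 1; abel
  rw [quad_segOne, h, quad_one]
  simp only [Complex.add_re, Complex.ofReal_re, Complex.re_ofReal_mul]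
  ring

theorem slitPlane_of_mem_roots (hb : 0 < b) (hB : ∀ x : 𝔼, b * ‖x‖ ^ 2 ≤ (quad B x).re)
    (hs : ∀ i j, B i j = B j i) {t : ℝ} (ht : t ∈ Set.Icc (0 : ℝ) 1) {z : ℂ}
    (hz : z ∈ B.charpoly.roots) : 1 + (t : ℂ) * (z - 1) ∈ Complex.slitPlane := by
  have h := re_pos_of_isRoot_charpoly hb hB hs (Polynomial.isRoot_of_mem_roots hz)
  refine Or.inl ?_
  have : (1 + (t : ℂ) * (z - 1)).re = (1 - t) + t * z.re := by
    simp
    ring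
  rw [this]
  rcases eq_or_lt_of_le ht.1 with h0 | h0
  · simp [← h0]
  · have := mul_pos h0 h
    linarith [ht.2]

theorem det_segOne_ne_zero (hb : 0 < b) (hB : ∀ x : 𝔼, b * ‖x‖ ^ 2 ≤ (quad B x).re)
    (hs : ∀ i j, B i j = B j i) {t : ℝ} (ht : t ∈ Set.Icc (0 : ℝ) 1) : (segOne B t).det ≠ 0 := by
  rw [segOne, det_one_add_smul_sub_one]
  refine Multiset.prod_ne_zero fun h => ?_
  obtain ⟨z, hz, hz0⟩ := Multiset.mem_map.1 h
  exact Complex.slitPlane_ne_zero (slitPlane_of_mem_roots hb hB hs ht hz) hz0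

theorem hasDerivAt_integral_gauss_segOne (hb : 0 < b) (hb1 : b ≤ 1)
    (hB : ∀ x : 𝔼, b * ‖x‖ ^ 2 ≤ (quad B x).re) {t : ℝ} (ht : t ∈ Set.Icc (0 : ℝ) 1) :
    HasDerivAt (fun t : ℝ => ∫ x : 𝔼, gauss ((2 * Real.pi : ℂ) • segOne B t) x)
      (∫ x : 𝔼, -(Real.pi : ℂ) * (gauss ((2 * Real.pi : ℂ) • segOne B t) x * quad (B - 1) x)) t := by
  have hpi := Real.pi_pos
  set M : ℝ := ∑ i, ∑ j, ‖(B - 1) i j‖ with hM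
  have hM0 : 0 ≤ M := by positivity
  have hseg : ∀ x : 𝔼, b * ‖x‖ ^ 2 ≤ (quad (segOne B t) x).re := fun x => by
    rw [re_quad_segOne]
    nlinarith [hB x, ht.1, ht.2, mul_nonneg (sub_nonneg.2 ht.2) (sq_nonneg ‖x‖),
      mul_nonneg ht.1 (sub_nonneg.2 (hB x))]
  -- Within this radius the form changes by at most `b/2 ‖x‖²`, so half of the coercivity survives
  -- and gives an integrable dominating function.
  have hnear : ∀ τ ∈ Metric.ball t (b / (2 * (M + 1))), ∀ x : 𝔼,
      b / 2 * ‖x‖ ^ 2 ≤ (quad (segOne B τ) x).re := by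
    intro τ hτ x
    have h1 : quad (segOne B τ) x = quad (segOne B t) x + ((τ - t : ℝ) : ℂ) * quad (B - 1) x := by
      rw [quad_segOne, quad_segOne]; push_cast; ring
    have h2 : |(((τ - t : ℝ) : ℂ) * quad (B - 1) x).re| ≤ b / 2 * ‖x‖ ^ 2 := by
      refine (Complex.abs_re_le_norm _).trans ?_
      rw [norm_mul, Complex.norm_real]
      have h3 : ‖τ - t‖ ≤ b / (2 * (M + 1)) := (mem_ball_iff_norm.1 hτ).le
      calc ‖τ - t‖ * ‖quad (B - 1) x‖ ≤ b / (2 * (M + 1)) * (M * ‖x‖ ^ 2) :=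
            mul_le_mul h3 (norm_quad_le _ x) (norm_nonneg _) (by positivity)
        _ = b / 2 * (M / (M + 1)) * ‖x‖ ^ 2 := by field_simp
        _ ≤ b / 2 * 1 * ‖x‖ ^ 2 := by
            gcongr
            rw [div_le_one (by positivity)]; linarith
        _ = _ := by ring
    rw [h1, Complex.add_re]
    linarith [hseg x, (abs_le.1 h2).1]
  have hnear' : ∀ τ ∈ Metric.ball t (b / (2 * (M + 1))), ∀ x : 𝔼,
      Real.pi * b * ‖x‖ ^ 2 ≤ (quad ((2 * Real.pi : ℂ) • segOne B τ) x).re := by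
    intro τ hτ x
    have e : (quad ((2 * Real.pi : ℂ) • segOne B τ) x).re =
        2 * Real.pi * (quad (segOne B τ) x).re := by
      rw [quad_smul, ← Complex.re_ofReal_mul]; push_cast; rfl
    rw [e]
    nlinarith [hnear τ hτ x]
  have hε : 0 < b / (2 * (M + 1)) := by positivity
  have htb : t ∈ Metric.ball t (b / (2 * (M + 1))) := Metric.mem_ball_self hε
  refine (hasDerivAt_integral_of_dominated_loc_of_deriv_le (μ := volume)
    (F := fun (τ : ℝ) (x : 𝔼) => gauss ((2 * Real.pi : ℂ) • segOne B τ) x)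
    (F' := fun (τ : ℝ) (x : 𝔼) =>
      -(Real.pi : ℂ) * (gauss ((2 * Real.pi : ℂ) • segOne B τ) x * quad (B - 1) x))
    (bound := fun x : 𝔼 => Real.pi * M * ((1 + ‖x‖) ^ 2 * Real.exp (-(Real.pi * b / 2) * ‖x‖ ^ 2)))
    (Metric.ball_mem_nhds t hε) ?_ ?_ ?_ ?_ ?_ ?_).2
  · exact Filter.Eventually.of_forall fun τ => (contDiff_gauss _).continuous.aestronglyMeasurable
  · simpa using integrable_gauss_mul (by positivity : 0 < Real.pi * b) (hnear' t htb)
      (PolyGrowth.const 1) continuous_const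
  · exact (continuous_const.mul ((contDiff_gauss _).continuous.mul
      (contDiff_quad _).continuous)).aestronglyMeasurable
  · refine Filter.Eventually.of_forall fun x τ hτ => ?_
    have h1 := norm_gauss_le (hnear' τ hτ) x
    have h2 := norm_quad_le (B - 1) x
    have hx := norm_nonneg x
    have h3 : ‖x‖ ^ 2 ≤ (1 + ‖x‖) ^ 2 := by gcongr; linarith
    rw [norm_mul, norm_mul, norm_neg, Complex.norm_real, Real.norm_of_nonneg hpi.le]
    calc _ ≤ Real.pi * (Real.exp (-(Real.pi * b / 2) * ‖x‖ ^ 2) * (M * (1 + ‖x‖) ^ 2)) := by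
          gcongr
          exact h2.trans (by gcongr)
      _ = _ := by ring
  · exact (integrable_pow_mul_exp (by positivity) 2).const_mul _
  · refine Filter.Eventually.of_forall fun x τ _ => ?_
    have h1 : (fun τ : ℝ => gauss ((2 * Real.pi : ℂ) • segOne B τ) x) = fun τ : ℝ =>
        Complex.exp (-(Real.pi : ℂ) * (quad 1 x + τ * quad (B - 1) x)) := by
      funext τ
      rw [gauss, quad_smul, quad_segOne]
      congr 1
      ring
    have h2 : HasDerivAt (fun τ : ℝ => -(Real.pi : ℂ) * (quad 1 x + τ * quad (B - 1) x))
        (-(Real.pi : ℂ) * quad (B - 1) x) τ := by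
      have := (((Complex.ofRealCLM.hasDerivAt (x := τ)).mul_const (quad (B - 1) x)).const_add
        (quad 1 x)).const_mul (-(Real.pi : ℂ))
      simpa using this
    rw [h1]
    refine h2.cexp.congr_deriv ?_
    rw [← congrFun h1 τ]
    ring

/-- The Gaussian integral of a complex symmetric matrix with positive definite real part. -/
theorem integral_gauss_eq_detInvSqrt (hb : 0 < b) (hB : ∀ x : 𝔼, b * ‖x‖ ^ 2 ≤ (quad B x).re)
    (hs : ∀ i j, B i j = B j i) :
    ∫ x : 𝔼, gauss ((2 * Real.pi : ℂ) • B) x = detInvSqrt B := by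
  -- With `b ≤ 1` the same `b` bounds the form from below along the whole segment from `1` to `B`.
  wlog hb1 : b ≤ 1 generalizing b
  · refine this one_pos (fun x => le_trans ?_ (hB x)) le_rfl
    gcongr
    exact (not_le.1 hb1).le
  have hpi := Real.pi_pos
  -- The integral `J` and the product `P` both solve `y' = -½ S y` on `[0, 1]` with `y(0) = 1`.
  -- Hence `J / P` is constant, with no choice of branch to be traced.
  set J : ℝ → ℂ := fun t => ∫ x : 𝔼, gauss ((2 * Real.pi : ℂ) • segOne B t) x with hJ
  set P : ℝ → ℂ := fun t =>
    (B.charpoly.roots.map fun z => (1 + (t : ℂ) * (z - 1)) ^ (-(1 / 2) : ℂ)).prod with hP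
  set S : ℝ → ℂ := fun t =>
    (B.charpoly.roots.map fun z => (z - 1) / (1 + (t : ℂ) * (z - 1))).sum with hS
  have hP0 : ∀ t ∈ Set.Icc (0 : ℝ) 1, P t ≠ 0 := by
    intro t ht
    refine Multiset.prod_ne_zero fun h => ?_
    obtain ⟨z, hz, hz0⟩ := Multiset.mem_map.1 h
    have := (Complex.cpow_eq_zero_iff _ _).1 hz0
    exact Complex.slitPlane_ne_zero (slitPlane_of_mem_roots hb hB hs ht hz) this.1
  have hPd : ∀ t ∈ Set.Icc (0 : ℝ) 1, HasDerivAt P (-(1 / 2) * S t * P t) t := fun t ht =>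
    hasDerivAt_multiset_prod_cpow _ t fun z hz => slitPlane_of_mem_roots hb hB hs ht hz
  have hJd : ∀ t ∈ Set.Icc (0 : ℝ) 1, HasDerivAt J (-(1 / 2) * S t * J t) t := by
    intro t ht
    refine (hasDerivAt_integral_gauss_segOne hb hb1 hB ht).congr_deriv ?_
    have hdet : IsUnit (segOne B t).det := isUnit_iff_ne_zero.2 (det_segOne_ne_zero hb hB hs ht)
    have hinv := Matrix.nonsing_inv_mul _ hdet
    have hS' : S t = ((segOne B t)⁻¹ * (B - 1)).trace :=
      sum_roots_eq_trace B t (fun z hz =>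
        Complex.slitPlane_ne_zero (slitPlane_of_mem_roots hb hB hs ht hz)) hinv
    have hA : ∀ x : 𝔼, 2 * Real.pi * b * ‖x‖ ^ 2 ≤ (quad ((2 * Real.pi : ℂ) • segOne B t) x).re := by
      intro x
      have e : (quad ((2 * Real.pi : ℂ) • segOne B t) x).re =
          2 * Real.pi * (quad (segOne B t) x).re := by
        rw [quad_smul, ← Complex.re_ofReal_mul]; push_cast; rfl
      have hseg : b * ‖x‖ ^ 2 ≤ (quad (segOne B t) x).re := by
        rw [re_quad_segOne]
        nlinarith [hB x, ht.1, ht.2, mul_nonneg (sub_nonneg.2 ht.2) (sq_nonneg ‖x‖),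
          mul_nonneg ht.1 (sub_nonneg.2 (hB x))]
      rw [e]
      nlinarith
    have hpb : 0 < 2 * Real.pi * b := by positivity
    have hpc : (2 * Real.pi : ℂ) ≠ 0 := by
      have : (Real.pi : ℂ) ≠ 0 := by exact_mod_cast hpi.ne'
      simp [this]
    have hinv2 : ((2 * Real.pi : ℂ)⁻¹ • (segOne B t)⁻¹) * ((2 * Real.pi : ℂ) • segOne B t) = 1 := by
      rw [Matrix.smul_mul, Matrix.mul_smul, smul_smul, hinv, inv_mul_cancel₀ hpc, one_smul]
    have hsym : ∀ i j, ((2 * Real.pi : ℂ) • segOne B t) i j =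
        ((2 * Real.pi : ℂ) • segOne B t) j i := fun i j => by
      simp only [Matrix.smul_apply, segOne_symm hs t i j]
    -- Second moments are entries of the inverse matrix; contracted with `B - 1` they give the trace
    -- that equals `S t`.
    have hmom : ∀ i j : Fin d, ∫ x : 𝔼, gauss ((2 * Real.pi : ℂ) • segOne B t) x *
        ((x i : ℂ) * (x j : ℂ)) = (2 * Real.pi : ℂ)⁻¹ * (segOne B t)⁻¹ i j * J t := by
      intro i j
      rw [integral_gauss_coord_mul hpb hA hsym hinv2 (contDiff_coord j) (PolyGrowth.coord j)
        (fun l => by rw [pderiv_coord_zero]; exact PolyGrowth.const _)]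
      rw [Finset.sum_eq_single j (fun l _ hl => by simp [pderiv_coord_zero, hl]) (by simp)]
      simp [pderiv_coord_zero, hJ]
    have hint : ∀ i j : Fin d, Integrable fun x : 𝔼 => (B - 1) i j *
        (gauss ((2 * Real.pi : ℂ) • segOne B t) x * ((x i : ℂ) * (x j : ℂ))) := fun i j =>
      (integrable_gauss_mul hpb hA ((PolyGrowth.coord i).mul (PolyGrowth.coord j))
        ((contDiff_coord i).mul (contDiff_coord j)).continuous).const_mul _
    have hexp : ∀ x : 𝔼, gauss ((2 * Real.pi : ℂ) • segOne B t) x * quad (B - 1) x =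
        ∑ i, ∑ j, (B - 1) i j *
          (gauss ((2 * Real.pi : ℂ) • segOne B t) x * ((x i : ℂ) * (x j : ℂ))) := by
      intro x
      simp only [quad, Finset.mul_sum]
      exact Finset.sum_congr rfl fun i _ => Finset.sum_congr rfl fun j _ => by ring
    rw [integral_const_mul]
    simp only [hexp]
    rw [integral_finsetSum _ fun i _ => integrable_finsetSum _ fun j _ => hint i j]
    simp only [fun i => integral_finsetSum Finset.univ fun j _ => hint i j, integral_const_mul, hmom]
    rw [hS', Matrix.trace]
    simp only [Matrix.diag_apply, Matrix.mul_apply, Finset.mul_sum, Finset.sum_mul]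
    refine Finset.sum_congr rfl fun i _ => Finset.sum_congr rfl fun j _ => ?_
    have hsB : (B - 1) i j = (B - 1) j i := by
      simp [hs i j, Matrix.one_apply, eq_comm]
    rw [hsB]
    have : (Real.pi : ℂ) ≠ 0 := by exact_mod_cast hpi.ne'
    field_simp
  have hQ : ∀ t ∈ Set.Icc (0 : ℝ) 1, HasDerivAt (fun t => J t / P t) 0 t := by
    intro t ht
    refine ((hJd t ht).div (hPd t ht) (hP0 t ht)).congr_deriv ?_
    ring
  have hconst := constant_of_has_deriv_right_zero (a := 0) (b := 1)
    (f := fun t => J t / P t) (fun t ht => (hQ t ht).continuousAt.continuousWithinAt)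
    (fun t ht => (hQ t ⟨ht.1, ht.2.le⟩).hasDerivWithinAt) 1 ⟨zero_le_one, le_rfl⟩
  have hP1 : P 1 = detInvSqrt B := by simp [hP, detInvSqrt]
  have hP00 : P 0 = 1 := by simp [hP]
  have hJ1 : J 1 = ∫ x : 𝔼, gauss ((2 * Real.pi : ℂ) • B) x := by
    simp only [hJ, segOne, Complex.ofReal_one, one_smul, add_sub_cancel]
  have hJ0 : J 0 = 1 := by
    have e : ∀ x : 𝔼, gauss ((2 * Real.pi : ℂ) • segOne B 0) x =
        ((Real.exp (-Real.pi * ‖x‖ ^ 2) : ℝ) : ℂ) := by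
      intro x
      rw [gauss, quad_smul, quad_segOne, quad_one]
      push_cast
      congr 1
      ring
    simp only [hJ, e]
    rw [integral_complex_ofReal, GaussianFourier.integral_rexp_neg_mul_sq_norm hpi,
      div_self hpi.ne', Real.one_rpow, Complex.ofReal_one]
  simp only [hP00, hJ0, div_one] at hconst
  rw [div_eq_one_iff_eq (hP0 1 ⟨zero_le_one, le_rfl⟩)] at hconst
  rw [← hJ1, ← hP1, hconst]

end GaussianIntegral

/-! ### Products of power series and expansions of Gevrey size. -/

section Numeric

open PowerSeries

theorem factorial_mul_factorial_rpow_le {σ : ℝ} (hσ : 0 ≤ σ) (m l : ℕ) :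
    (m.factorial : ℝ) ^ σ * (l.factorial : ℝ) ^ σ ≤ ((m + l).factorial : ℝ) ^ σ := by
  rw [← Real.mul_rpow (by positivity) (by positivity)]
  refine Real.rpow_le_rpow (by positivity) ?_ hσ
  exact_mod_cast Nat.le_of_dvd (Nat.factorial_pos _) (Nat.factorial_mul_factorial_dvd_factorial_add m l)

/-- Since `m! l! ≤ (m + l)!`, doubling the rate of the second factor leaves a geometric series in
`(1/2)^m`, with sum at most 2. -/
theorem sum_antidiagonal_geom_factorial_le {σ Y : ℝ} (hσ : 0 ≤ σ) (hY : 0 ≤ Y) (N : ℕ) :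
    ∑ ml ∈ Finset.HasAntidiagonal.antidiagonal N, (Y ^ ml.1 * (ml.1.factorial : ℝ) ^ σ) *
      ((2 * Y) ^ ml.2 * (ml.2.factorial : ℝ) ^ σ) ≤ 2 * ((2 * Y) ^ N * (N.factorial : ℝ) ^ σ) := by
  have h1 : ∀ ml ∈ Finset.HasAntidiagonal.antidiagonal N, (Y ^ ml.1 * (ml.1.factorial : ℝ) ^ σ) *
      ((2 * Y) ^ ml.2 * (ml.2.factorial : ℝ) ^ σ) ≤
      (1 / 2 : ℝ) ^ ml.1 * ((2 * Y) ^ N * (N.factorial : ℝ) ^ σ) := by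
    rintro ⟨m, l⟩ hml
    obtain rfl := Finset.HasAntidiagonal.mem_antidiagonal.1 hml
    have h2 := factorial_mul_factorial_rpow_le hσ m l
    have h3 : Y ^ m = (1 / 2 : ℝ) ^ m * (2 * Y) ^ m := by rw [← mul_pow]; congr 1; ring
    calc (Y ^ m * (m.factorial : ℝ) ^ σ) * ((2 * Y) ^ l * (l.factorial : ℝ) ^ σ)
        = (1 / 2 : ℝ) ^ m * ((2 * Y) ^ (m + l) *
          ((m.factorial : ℝ) ^ σ * (l.factorial : ℝ) ^ σ)) := by rw [h3]; ring
      _ ≤ _ := by gcongr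
  refine (Finset.sum_le_sum h1).trans ?_
  rw [← Finset.sum_mul, Finset.Nat.sum_antidiagonal_eq_sum_range_succ_mk]
  gcongr
  exact sum_geometric_two_le _

/-- The coefficients of the power series `p` are of Gevrey size. -/
def GevreyCoeff {𝕜 : Type*} [NormedField 𝕜] (σ Y A : ℝ) (p : 𝕜⟦X⟧) : Prop :=
  ∀ N : ℕ, ‖coeff N p‖ ≤ A * (Y ^ N * (N.factorial : ℝ) ^ σ)

theorem sum_antidiagonal_gevrey_le {σ Y A A' : ℝ} (hσ : 0 ≤ σ) (hY : 0 ≤ Y) (hA : 0 ≤ A)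
    (hA' : 0 ≤ A') (N : ℕ) :
    ∑ ml ∈ Finset.HasAntidiagonal.antidiagonal N, (A * (Y ^ ml.1 * (ml.1.factorial : ℝ) ^ σ)) *
      (A' * ((2 * Y) ^ ml.2 * (ml.2.factorial : ℝ) ^ σ)) ≤
      2 * A * A' * ((2 * Y) ^ N * (N.factorial : ℝ) ^ σ) := by
  have hconv := sum_antidiagonal_geom_factorial_le hσ hY N
  calc _ = A * A' * ∑ ml ∈ Finset.HasAntidiagonal.antidiagonal N,
        (Y ^ ml.1 * (ml.1.factorial : ℝ) ^ σ) * ((2 * Y) ^ ml.2 * (ml.2.factorial : ℝ) ^ σ) := by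
        rw [Finset.mul_sum]; exact Finset.sum_congr rfl fun ml _ => by ring
    _ ≤ A * A' * (2 * ((2 * Y) ^ N * (N.factorial : ℝ) ^ σ)) := by gcongr
    _ = _ := by ring

theorem GevreyCoeff.mul {𝕜 : Type*} [NormedField 𝕜] {σ Y A A' : ℝ} {p q : 𝕜⟦X⟧} (hσ : 0 ≤ σ)
    (hY : 0 ≤ Y) (hA : 0 ≤ A) (hA' : 0 ≤ A') (hp : GevreyCoeff σ Y A p)
    (hq : GevreyCoeff σ (2 * Y) A' q) : GevreyCoeff σ (2 * Y) (2 * A * A') (p * q) := by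
  intro N
  rw [coeff_mul]
  refine le_trans (norm_sum_le_of_le _ fun ml _ => ?_) (sum_antidiagonal_gevrey_le hσ hY hA hA' N)
  rw [norm_mul]
  exact mul_le_mul (hp _) (hq _) (norm_nonneg _) ((norm_nonneg _).trans (hp _))

/-- As `p` has the smaller rate `Y`, each multiplication by it keeps the rate `2Y` and costs just a
factor `2A`. The growth in `μ` is therefore only geometric. -/
theorem GevreyCoeff.pow_mul {𝕜 : Type*} [NormedField 𝕜] {σ Y A A' : ℝ} {p q : 𝕜⟦X⟧} (hσ : 0 ≤ σ)
    (hY : 0 ≤ Y) (hA : 0 ≤ A) (hA' : 0 ≤ A') (hp : GevreyCoeff σ Y A p)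
    (hq : GevreyCoeff σ (2 * Y) A' q) (μ : ℕ) :
    GevreyCoeff σ (2 * Y) (A' * (2 * A) ^ μ) (p ^ μ * q) := by
  induction μ with
  | zero => simpa using hq
  | succ μ ih =>
    have := hp.mul hσ hY hA (by positivity) ih
    convert this using 1 <;> ring

/-- `F` has the formal expansion `∑ pₙ`, with coefficients and remainders of Gevrey size. -/
def HasGevreyExpansion (σ Y A : ℝ) (F : ℂ) (p : ℂ⟦X⟧) : Prop :=
  GevreyCoeff σ Y A p ∧ ∀ N : ℕ,
    ‖F - ∑ n ∈ Finset.range N, coeff n p‖ ≤ A * (Y ^ N * (N.factorial : ℝ) ^ σ)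

theorem HasGevreyExpansion.mul {σ Y A A' : ℝ} {F G : ℂ} {p q : ℂ⟦X⟧} (hσ : 0 ≤ σ) (hY : 0 ≤ Y)
    (hA : 0 ≤ A) (hA' : 0 ≤ A') (hF : HasGevreyExpansion σ Y A F p)
    (hG : HasGevreyExpansion σ (2 * Y) A' G q) :
    HasGevreyExpansion σ (2 * Y) (2 * A * A') (F * G) (p * q) := by
  refine ⟨hF.1.mul hσ hY hA hA' hG.1, fun N => ?_⟩
  have hsum := sum_antidiagonal_gevrey_le hσ hY hA hA' N
  have h1 : ∑ n ∈ Finset.range N, coeff n (p * q) =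
      ∑ m ∈ Finset.range N, coeff m p * ∑ l ∈ Finset.range (N - m), coeff l q := by
    simp only [coeff_mul, Finset.Nat.sum_antidiagonal_eq_sum_range_succ_mk, Finset.mul_sum]
    exact Finset.sum_range_diag_flip N fun m l => coeff m p * coeff l q
  -- Coefficients of `p` meet complementary remainders of `G`. The last term, a remainder of `F`
  -- times `G`, takes the place of `m = N` in the convolution.
  have h2 : F * G - ∑ n ∈ Finset.range N, coeff n (p * q) =
      (∑ m ∈ Finset.range N, coeff m p * (G - ∑ l ∈ Finset.range (N - m), coeff l q)) +
        (F - ∑ m ∈ Finset.range N, coeff m p) * G := by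
    rw [h1]
    simp only [mul_sub, Finset.sum_sub_distrib, ← Finset.sum_mul]
    ring
  have hG0 : ‖G‖ ≤ A' * ((2 * Y) ^ (N - N) * ((N - N).factorial : ℝ) ^ σ) := by
    have := hG.2 0
    simpa using this
  rw [Finset.Nat.sum_antidiagonal_eq_sum_range_succ_mk, Finset.sum_range_succ] at hsum
  rw [h2]
  refine le_trans ((norm_add_le _ _).trans (add_le_add (norm_sum_le_of_le _ fun m _ => ?_) ?_)) hsum
  · rw [norm_mul]
    exact mul_le_mul (hF.1 _) (hG.2 _) (norm_nonneg _) ((norm_nonneg _).trans (hF.1 _))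
  · rw [norm_mul]
    exact mul_le_mul (hF.2 _) hG0 (norm_nonneg _) ((norm_nonneg _).trans (hF.2 _))

theorem HasGevreyExpansion.pow_mul {σ Y A A' : ℝ} {F G : ℂ} {p q : ℂ⟦X⟧} (hσ : 0 ≤ σ) (hY : 0 ≤ Y)
    (hA : 0 ≤ A) (hA' : 0 ≤ A') (hF : HasGevreyExpansion σ Y A F p)
    (hG : HasGevreyExpansion σ (2 * Y) A' G q) (μ : ℕ) :
    HasGevreyExpansion σ (2 * Y) (A' * (2 * A) ^ μ) (F ^ μ * G) (p ^ μ * q) := by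
  induction μ with
  | zero => simpa using hG
  | succ μ ih =>
    have := hF.mul hσ hY hA (by positivity) ih
    convert this using 1 <;> ring

/-! ### Inequalities for factorials and exponentials. -/

theorem factorial_add_le (m l : ℕ) :
    (m + l).factorial ≤ 2 ^ (m + l) * (m.factorial * l.factorial) := by
  rw [← Nat.add_choose_mul_factorial_mul_factorial m l, mul_assoc]
  exact Nat.mul_le_mul_right _ (Nat.choose_le_two_pow _ _)

theorem factorial_three_mul_add_le (μ l : ℕ) :
    (3 * μ + l).factorial ≤ 256 ^ (μ + l) * (μ.factorial ^ 3 * l.factorial) := by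
  have h1 := factorial_add_le (3 * μ) l
  have h2 := factorial_add_le (2 * μ) μ
  have h3 := factorial_add_le μ μ
  rw [← two_mul] at h3
  rw [show 2 * μ + μ = 3 * μ by ring] at h2
  calc (3 * μ + l).factorial ≤ 2 ^ (3 * μ + l) * ((2 ^ (3 * μ) * ((2 ^ (2 * μ) *
        (μ.factorial * μ.factorial)) * μ.factorial)) * l.factorial) := by
        refine h1.trans ?_
        gcongr
        refine h2.trans ?_
        gcongr
    _ = 2 ^ (8 * μ + l) * (μ.factorial ^ 3 * l.factorial) := by
        rw [show 8 * μ + l = (3 * μ + l) + 3 * μ + 2 * μ by ring, pow_add 2 _ (2 * μ),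
          pow_add 2 _ (3 * μ)]
        ring
    _ ≤ 2 ^ (8 * (μ + l)) * (μ.factorial ^ 3 * l.factorial) := by
        gcongr
        · norm_num
        · omega
    _ = _ := by rw [pow_mul]; norm_num

/-- The decisive count. Up to geometric factors `√(3μ+l)!` is `μ! √μ! √l!`, so one `μ!` cancels;
`√μ! ≤ μ!^{s-1/2}` by `s ≥ 1`, and `l!^{s-1} √l! = l!^{s-1/2}`. -/
theorem factorial_quotient_le {s : ℝ} (hs : 1 ≤ s) (μ l : ℕ) :
    (l.factorial : ℝ) ^ (s - 1) * √((3 * μ + l).factorial) / μ.factorial ≤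
      16 ^ (μ + l) * ((μ + l).factorial : ℝ) ^ (s - 1 / 2) := by
  have hm : (1 : ℝ) ≤ μ.factorial := by exact_mod_cast Nat.factorial_pos μ
  have hm0 : (0 : ℝ) < μ.factorial := by positivity
  have hl0 : (0 : ℝ) < l.factorial := by positivity
  have h1 : √((3 * μ + l).factorial : ℝ) ≤ 16 ^ (μ + l) * (μ.factorial * √μ.factorial * √l.factorial) := by
    refine Real.sqrt_le_iff.2 ⟨by positivity, ?_⟩
    have := factorial_three_mul_add_le μ l
    have h : ((3 * μ + l).factorial : ℝ) ≤ 256 ^ (μ + l) * (μ.factorial ^ 3 * l.factorial) := by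
      exact_mod_cast this
    refine h.trans (le_of_eq ?_)
    rw [mul_pow, mul_pow, mul_pow, Real.sq_sqrt hm0.le, Real.sq_sqrt hl0.le, ← pow_mul, mul_comm (μ + l),
      pow_mul, show (16 : ℝ) ^ 2 = 256 by norm_num]
    ring
  have h2 : √(μ.factorial : ℝ) ≤ (μ.factorial : ℝ) ^ (s - 1 / 2) := by
    rw [Real.sqrt_eq_rpow]
    exact Real.rpow_le_rpow_of_exponent_le hm (by linarith)
  have h3 : (l.factorial : ℝ) ^ (s - 1) * √l.factorial = (l.factorial : ℝ) ^ (s - 1 / 2) := by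
    rw [Real.sqrt_eq_rpow, ← Real.rpow_add hl0]
    congr 1
    ring
  rw [div_le_iff₀ hm0]
  calc (l.factorial : ℝ) ^ (s - 1) * √((3 * μ + l).factorial : ℝ)
      ≤ (l.factorial : ℝ) ^ (s - 1) *
        (16 ^ (μ + l) * (μ.factorial * √μ.factorial * √l.factorial)) := by gcongr
    _ = 16 ^ (μ + l) * (√μ.factorial * ((l.factorial : ℝ) ^ (s - 1) * √l.factorial)) * μ.factorial := by
        ring
    _ ≤ 16 ^ (μ + l) * ((μ.factorial : ℝ) ^ (s - 1 / 2) * (l.factorial : ℝ) ^ (s - 1 / 2)) *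
        μ.factorial := by rw [h3]; gcongr
    _ ≤ _ := by
        gcongr
        exact factorial_mul_factorial_rpow_le (by linarith) μ l

theorem factorial_two_mul_rpow_le {s : ℝ} (hs : 1 ≤ s) (k : ℕ) :
    ((2 * k).factorial : ℝ) ^ (s - 1 / 2) ≤ (4 ^ s) ^ k * (k.factorial : ℝ) ^ (2 * s - 1) := by
  have h : ((2 * k).factorial : ℝ) ≤ 4 ^ k * (k.factorial : ℝ) ^ (2 : ℕ) := by
    have := factorial_add_le k k
    rw [← two_mul, pow_mul] at this
    norm_num at this
    rw [sq]
    exact_mod_cast this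
  have hk : (0 : ℝ) ≤ k.factorial := by positivity
  calc ((2 * k).factorial : ℝ) ^ (s - 1 / 2)
      ≤ (4 ^ k * (k.factorial : ℝ) ^ (2 : ℕ)) ^ (s - 1 / 2) :=
        Real.rpow_le_rpow (by positivity) h (by linarith)
    _ = ((4 : ℝ) ^ k) ^ (s - 1 / 2) * (k.factorial : ℝ) ^ (2 * s - 1) := by
        rw [Real.mul_rpow (by positivity) (by positivity), ← Real.rpow_natCast _ 2, ← Real.rpow_mul hk]
        congr 2
        push_cast
        ring
    _ = ((4 : ℝ) ^ (s - 1 / 2)) ^ k * (k.factorial : ℝ) ^ (2 * s - 1) := by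
        rw [← Real.rpow_natCast, ← Real.rpow_natCast, ← Real.rpow_mul (by norm_num),
          ← Real.rpow_mul (by norm_num), mul_comm (k : ℝ)]
    _ ≤ _ := by
        gcongr
        · norm_num
        · linarith

/-- Half of the exponent absorbs a constant; the whole yields `√p! (a√h)^p`, after a square root of
`t^p ≤ p! e^t` at `t = δ/h`. What remains is `a^p`, and `p!^{s-1}` dominates it because `s > 1`. The
threshold depends on `s` and `δ` only. -/
theorem exists_exp_neg_div_le {s : ℝ} (hs : 1 < s) {δ : ℝ} (hδ : 0 < δ) :
    ∃ h₀ > 0, ∀ h : ℝ, 0 < h → h < h₀ → ∀ p : ℕ,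
      Real.exp (-δ / h) ≤ (p.factorial : ℝ) ^ (s - 1 / 2) * √h ^ p := by
  set ε := s - 1
  have hε : 0 < ε := by simp only [ε]; linarith
  set a : ℝ := √(1 / δ) with ha
  have ha0 : 0 < a := Real.sqrt_pos.2 (by positivity)
  -- `S` bounds `a^p / p!^ε` uniformly in `p`.
  set S : ℝ := Real.exp (a ^ (1 / ε)) ^ ε with hS
  have hS1 : 1 ≤ S := Real.one_le_rpow (Real.one_le_exp (by positivity)) hε.le
  have hSp : ∀ p : ℕ, a ^ p ≤ S * (p.factorial : ℝ) ^ ε := by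
    intro p
    have h1 : (a ^ (1 / ε)) ^ p ≤ p.factorial * Real.exp (a ^ (1 / ε)) := by
      have := Real.pow_div_factorial_le_exp (a ^ (1 / ε)) (by positivity) p
      rwa [div_le_iff₀' (by positivity)] at this
    have h2 := Real.rpow_le_rpow (by positivity) h1 hε.le
    rw [Real.mul_rpow (by positivity) (by positivity)] at h2
    have h3 : ((a ^ (1 / ε)) ^ p) ^ ε = a ^ p := by
      rw [← Real.rpow_natCast, ← Real.rpow_natCast, ← Real.rpow_mul ha0.le, ← Real.rpow_mul ha0.le]
      congr 1
      field_simp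
    rw [h3] at h2
    linarith
  -- Below this value of `h` one has `S ≤ exp(δ/(2h))`; the `+ 1` keeps the denominator positive
  -- when `S = 1`.
  refine ⟨δ / (2 * (Real.log S + 1)), by have := Real.log_nonneg hS1; positivity, ?_⟩
  intro h hh hh0 p
  have hlog := Real.log_nonneg hS1
  have h1 : S ≤ Real.exp (δ / (2 * h)) := by
    rw [← Real.log_le_iff_le_exp (by linarith)]
    rw [lt_div_iff₀ (by positivity)] at hh0
    rw [le_div_iff₀ (by positivity)]
    nlinarith
  have h2 : 1 ≤ √p.factorial * (a * √h) ^ p * Real.exp (δ / (2 * h)) := by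
    have h3 : (δ / h) ^ p ≤ p.factorial * Real.exp (δ / h) := by
      have := Real.pow_div_factorial_le_exp (δ / h) (by positivity) p
      rwa [div_le_iff₀' (by positivity)] at this
    have h4 : (1 : ℝ) ≤ (√p.factorial * (a * √h) ^ p * Real.exp (δ / (2 * h))) ^ 2 := by
      have e1 : (√(p.factorial : ℝ) * (a * √h) ^ p * Real.exp (δ / (2 * h))) ^ 2 =
          p.factorial * Real.exp (δ / h) * (h / δ) ^ p := by
        rw [mul_pow, mul_pow, Real.sq_sqrt (by positivity), ← pow_mul, mul_comm p 2, pow_mul, mul_pow,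
          Real.sq_sqrt hh.le, ha, Real.sq_sqrt (by positivity), ← Real.exp_nat_mul]
        rw [show ((2 : ℕ) : ℝ) * (δ / (2 * h)) = δ / h by push_cast; field_simp,
          show 1 / δ * h = h / δ by ring]
        ring
      rw [e1]
      calc (1 : ℝ) = (δ / h) ^ p * (h / δ) ^ p := by
            rw [← mul_pow, div_mul_div_cancel₀ hh.ne', div_self hδ.ne', one_pow]
        _ ≤ _ := by gcongr
    exact (one_le_sq_iff₀ (by positivity)).1 h4
  have hp0 : (0 : ℝ) < p.factorial := by positivity
  have e2 : √(p.factorial : ℝ) * (p.factorial : ℝ) ^ ε = (p.factorial : ℝ) ^ (s - 1 / 2) := by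
    rw [Real.sqrt_eq_rpow, ← Real.rpow_add hp0]
    congr 1
    simp only [ε]; ring
  have e3 : Real.exp (-δ / h) * Real.exp (δ / (2 * h)) * Real.exp (δ / (2 * h)) = 1 := by
    rw [← Real.exp_add, ← Real.exp_add, ← Real.exp_zero]
    congr 1
    field_simp
    ring
  have hE := Real.exp_pos (-δ / h)
  have hE2 := Real.exp_pos (δ / (2 * h))
  calc Real.exp (-δ / h) = Real.exp (-δ / h) * 1 := (mul_one _).symm
    _ ≤ Real.exp (-δ / h) * (√p.factorial * (a * √h) ^ p * Real.exp (δ / (2 * h))) := by gcongr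
    _ = Real.exp (-δ / h) * Real.exp (δ / (2 * h)) * √p.factorial * √h ^ p * a ^ p := by
        rw [mul_pow]; ring
    _ ≤ Real.exp (-δ / h) * Real.exp (δ / (2 * h)) * √p.factorial * √h ^ p *
        (Real.exp (δ / (2 * h)) * (p.factorial : ℝ) ^ ε) := by
        gcongr
        exact (hSp p).trans (by gcongr)
    _ = (Real.exp (-δ / h) * Real.exp (δ / (2 * h)) * Real.exp (δ / (2 * h))) *
        (√p.factorial * (p.factorial : ℝ) ^ ε) * √h ^ p := by ring
    _ = _ := by rw [e3, e2, one_mul]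

/-- Square, and use `tⁿ ≤ n! eᵗ` with `t = bX²`. Working with the square is what yields `√n!` rather
than `n!`. -/
theorem pow_le_sqrt_factorial_mul_exp {b : ℝ} (hb : 0 < b) (X : ℝ) (n : ℕ) :
    X ^ n ≤ √n.factorial * (√b)⁻¹ ^ n * Real.exp (b * X ^ 2) := by
  refine abs_le_of_sq_le_sq' ?_ (by positivity) |>.2
  have h1 : (b * X ^ 2) ^ n ≤ n.factorial * Real.exp (b * X ^ 2) := by
    have := Real.pow_div_factorial_le_exp (b * X ^ 2) (by positivity) n
    rwa [div_le_iff₀' (by positivity)] at this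
  have h2 : 1 ≤ Real.exp (b * X ^ 2) := Real.one_le_exp (by positivity)
  have e : (√(n.factorial : ℝ) * (√b)⁻¹ ^ n * Real.exp (b * X ^ 2)) ^ 2 =
      n.factorial * Real.exp (b * X ^ 2) * Real.exp (b * X ^ 2) * b⁻¹ ^ n := by
    rw [mul_pow, mul_pow, Real.sq_sqrt (by positivity), ← pow_mul, mul_comm n 2, pow_mul, inv_pow,
      Real.sq_sqrt hb.le]
    ring
  rw [e]
  calc (X ^ n) ^ 2 = (b * X ^ 2) ^ n * 1 * b⁻¹ ^ n := by
        rw [mul_one, ← mul_pow, ← pow_mul, mul_comm n 2, pow_mul]; congr 1; field_simp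
    _ ≤ _ := by gcongr

theorem norm_exp_sub_sum_le_pow_div_factorial (z : ℂ) (n : ℕ) :
    ‖Complex.exp z - ∑ m ∈ Finset.range n, z ^ m / m.factorial‖ ≤
      ‖z‖ ^ n / n.factorial * Real.exp ‖z‖ := by
  refine (Complex.norm_exp_sub_sum_le_exp_norm_sub_sum z n).trans ?_
  have hs := Real.summable_pow_div_factorial ‖z‖
  have h1 : Real.exp ‖z‖ = ∑' m : ℕ, ‖z‖ ^ m / m.factorial := by
    rw [Real.exp_eq_exp_ℝ, NormedSpace.exp_eq_tsum_div]
  have h2 := hs.sum_add_tsum_nat_add n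
  have h3 : Real.exp ‖z‖ - ∑ m ∈ Finset.range n, ‖z‖ ^ m / m.factorial =
      ∑' m : ℕ, ‖z‖ ^ (m + n) / (m + n).factorial := by rw [h1, ← h2]; ring
  rw [h3, h1, ← tsum_mul_left]
  refine ((summable_nat_add_iff n).2 hs).tsum_le_tsum (fun m => ?_) (hs.mul_left _)
  rw [div_mul_div_comm, ← pow_add, add_comm n m]
  gcongr
  exact_mod_cast (mul_comm _ _).trans_le
    (Nat.le_of_dvd (Nat.factorial_pos _) (Nat.factorial_mul_factorial_dvd_factorial_add m n))

end Numeric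

/-! ### The remainder `g` beyond second order. -/

section Remainder

variable {f : EuclideanSpace ℝ (Fin d) → ℂ} {x₀ : EuclideanSpace ℝ (Fin d)}

theorem contDiff_quad_sub (A : Matrix (Fin d) (Fin d) ℂ) (x₀ : EuclideanSpace ℝ (Fin d)) :
    ContDiff ℝ ∞ fun x : 𝔼 => quad A (x - x₀) :=
  (contDiff_quad A).comp (contDiff_id.sub contDiff_const)

theorem gRem_eq (f : 𝔼 → ℂ) (x₀ x : 𝔼) :
    gRem f x₀ x = f x + -(1 / 2) * quad (hess f x₀) (x - x₀) := by
  simp [gRem, quad, sub_eq_add_neg]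

theorem contDiff_gRem (hf : ContDiff ℝ ∞ f) : ContDiff ℝ ∞ (gRem f x₀) := by
  rw [funext (gRem_eq f x₀)]
  exact hf.add (contDiff_const.mul (contDiff_quad_sub _ _))

theorem pderiv_comp_sub (F : 𝔼 → ℂ) (x₀ : EuclideanSpace ℝ (Fin d)) (i : Fin d) :
    pderiv i (fun x => F (x - x₀)) = fun x => pderiv i F (x - x₀) := by
  funext x
  simp only [pderiv, fderiv_comp_sub]

theorem contDiff_coord_sub (i : Fin d) (x₀ : EuclideanSpace ℝ (Fin d)) :
    ContDiff ℝ ∞ fun x : 𝔼 => (((x - x₀) i : ℝ) : ℂ) :=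
  (contDiff_coord i).comp (contDiff_id.sub contDiff_const)

theorem pderiv_gRem (hf : ContDiff ℝ ∞ f) (l : Fin d) :
    pderiv l (gRem f x₀) =
      fun x => pderiv l f x + -∑ i, hess f x₀ l i * (((x - x₀) i : ℝ) : ℂ) := by
  rw [funext (gRem_eq f x₀), pderiv_add hf (contDiff_const.mul (contDiff_quad_sub _ _)),
    pderiv_const_mul (contDiff_quad_sub _ _), pderiv_comp_sub, pderiv_quad (hess_symm hf x₀)]
  funext x
  ring

theorem pderiv_pderiv_gRem (hf : ContDiff ℝ ∞ f) (k l : Fin d) :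
    pderiv k (pderiv l (gRem f x₀)) = fun x => pderiv k (pderiv l f) x + -hess f x₀ l k := by
  have hc : ∀ i, ContDiff ℝ ∞ fun x : 𝔼 => hess f x₀ l i * (((x - x₀) i : ℝ) : ℂ) :=
    fun i => contDiff_const.mul (contDiff_coord_sub i x₀)
  have hc' : ContDiff ℝ ∞ fun x : 𝔼 => ∑ i, hess f x₀ l i * (((x - x₀) i : ℝ) : ℂ) :=
    ContDiff.sum fun i _ => hc i
  rw [pderiv_gRem hf, pderiv_add (contDiff_pderiv hf l) hc'.neg]
  funext x
  congr 1
  have h1 : (fun x : 𝔼 => -∑ i, hess f x₀ l i * (((x - x₀) i : ℝ) : ℂ)) =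
      fun x => (-1) * ∑ i, hess f x₀ l i * (((x - x₀) i : ℝ) : ℂ) := by funext x; ring
  rw [h1, pderiv_const_mul hc', pderiv_sum _ hc]
  have h2 : ∀ i, pderiv k (fun x : 𝔼 => hess f x₀ l i * (((x - x₀) i : ℝ) : ℂ)) x =
      hess f x₀ l i * if k = i then 1 else 0 := by
    intro i
    rw [pderiv_const_mul (contDiff_coord_sub i x₀)]
    exact congrArg _ (congrFun (pderiv_coord k i (x₀ i)) x)
  simp only [h2]
  simp

theorem wderiv_gRem (hf : ContDiff ℝ ∞ f) {w : List (Fin d)} (hw : 3 ≤ w.length) :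
    wderiv w (gRem f x₀) = wderiv w f := by
  match w, hw with
  | l :: k :: m :: w, _ =>
    simp only [wderiv_cons]
    rw [pderiv_pderiv_gRem hf, pderiv_add (contDiff_pderiv (contDiff_pderiv hf l) k) contDiff_const,
      pderiv_const]
    simp only [add_zero]

theorem wderiv_gRem_eq_zero (hf : ContDiff ℝ ∞ f) (h0 : f x₀ = 0) (h1 : fderiv ℝ f x₀ = 0)
    {w : List (Fin d)} (hw : w.length < 3) : wderiv w (gRem f x₀) x₀ = 0 := by
  match w, hw with
  | [], _ => simp [gRem_eq, h0, quad]
  | [l], _ =>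
    simp only [wderiv_cons, wderiv_nil, pderiv_gRem hf]
    simp [pderiv, h1]
  | [l, k], _ =>
    simp only [wderiv_cons, wderiv_nil, pderiv_pderiv_gRem hf]
    rw [hess_symm hf x₀ l k]
    simp [hess]

theorem tay_gRem_eq_zero (hf : ContDiff ℝ ∞ f) (h0 : f x₀ = 0) (h1 : fderiv ℝ f x₀ = 0) {n : ℕ}
    (hn : n < 3) (x : 𝔼) : tay x₀ n (gRem f x₀) x = 0 := by
  have := norm_tay_le x₀ n (gRem f x₀) le_rfl
    (fun w hw => by rw [wderiv_gRem_eq_zero hf h0 h1 (hw ▸ hn), norm_zero]) x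
  simpa using this

theorem factorial_add_three_rpow_le {σ : ℝ} (hσ : 0 ≤ σ) (n : ℕ) :
    ((n + 3).factorial : ℝ) ^ σ ≤ 48 ^ σ * ((2 ^ σ) ^ n * (n.factorial : ℝ) ^ σ) := by
  have h : ((n + 3).factorial : ℝ) ≤ 48 * (2 ^ n * n.factorial) := by
    have := factorial_add_le n 3
    rw [pow_add, show Nat.factorial 3 = 6 from rfl] at this
    have h' : ((n + 3).factorial : ℝ) ≤ 2 ^ n * 2 ^ 3 * (n.factorial * 6) := by exact_mod_cast this
    linarith
  refine (Real.rpow_le_rpow (by positivity) h hσ).trans (le_of_eq ?_)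
  rw [Real.mul_rpow (by positivity) (by positivity), Real.mul_rpow (by positivity) (by positivity),
    ← Real.rpow_natCast, ← Real.rpow_natCast, ← Real.rpow_mul (by norm_num),
    ← Real.rpow_mul (by norm_num), mul_comm (n : ℝ)]

/-- A Gevrey bound of order `n + 3`, rewritten with the factorials of order `n`. -/
theorem gevrey_shift_le {s A C D : ℝ} (hs : 1 ≤ s) (hA : 0 ≤ A) (hC : 0 ≤ C) (hD : C * 2 ^ (s - 1) ≤ D)
    (n : ℕ) :
    A * C ^ (n + 3) * ((n + 3).factorial : ℝ) ^ (s - 1) ≤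
      A * C ^ 3 * 48 ^ (s - 1) * (D ^ n * (n.factorial : ℝ) ^ (s - 1)) := by
  calc A * C ^ (n + 3) * ((n + 3).factorial : ℝ) ^ (s - 1)
      ≤ A * C ^ (n + 3) * (48 ^ (s - 1) * ((2 ^ (s - 1)) ^ n * (n.factorial : ℝ) ^ (s - 1))) := by
        gcongr
        exact factorial_add_three_rpow_le (by linarith) n
    _ = A * C ^ 3 * 48 ^ (s - 1) * ((C * 2 ^ (s - 1)) ^ n * (n.factorial : ℝ) ^ (s - 1)) := by
        rw [mul_pow]; ring
    _ ≤ _ := by gcongr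

theorem factorial_rpow_eq (s : ℝ) (n : ℕ) :
    (n.factorial : ℝ) ^ s = n.factorial * (n.factorial : ℝ) ^ (s - 1) := by
  have hn : (0 : ℝ) < n.factorial := by positivity
  conv_lhs => rw [show s = 1 + (s - 1) by ring, Real.rpow_add hn, Real.rpow_one]

end Remainder

/-! ### Majorant series for derivatives at a point. -/

section Words

open PowerSeries

/-- The derivatives of `F` at `x₀` along words of length `n` are at most `n! αₙ`. -/
def WordBound (x₀ : EuclideanSpace ℝ (Fin d)) (F : 𝔼 → ℂ) (α : ℝ⟦X⟧) : Prop :=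
  ∀ w : List (Fin d), ‖wderiv w F x₀‖ ≤ w.length.factorial * coeff w.length α

variable {x₀ : EuclideanSpace ℝ (Fin d)}

theorem WordBound.pderiv {F : 𝔼 → ℂ} {α : ℝ⟦X⟧} (h : WordBound x₀ F α) (i : Fin d) :
    WordBound x₀ (pderiv i F) (d⁄dX ℝ α) := by
  intro w
  refine (h (i :: w)).trans (le_of_eq ?_)
  rw [coeff_derivative, List.length_cons, Nat.factorial_succ]
  push_cast
  ring

/-- A partial derivative of the function corresponds to `d⁄dX` of the majorant, and both obey the
Leibniz rule; the binomial sums stay hidden in the product of series. -/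
theorem WordBound.mul {F G : 𝔼 → ℂ} {α β : ℝ⟦X⟧} (hF : ContDiff ℝ ∞ F) (hG : ContDiff ℝ ∞ G)
    (h : WordBound x₀ F α) (h' : WordBound x₀ G β) :
    WordBound x₀ (fun x => F x * G x) (α * β) := by
  intro w
  induction w generalizing F G α β with
  | nil =>
    have h1 := h []
    have h2 := h' []
    simp only [wderiv_nil, List.length_nil, Nat.factorial_zero, Nat.cast_one, one_mul] at h1 h2 ⊢
    rw [norm_mul, coeff_mul]
    simpa using mul_le_mul h1 h2 (norm_nonneg _) ((norm_nonneg _).trans h1)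
  | cons i w ih =>
    have hFi := contDiff_pderiv hF i
    have hGi := contDiff_pderiv hG i
    rw [wderiv_cons, pderiv_mul hF hG, wderiv_add (hFi.mul hG) (hF.mul hGi)]
    refine (norm_add_le _ _).trans ((add_le_add (ih hFi hG (h.pderiv i) h')
      (ih hF hGi h (h'.pderiv i))).trans (le_of_eq ?_))
    have e : ((i :: w).length.factorial : ℝ) * coeff (i :: w).length (α * β) =
        w.length.factorial * coeff w.length (d⁄dX ℝ (α * β)) := by
      rw [coeff_derivative, List.length_cons, Nat.factorial_succ]
      push_cast
      ring
    rw [e, Derivation.leibniz, smul_eq_mul, smul_eq_mul, ← mul_add, ← map_add]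
    congr 2
    ring

theorem WordBound.pow_mul {F G : 𝔼 → ℂ} {α β : ℝ⟦X⟧} (hF : ContDiff ℝ ∞ F) (hG : ContDiff ℝ ∞ G)
    (h : WordBound x₀ F α) (h' : WordBound x₀ G β) (μ : ℕ) :
    WordBound x₀ (fun x => F x ^ μ * G x) (α ^ μ * β) := by
  induction μ with
  | zero => simpa using h'
  | succ μ ih =>
    have e : (fun y => F y ^ (μ + 1) * G y) = fun y => F y * (F y ^ μ * G y) := by
      funext y; ring
    rw [e, pow_succ', mul_assoc]
    exact h.mul hF ((hF.pow μ).mul hG) ih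

theorem wderiv_const_mul {F : 𝔼 → ℂ} (hF : ContDiff ℝ ∞ F) (a : ℂ) (w : List (Fin d)) :
    wderiv w (fun x => a * F x) = fun x => a * wderiv w F x := by
  induction w generalizing F with
  | nil => rfl
  | cons i w ih => rw [wderiv_cons, pderiv_const_mul hF, ih (contDiff_pderiv hF i), wderiv_cons]

theorem wderiv_sum {ι : Type*} (S : Finset ι) {F : ι → 𝔼 → ℂ} (hF : ∀ j, ContDiff ℝ ∞ (F j))
    (w : List (Fin d)) :
    wderiv w (fun x => ∑ j ∈ S, F j x) = fun x => ∑ j ∈ S, wderiv w (F j) x := by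
  induction w generalizing F with
  | nil => rfl
  | cons i w ih =>
    rw [wderiv_cons, pderiv_sum S hF, ih fun j => contDiff_pderiv (hF j) i]
    rfl

theorem norm_quadOp_iterate_le {B : Matrix (Fin d) (Fin d) ℂ} {c₀ M : ℝ} (hc : 0 ≤ c₀) (hM : 0 ≤ M)
    (hB : ∀ i j, ‖B i j‖ ≤ c₀) (ν : ℕ) {F : 𝔼 → ℂ} (hF : ContDiff ℝ ∞ F)
    (h : ∀ w : List (Fin d), w.length = 2 * ν → ‖wderiv w F x₀‖ ≤ M) :
    ‖(quadOp B)^[ν] F x₀‖ ≤ (d ^ 2 * c₀) ^ ν * M := by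
  induction ν generalizing F M with
  | zero => simpa using h [] rfl
  | succ ν ih =>
    rw [Function.iterate_succ_apply]
    refine (ih (M := d ^ 2 * c₀ * M) (by positivity) (contDiff_quadOp hF B) fun w hw => ?_).trans
      (le_of_eq (by ring))
    have h2 : ∀ i j, ContDiff ℝ ∞ fun x => B i j * pderiv i (pderiv j F) x :=
      fun i j => contDiff_const.mul (contDiff_pderiv (contDiff_pderiv hF j) i)
    have e : wderiv w (quadOp B F) x₀ =
        ∑ i, ∑ j, B i j * wderiv (j :: i :: w) F x₀ := by
      unfold quadOp
      rw [wderiv_sum _ (F := fun i x => ∑ j, B i j * pderiv i (pderiv j F) x)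
        fun i => ContDiff.sum fun j _ => h2 i j]
      refine Finset.sum_congr rfl fun i _ => ?_
      rw [wderiv_sum _ (F := fun j x => B i j * pderiv i (pderiv j F) x) (h2 i)]
      refine Finset.sum_congr rfl fun j _ => ?_
      rw [wderiv_const_mul (contDiff_pderiv (contDiff_pderiv hF j) i)]
      rfl
    rw [e]
    calc _ ≤ ∑ _i : Fin d, ∑ _j : Fin d, c₀ * M :=
          norm_sum_le_of_le _ fun i _ => norm_sum_le_of_le _ fun j _ => by
            rw [norm_mul]
            exact mul_le_mul (hB i j) (h _ (by simp [hw]; ring)) (norm_nonneg _) hc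
      _ = _ := by simp; ring

end Words

/-! ### The bound for `L_j`. -/

section Coefficients

open PowerSeries

variable {f u : EuclideanSpace ℝ (Fin d) → ℂ} {x₀ : EuclideanSpace ℝ (Fin d)}

/-- The power series `∑ A Yⁿ n!^σ Xⁿ`. -/
def gevreySeries (σ Y A : ℝ) : ℝ⟦X⟧ := PowerSeries.mk fun n => A * (Y ^ n * (n.factorial : ℝ) ^ σ)

theorem gevreyCoeff_gevreySeries {σ Y A : ℝ} (hY : 0 ≤ Y) (hA : 0 ≤ A) :
    GevreyCoeff σ Y A (gevreySeries σ Y A) := fun N => by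
  rw [gevreySeries, coeff_mk, Real.norm_of_nonneg (by positivity)]

theorem wordBound_of_gevrey {s A C Y : ℝ} (hs : 1 ≤ s) (hA : 0 ≤ A) (hC : 0 ≤ C) (hCY : C ≤ Y)
    (h : GevreyBoundOn s A C {x₀} u) (hu : ContDiff ℝ ∞ u) :
    WordBound x₀ u (gevreySeries (s - 1) Y A) := by
  intro w
  refine (h.norm_wderiv_le (by linarith) hA hC hu w rfl).trans ?_
  rw [gevreySeries, coeff_mk, factorial_rpow_eq]
  calc _ = (w.length.factorial : ℝ) * (A * (C ^ w.length * (w.length.factorial : ℝ) ^ (s - 1))) := by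
        ring
    _ ≤ _ := by gcongr

/-- The factor `X ^ 3` records that derivatives of order below three vanish at `x₀`; from order
three on they are those of `f`. -/
theorem wordBound_gRem {s A C Y : ℝ} (hs : 1 ≤ s) (hA : 0 ≤ A) (hC : 0 ≤ C)
    (hCY : C * 2 ^ (s - 1) ≤ Y) (h : GevreyBoundOn s A C {x₀} f) (hf : ContDiff ℝ ∞ f)
    (h0 : f x₀ = 0) (h1 : fderiv ℝ f x₀ = 0) :
    WordBound x₀ (gRem f x₀) (X ^ 3 * gevreySeries (s - 1) Y (A * C ^ 3 * 48 ^ (s - 1))) := by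
  intro w
  rw [coeff_X_pow_mul']
  split_ifs with hw
  · rw [wderiv_gRem hf hw]
    refine (h.norm_wderiv_le (by linarith) hA hC hf w rfl).trans ?_
    obtain ⟨n, hn⟩ := Nat.exists_eq_add_of_le' hw
    rw [hn, gevreySeries, coeff_mk, factorial_rpow_eq, Nat.add_sub_cancel]
    calc _ = ((n + 3).factorial : ℝ) * (A * C ^ (n + 3) * ((n + 3).factorial : ℝ) ^ (s - 1)) := by
          ring
      _ ≤ _ := mul_le_mul_of_nonneg_left (gevrey_shift_le hs hA hC hCY n) (by positivity)
  · rw [wderiv_gRem_eq_zero hf h0 h1 (not_le.1 hw)]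
    simp

theorem two_mul_add_one_le_four_pow (j : ℕ) : 2 * j + 1 ≤ 4 ^ j := by
  induction j with
  | zero => simp
  | succ n ih => rw [pow_succ]; omega

theorem norm_Lop_le {s Au Cu Af Cf c₀ : ℝ} (hs : 1 ≤ s) (hAu : 0 ≤ Au) (hCu : 0 ≤ Cu) (hAf : 0 ≤ Af)
    (hCf : 0 ≤ Cf) (hc₀ : 0 ≤ c₀) (hf : ContDiff ℝ ∞ f) (hu : ContDiff ℝ ∞ u)
    (h0 : f x₀ = 0) (h1 : fderiv ℝ f x₀ = 0)
    (hub : GevreyBoundOn s Au Cu {x₀} u) (hfb : GevreyBoundOn s Af Cf {x₀} f)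
    (hH : ∀ i j, ‖(hess f x₀)⁻¹ i j‖ ≤ c₀) (j : ℕ) :
    ‖Lop f x₀ j u‖ ≤ 2 * Au * (4 * (1 + d ^ 2 * c₀) ^ 3 *
      (1 + 2 * (Af * Cf ^ 3 * 48 ^ (s - 1))) ^ 2 * (1 + 2 * (Cu + Cf * 2 ^ (s - 1))) ^ 2 *
      256 * 4 ^ s) ^ j * (j.factorial : ℝ) ^ (2 * s - 1) := by
  set B : ℝ := Af * Cf ^ 3 * 48 ^ (s - 1)
  set Y : ℝ := Cu + Cf * 2 ^ (s - 1)
  have hB : 0 ≤ B := by positivity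
  have hY : 0 ≤ Y := by positivity
  have hσ : 0 ≤ s - 1 := by linarith
  have hwg := wordBound_gRem (Y := Y) hs hAf hCf (by simp only [Y]; linarith) hfb hf h0 h1
  have hCY : Cu ≤ 2 * Y := by
    have : 0 ≤ Cf * 2 ^ (s - 1) := by positivity
    simp only [Y]; linarith
  have hwu := wordBound_of_gevrey hs hAu hCu hCY hub hu
  have hg := contDiff_gRem (x₀ := x₀) hf
  have hterm : ∀ μ ∈ Finset.range (2 * j + 1),
      ‖Complex.I ^ (μ + (j + μ)) /
        ((2 : ℂ) ^ (j + μ) * (μ.factorial : ℂ) * ((j + μ).factorial : ℂ)) *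
      (quadOp (hess f x₀)⁻¹)^[j + μ] (fun x => gRem f x₀ x ^ μ * u x) x₀‖ ≤
      Au * ((1 + d ^ 2 * c₀) ^ (3 * j) * (1 + 2 * B) ^ (2 * j) * (1 + 2 * Y) ^ (2 * j) *
        (16 ^ (2 * j) * ((2 * j).factorial : ℝ) ^ (s - 1 / 2))) := by
    intro μ hμ
    obtain ⟨l, hl⟩ := Nat.exists_eq_add_of_le (Nat.lt_succ_iff.1 (Finset.mem_range.1 hμ))
    -- With `l = 2j - μ`, the `2ν` derivatives split into the `3μ` consumed by `g^μ` and `l` free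
    -- ones.
    have h2ν : 2 * (j + μ) = 3 * μ + l := by omega
    have hw : ∀ w : List (Fin d), w.length = 2 * (j + μ) →
        ‖wderiv w (fun x => gRem f x₀ x ^ μ * u x) x₀‖ ≤
        (2 * (j + μ)).factorial * (Au * (2 * B) ^ μ * ((2 * Y) ^ l * (l.factorial : ℝ) ^ (s - 1))) := by
      intro w hw
      refine (hwg.pow_mul hg hu hwu μ w).trans ?_
      rw [hw, mul_pow, ← pow_mul, mul_assoc (X ^ (3 * μ)), h2ν, coeff_X_pow_mul', if_pos (by omega),
        Nat.add_sub_cancel_left]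
      gcongr
      exact (le_abs_self _).trans ((gevreyCoeff_gevreySeries hY hB).pow_mul hσ hY hB hAu
        (gevreyCoeff_gevreySeries (by positivity) hAu) μ l)
    have hq := norm_quadOp_iterate_le hc₀ (by positivity) hH (j + μ) ((hg.pow μ).mul hu) hw
    -- Only one of the two factors `√(2ν)!` is estimated: it cancels the `2^ν ν!` in the
    -- denominator. The other goes into `factorial_quotient_le`.
    have hfac : ((2 * (j + μ)).factorial : ℝ) ≤
        2 ^ (j + μ) * (j + μ).factorial * √((3 * μ + l).factorial) := by
      rw [← h2ν]
      have h4 : √((2 * (j + μ)).factorial : ℝ) ≤ 2 ^ (j + μ) * (j + μ).factorial := by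
        refine Real.sqrt_le_iff.2 ⟨by positivity, ?_⟩
        have := factorial_add_le (j + μ) (j + μ)
        rw [← two_mul, pow_mul] at this
        norm_num at this
        have h5 : ((2 * (j + μ)).factorial : ℝ) ≤
            4 ^ (j + μ) * ((j + μ).factorial * (j + μ).factorial) := by exact_mod_cast this
        refine h5.trans (le_of_eq ?_)
        rw [mul_pow, ← pow_mul, mul_comm (j + μ) 2, pow_mul]
        norm_num
        ring
      calc ((2 * (j + μ)).factorial : ℝ) =
          √((2 * (j + μ)).factorial : ℝ) * √((2 * (j + μ)).factorial : ℝ) :=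
            (Real.mul_self_sqrt (by positivity)).symm
        _ ≤ _ := by gcongr
    have hphi := factorial_quotient_le hs μ l
    rw [norm_mul, norm_div, norm_pow, Complex.norm_I, one_pow, norm_mul, norm_mul, norm_pow,
      Complex.norm_natCast, Complex.norm_natCast, Complex.norm_ofNat]
    calc _ ≤ 1 / (2 ^ (j + μ) * μ.factorial * (j + μ).factorial) * ((d ^ 2 * c₀) ^ (j + μ) *
          ((2 ^ (j + μ) * (j + μ).factorial * √((3 * μ + l).factorial)) *
            (Au * (2 * B) ^ μ * ((2 * Y) ^ l * (l.factorial : ℝ) ^ (s - 1))))) := by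
          gcongr
          refine hq.trans ?_
          gcongr
      _ = Au * ((d ^ 2 * c₀) ^ (j + μ) * (2 * B) ^ μ * (2 * Y) ^ l *
          ((l.factorial : ℝ) ^ (s - 1) * √((3 * μ + l).factorial) / μ.factorial)) := by
          field_simp
      _ ≤ Au * ((1 + d ^ 2 * c₀) ^ (3 * j) * (1 + 2 * B) ^ (2 * j) * (1 + 2 * Y) ^ (2 * j) *
          (16 ^ (μ + l) * ((μ + l).factorial : ℝ) ^ (s - 1 / 2))) := by
          have p1 : (d ^ 2 * c₀ : ℝ) ^ (j + μ) ≤ (1 + d ^ 2 * c₀) ^ (3 * j) :=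
            (pow_le_pow_left₀ (by positivity) (by linarith) _).trans
              (pow_le_pow_right₀ (by nlinarith [sq_nonneg (d : ℝ)]) (by omega))
          have p2 : (2 * B) ^ μ ≤ (1 + 2 * B) ^ (2 * j) :=
            (pow_le_pow_left₀ (by positivity) (by linarith) _).trans
              (pow_le_pow_right₀ (by linarith) (by omega))
          have p3 : (2 * Y) ^ l ≤ (1 + 2 * Y) ^ (2 * j) :=
            (pow_le_pow_left₀ (by positivity) (by linarith) _).trans
              (pow_le_pow_right₀ (by linarith) (by omega))
          gcongr
      _ = _ := by rw [← hl]
  have hcount : ((2 * j + 1 : ℕ) : ℝ) ≤ 4 ^ j := by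
    exact_mod_cast two_mul_add_one_le_four_pow j
  calc ‖Lop f x₀ j u‖ ≤ ∑ _μ ∈ Finset.range (2 * j + 1), Au * ((1 + d ^ 2 * c₀) ^ (3 * j) *
        (1 + 2 * B) ^ (2 * j) * (1 + 2 * Y) ^ (2 * j) *
        (16 ^ (2 * j) * ((2 * j).factorial : ℝ) ^ (s - 1 / 2))) := norm_sum_le_of_le _ hterm
    _ = ((2 * j + 1 : ℕ) : ℝ) * (Au * ((1 + d ^ 2 * c₀) ^ (3 * j) *
        (1 + 2 * B) ^ (2 * j) * (1 + 2 * Y) ^ (2 * j) *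
        (16 ^ (2 * j) * ((2 * j).factorial : ℝ) ^ (s - 1 / 2)))) := by
        rw [Finset.sum_const, Finset.card_range, nsmul_eq_mul]
    _ ≤ 4 ^ j * (Au * ((1 + d ^ 2 * c₀) ^ (3 * j) *
        (1 + 2 * B) ^ (2 * j) * (1 + 2 * Y) ^ (2 * j) *
        (16 ^ (2 * j) * ((4 ^ s) ^ j * (j.factorial : ℝ) ^ (2 * s - 1))))) := by
        gcongr
        exact factorial_two_mul_rpow_le hs j
    _ = Au * (4 * (1 + d ^ 2 * c₀) ^ 3 * (1 + 2 * B) ^ 2 * (1 + 2 * Y) ^ 2 * 256 * 4 ^ s) ^ j *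
        (j.factorial : ℝ) ^ (2 * s - 1) := by
        rw [show (256 : ℝ) = 16 ^ 2 by norm_num]
        simp only [mul_pow, ← pow_mul]
        ring
    _ ≤ _ := by
        gcongr
        linarith

end Coefficients

/-! ### Taylor bounds for `g^μ u` and their interplay with the Gaussian. -/

section Pointwise

open PowerSeries

variable {f u : EuclideanSpace ℝ (Fin d) → ℂ} {x₀ : EuclideanSpace ℝ (Fin d)}

theorem gevrey_taylor_eq (s A C T : ℝ) (n : ℕ) :
    A * C ^ n * (n.factorial : ℝ) ^ s * T ^ n / n.factorial =
      A * (C * T) ^ n * (n.factorial : ℝ) ^ (s - 1) := by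
  have hn : (0 : ℝ) < n.factorial := by positivity
  rw [factorial_rpow_eq, mul_pow]
  field_simp

theorem norm_tay_le_of_gevrey {s A C : ℝ} (hA : 0 ≤ A) (hC : 0 ≤ C) (n : ℕ)
    (h : ∀ w : List (Fin d), w.length = n → ‖wderiv w u x₀‖ ≤ A * C ^ n * (n.factorial : ℝ) ^ s)
    (x : 𝔼) :
    ‖tay x₀ n u x‖ ≤ A * (C * (d * ‖x‖)) ^ n * (n.factorial : ℝ) ^ (s - 1) := by
  rw [← gevrey_taylor_eq]
  exact norm_tay_le x₀ n u (by positivity) h x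

theorem norm_sub_sum_tay_le_of_gevrey {s A C : ℝ} (hA : 0 ≤ A) (hC : 0 ≤ C) (N : ℕ)
    (hu : ContDiff ℝ ∞ u) (x : 𝔼)
    (h : ∀ w : List (Fin d), w.length = N → ∀ t ∈ Set.Icc (0 : ℝ) 1,
      ‖wderiv w u (x₀ + t • x)‖ ≤ A * C ^ N * (N.factorial : ℝ) ^ s) :
    ‖u (x₀ + x) - ∑ n ∈ Finset.range N, tay x₀ n u x‖ ≤
      A * (C * (d * ‖x‖)) ^ N * (N.factorial : ℝ) ^ (s - 1) := by
  have := norm_sub_sum_tay_le x₀ N hu (by positivity) x h (t := 1) (by simp)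
  rw [one_smul, one_pow, mul_one] at this
  rwa [← gevrey_taylor_eq]

/-- The Taylor series of the cubic remainder along a ray, divided by `X ^ 3`. -/
def remSeries (f : EuclideanSpace ℝ (Fin d) → ℂ) (x₀ x : EuclideanSpace ℝ (Fin d)) : ℂ⟦X⟧ :=
  PowerSeries.mk fun n => tay x₀ (n + 3) (gRem f x₀) x

theorem taySeries_gRem (hf : ContDiff ℝ ∞ f) (h0 : f x₀ = 0) (h1 : fderiv ℝ f x₀ = 0) (x : 𝔼) :
    taySeries x₀ (gRem f x₀) x = X ^ 3 * remSeries f x₀ x := by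
  ext n
  rw [coeff_taySeries, coeff_X_pow_mul']
  split_ifs with hn
  · rw [remSeries, coeff_mk, Nat.sub_add_cancel hn]
  · exact tay_gRem_eq_zero hf h0 h1 (not_le.1 hn) x

theorem taySeries_gRem_pow_mul (hf : ContDiff ℝ ∞ f) (hu : ContDiff ℝ ∞ u) (h0 : f x₀ = 0)
    (h1 : fderiv ℝ f x₀ = 0) (μ : ℕ) (x : 𝔼) :
    taySeries x₀ (fun y => gRem f x₀ y ^ μ * u y) x =
      X ^ (3 * μ) * (remSeries f x₀ x ^ μ * taySeries x₀ u x) := by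
  rw [taySeries_pow_mul x₀ (contDiff_gRem hf) hu, taySeries_gRem hf h0 h1, mul_pow, pow_mul,
    mul_assoc]

theorem gevreyCoeff_taySeries {s A C Y : ℝ} (hs : 1 ≤ s) (hA : 0 ≤ A) (hC : 0 ≤ C)
    (hu : ContDiff ℝ ∞ u) (h : GevreyBoundOn s A C {x₀} u) (x : 𝔼) (hY : C * (d * ‖x‖) ≤ Y) :
    GevreyCoeff (s - 1) Y A (taySeries x₀ u x) := by
  intro N
  rw [coeff_taySeries]
  refine (norm_tay_le_of_gevrey (s := s) hA hC N (fun w hw => ?_) x).trans ?_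
  · simpa [hw] using h.norm_wderiv_le (by linarith) hA hC hu w rfl
  · rw [mul_assoc]; gcongr

theorem gevreyCoeff_remSeries {s A C D : ℝ} (hs : 1 ≤ s) (hA : 0 ≤ A) (hC : 0 ≤ C)
    (hf : ContDiff ℝ ∞ f) (h : GevreyBoundOn s A C {x₀} f) (x : 𝔼)
    (hD : C * (d * ‖x‖) * 2 ^ (s - 1) ≤ D) :
    GevreyCoeff (s - 1) D (A * (C * (d * ‖x‖)) ^ 3 * 48 ^ (s - 1)) (remSeries f x₀ x) := by
  intro N
  rw [remSeries, coeff_mk]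
  refine (norm_tay_le_of_gevrey (s := s) hA hC (N + 3) (fun w hw => ?_) x).trans
    (gevrey_shift_le hs hA (by positivity) hD N)
  rw [wderiv_gRem hf (by omega)]
  simpa [hw] using h.norm_wderiv_le (by linarith) hA hC hf w rfl

theorem hasGevreyExpansion_taySeries {s A C Y : ℝ} (hs : 1 ≤ s) (hA : 0 ≤ A) (hC : 0 ≤ C)
    (hu : ContDiff ℝ ∞ u) {V : Set 𝔼} (h : GevreyBoundOn s A C V u) (x : 𝔼)
    (hV : ∀ t ∈ Set.Icc (0 : ℝ) 1, x₀ + t • x ∈ V) (hY : C * (d * ‖x‖) ≤ Y) :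
    HasGevreyExpansion (s - 1) Y A (u (x₀ + x)) (taySeries x₀ u x) := by
  have hx₀ : x₀ ∈ V := by simpa using hV 0 (by simp)
  refine ⟨gevreyCoeff_taySeries hs hA hC hu
    (fun α y hy => h α y ((Set.mem_singleton_iff.1 hy) ▸ hx₀)) x hY, fun N => ?_⟩
  simp only [coeff_taySeries]
  refine (norm_sub_sum_tay_le_of_gevrey (s := s) hA hC N hu x (fun w hw t ht => ?_)).trans ?_
  · simpa [hw] using h.norm_wderiv_le (by linarith) hA hC hu w (hV t ht)
  · rw [mul_assoc]; gcongr

theorem hasGevreyExpansion_remSeries {s A C D : ℝ} (hs : 1 ≤ s) (hA : 0 ≤ A) (hC : 0 ≤ C)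
    (hf : ContDiff ℝ ∞ f) (h0 : f x₀ = 0) (h1 : fderiv ℝ f x₀ = 0) {V : Set 𝔼}
    (h : GevreyBoundOn s A C V f) (x : 𝔼)
    (hV : ∀ t ∈ Set.Icc (0 : ℝ) 1, x₀ + t • x ∈ V) (hD : C * (d * ‖x‖) * 2 ^ (s - 1) ≤ D) :
    HasGevreyExpansion (s - 1) D (A * (C * (d * ‖x‖)) ^ 3 * 48 ^ (s - 1)) (gRem f x₀ (x₀ + x))
      (remSeries f x₀ x) := by
  have hx₀ : x₀ ∈ V := by simpa using hV 0 (by simp)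
  refine ⟨gevreyCoeff_remSeries hs hA hC hf
    (fun α y hy => h α y ((Set.mem_singleton_iff.1 hy) ▸ hx₀)) x hD, fun N => ?_⟩
  have e : ∑ n ∈ Finset.range N, coeff n (remSeries f x₀ x) =
      ∑ n ∈ Finset.range (N + 3), tay x₀ n (gRem f x₀) x := by
    simp only [remSeries, coeff_mk]
    rw [add_comm N 3, Finset.sum_range_add]
    have : ∑ n ∈ Finset.range 3, tay x₀ n (gRem f x₀) x = 0 :=
      Finset.sum_eq_zero fun n hn => tay_gRem_eq_zero hf h0 h1 (Finset.mem_range.1 hn) x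
    simp only [this, zero_add, add_comm]
  rw [e]
  refine (norm_sub_sum_tay_le_of_gevrey (s := s) hA hC (N + 3) (contDiff_gRem hf) x
    (fun w hw t ht => ?_)).trans (gevrey_shift_le hs hA (by positivity) hD N)
  rw [wderiv_gRem hf (by omega)]
  simpa [hw] using h.norm_wderiv_le (by linarith) hA hC hf w (hV t ht)

/-- The Gevrey size of the term of order `3μ + l` in the expansion of `g^μ u`. -/
def termSize (s A b y : ℝ) (μ l : ℕ) (T : ℝ) : ℝ :=
  A * (2 * b) ^ μ * ((2 * y) ^ l * (l.factorial : ℝ) ^ (s - 1)) * T ^ (3 * μ + l)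

variable {s Au Cu Af Cf : ℝ}

theorem termSize_eq (s A b y : ℝ) (μ l : ℕ) (T : ℝ) :
    A * (2 * (b * T ^ 3)) ^ μ * ((2 * (y * T)) ^ l * (l.factorial : ℝ) ^ (s - 1)) =
      termSize s A b y μ l T := by
  rw [termSize, pow_add, pow_mul]
  simp only [mul_pow]
  ring

theorem norm_tay_gRem_pow_mul_le (hs : 1 ≤ s) (hAu : 0 ≤ Au) (hCu : 0 ≤ Cu) (hAf : 0 ≤ Af)
    (hCf : 0 ≤ Cf) (hf : ContDiff ℝ ∞ f) (hu : ContDiff ℝ ∞ u) (h0 : f x₀ = 0)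
    (h1 : fderiv ℝ f x₀ = 0) (hub : GevreyBoundOn s Au Cu {x₀} u)
    (hfb : GevreyBoundOn s Af Cf {x₀} f) (μ l : ℕ) (x : 𝔼) :
    ‖tay x₀ (3 * μ + l) (fun y => gRem f x₀ y ^ μ * u y) x‖ ≤
      termSize s Au (Af * (Cf * d) ^ 3 * 48 ^ (s - 1)) ((Cu + Cf * 2 ^ (s - 1)) * d) μ l ‖x‖ := by
  have hσ : 0 ≤ s - 1 := by linarith
  set Y : ℝ := (Cu + Cf * 2 ^ (s - 1)) * d * ‖x‖ with hY
  have hY0 : 0 ≤ Y := by positivity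
  have hg := gevreyCoeff_remSeries (D := Y) hs hAf hCf hf hfb x (by
    rw [hY]
    have : 0 ≤ Cu * d * ‖x‖ := by positivity
    linarith)
  have hu' := gevreyCoeff_taySeries (Y := 2 * Y) hs hAu hCu hu hub x (by
    rw [hY]
    have : 0 ≤ Cu * d * ‖x‖ := by positivity
    have : 0 ≤ Cf * 2 ^ (s - 1) * d * ‖x‖ := by positivity
    linarith)
  have h := hg.pow_mul hσ hY0 (by positivity) hAu hu' μ l
  rw [← coeff_taySeries, taySeries_gRem_pow_mul hf hu h0 h1, coeff_X_pow_mul', if_pos (by omega),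
    Nat.add_sub_cancel_left, ← termSize_eq]
  refine h.trans (le_of_eq ?_)
  rw [hY]
  ring

/-- The series of `g^μ u` is `X ^ (3 * μ)` times a product of Gevrey size. Truncating it at `3μ + l`
truncates that product at `l`, which is why `l!` enters and not `(3μ + l)!`. -/
theorem norm_sub_sum_tay_gRem_pow_mul_le (hs : 1 ≤ s) (hAu : 0 ≤ Au) (hCu : 0 ≤ Cu) (hAf : 0 ≤ Af)
    (hCf : 0 ≤ Cf) (hf : ContDiff ℝ ∞ f) (hu : ContDiff ℝ ∞ u) (h0 : f x₀ = 0)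
    (h1 : fderiv ℝ f x₀ = 0) {V : Set 𝔼} (hub : GevreyBoundOn s Au Cu V u)
    (hfb : GevreyBoundOn s Af Cf V f) (μ l : ℕ) (x : 𝔼)
    (hV : ∀ t ∈ Set.Icc (0 : ℝ) 1, x₀ + t • x ∈ V) :
    ‖gRem f x₀ (x₀ + x) ^ μ * u (x₀ + x) -
        ∑ n ∈ Finset.range (3 * μ + l), tay x₀ n (fun y => gRem f x₀ y ^ μ * u y) x‖ ≤
      termSize s Au (Af * (Cf * d) ^ 3 * 48 ^ (s - 1)) ((Cu + Cf * 2 ^ (s - 1)) * d) μ l ‖x‖ := by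
  have hσ : 0 ≤ s - 1 := by linarith
  set Y : ℝ := (Cu + Cf * 2 ^ (s - 1)) * d * ‖x‖ with hY
  have hY0 : 0 ≤ Y := by positivity
  have hg := hasGevreyExpansion_remSeries (D := Y) hs hAf hCf hf h0 h1 hfb x hV (by
    rw [hY]
    have : 0 ≤ Cu * d * ‖x‖ := by positivity
    linarith)
  have hu' := hasGevreyExpansion_taySeries (Y := 2 * Y) hs hAu hCu hu hub x hV (by
    rw [hY]
    have : 0 ≤ Cu * d * ‖x‖ := by positivity
    have : 0 ≤ Cf * 2 ^ (s - 1) * d * ‖x‖ := by positivity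
    linarith)
  have h := (hg.pow_mul hσ hY0 (by positivity) hAu hu' μ).2 l
  have e : ∑ n ∈ Finset.range (3 * μ + l), tay x₀ n (fun y => gRem f x₀ y ^ μ * u y) x =
      ∑ n ∈ Finset.range l, coeff n (remSeries f x₀ x ^ μ * taySeries x₀ u x) := by
    simp only [← coeff_taySeries, taySeries_gRem_pow_mul hf hu h0 h1, coeff_X_pow_mul']
    rw [Finset.sum_range_add, Finset.sum_eq_zero fun n hn => if_neg (by
      have := Finset.mem_range.1 hn; omega), zero_add]
    exact Finset.sum_congr rfl fun n _ => by rw [if_pos (by omega), Nat.add_sub_cancel_left]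
  rw [e, ← termSize_eq]
  refine h.trans (le_of_eq ?_)
  rw [hY]
  ring

/-- The constant that governs the growth of the rescaled terms. -/
def growth (b y c : ℝ) : ℝ := (1 + 2 * b) * (1 + 2 * y) * (1 + √(8 / c)) ^ 3 * 16

theorem one_le_growth {b y : ℝ} (hb : 0 ≤ b) (hy : 0 ≤ y) (c : ℝ) : 1 ≤ growth b y c := by
  have h1 : 1 ≤ 1 + 2 * b := by linarith
  have h2 : 1 ≤ 1 + 2 * y := by linarith
  have h3 : 1 ≤ (1 + √(8 / c)) ^ 3 := one_le_pow₀ (by linarith [Real.sqrt_nonneg (8 / c)])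
  exact one_le_mul_of_one_le_of_one_le (one_le_mul_of_one_le_of_one_le
    (one_le_mul_of_one_le_of_one_le h1 h2) h3) (by norm_num)

/-- Half of the exponent turns `T^{3μ+l}` into `√(3μ+l)! (√(8/c) √h)^{3μ+l}`. Against `h^{-μ}` the
powers of `h` reduce to `√h^{μ+l}`, and the other half stays for integration. -/
theorem termSize_mul_exp_le {A b y c h T : ℝ} (hs : 1 ≤ s) (hA : 0 ≤ A) (hb : 0 ≤ b) (hy : 0 ≤ y)
    (hc : 0 < c) (hh : 0 < h) (μ l : ℕ) :
    (1 / h) ^ μ / μ.factorial * termSize s A b y μ l T * Real.exp (-(c / (4 * h)) * T ^ 2) ≤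
      A * (growth b y c ^ (μ + l) * ((μ + l).factorial : ℝ) ^ (s - 1 / 2) * √h ^ (μ + l)) *
        Real.exp (-(c / (8 * h)) * T ^ 2) := by
  have hb' : 0 < c / (8 * h) := by positivity
  have hpow := pow_le_sqrt_factorial_mul_exp hb' T (3 * μ + l)
  have hsq : (√(c / (8 * h)))⁻¹ = √(8 / c) * √h := by
    rw [← Real.sqrt_inv, inv_div, ← Real.sqrt_mul (by positivity)]
    congr 1
    ring
  have hexp : Real.exp (c / (8 * h) * T ^ 2) * Real.exp (-(c / (4 * h)) * T ^ 2) =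
      Real.exp (-(c / (8 * h)) * T ^ 2) := by
    rw [← Real.exp_add]
    congr 1
    field_simp
    ring
  have hhp : (1 / h) ^ μ * √h ^ (3 * μ + l) = √h ^ (μ + l) := by
    have : √h ^ (3 * μ + l) = h ^ μ * √h ^ (μ + l) := by
      rw [show 3 * μ + l = 2 * μ + (μ + l) by ring, pow_add, pow_mul, Real.sq_sqrt hh.le]
    rw [this, ← mul_assoc, ← mul_pow, one_div_mul_cancel hh.ne', one_pow, one_mul]
  have hphi := factorial_quotient_le hs μ l
  have hq : 0 ≤ √(8 / c) := Real.sqrt_nonneg _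
  calc (1 / h) ^ μ / μ.factorial * termSize s A b y μ l T * Real.exp (-(c / (4 * h)) * T ^ 2)
      ≤ (1 / h) ^ μ / μ.factorial * (A * (2 * b) ^ μ * ((2 * y) ^ l * (l.factorial : ℝ) ^ (s - 1)) *
        (√((3 * μ + l).factorial) * (√(8 / c) * √h) ^ (3 * μ + l) *
          Real.exp (c / (8 * h) * T ^ 2))) * Real.exp (-(c / (4 * h)) * T ^ 2) := by
        rw [hsq] at hpow
        unfold termSize
        gcongr
    _ = A * (((2 * b) ^ μ * (2 * y) ^ l * √(8 / c) ^ (3 * μ + l)) *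
        ((l.factorial : ℝ) ^ (s - 1) * √((3 * μ + l).factorial) / μ.factorial) *
        ((1 / h) ^ μ * √h ^ (3 * μ + l))) *
        (Real.exp (c / (8 * h) * T ^ 2) * Real.exp (-(c / (4 * h)) * T ^ 2)) := by
        rw [mul_pow (√(8 / c))]
        ring
    _ ≤ A * (((1 + 2 * b) ^ (μ + l) * (1 + 2 * y) ^ (μ + l) * (1 + √(8 / c)) ^ (3 * (μ + l))) *
        (16 ^ (μ + l) * ((μ + l).factorial : ℝ) ^ (s - 1 / 2)) * √h ^ (μ + l)) *
        Real.exp (-(c / (8 * h)) * T ^ 2) := by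
        rw [hexp, hhp]
        have p1 : (2 * b) ^ μ ≤ (1 + 2 * b) ^ (μ + l) :=
          (pow_le_pow_left₀ (by positivity) (by linarith) _).trans
            (pow_le_pow_right₀ (by linarith) (by omega))
        have p2 : (2 * y) ^ l ≤ (1 + 2 * y) ^ (μ + l) :=
          (pow_le_pow_left₀ (by positivity) (by linarith) _).trans
            (pow_le_pow_right₀ (by linarith) (by omega))
        have p3 : √(8 / c) ^ (3 * μ + l) ≤ (1 + √(8 / c)) ^ (3 * (μ + l)) :=
          (pow_le_pow_left₀ (by positivity) (by linarith) _).trans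
            (pow_le_pow_right₀ (by linarith) (by omega))
        gcongr
    _ = _ := by
        simp only [growth, mul_pow, ← pow_mul]
        ring

end Pointwise

/-! ### The integrand against its polynomial model, near and away from `x₀`. -/

section Integrand

open PowerSeries

variable {f u : EuclideanSpace ℝ (Fin d) → ℂ} {x₀ : EuclideanSpace ℝ (Fin d)}
variable {s Au Cu Af Cf : ℝ}

theorem tay_gRem_pow_mul_eq_zero (hf : ContDiff ℝ ∞ f) (hu : ContDiff ℝ ∞ u) (h0 : f x₀ = 0)
    (h1 : fderiv ℝ f x₀ = 0) {μ n : ℕ} (hn : n < 3 * μ) (x : 𝔼) :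
    tay x₀ n (fun y => gRem f x₀ y ^ μ * u y) x = 0 := by
  rw [← coeff_taySeries, taySeries_gRem_pow_mul hf hu h0 h1, coeff_X_pow_mul', if_neg (not_le.2 hn)]

/-- The polynomial that replaces `exp(ig/h) u` in the expansion to order `k`. -/
def approxPoly (f u : EuclideanSpace ℝ (Fin d) → ℂ) (x₀ : EuclideanSpace ℝ (Fin d)) (h : ℝ) (k : ℕ)
    (x : EuclideanSpace ℝ (Fin d)) : ℂ :=
  ∑ μ ∈ Finset.range (2 * k), (Complex.I / h) ^ μ / μ.factorial *
    ∑ n ∈ Finset.range (2 * (k + μ)), tay x₀ n (fun y => gRem f x₀ y ^ μ * u y) x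

/-- The size of the remainder of order `k`. -/
def remSize (d : ℕ) (s Au Cu Af Cf c h : ℝ) (k : ℕ) : ℝ :=
  Au * (growth (Af * (Cf * d) ^ 3 * 48 ^ (s - 1)) ((Cu + Cf * 2 ^ (s - 1)) * d) c ^ (2 * k) *
    ((2 * k).factorial : ℝ) ^ (s - 1 / 2) * √h ^ (2 * k))

theorem norm_I_div_pow_div (h : ℝ) (hh : 0 < h) (μ : ℕ) :
    ‖(Complex.I / h) ^ μ / (μ.factorial : ℂ)‖ = (1 / h) ^ μ / μ.factorial := by
  rw [norm_div, norm_pow, norm_div, Complex.norm_I, Complex.norm_real, Complex.norm_natCast,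
    Real.norm_of_nonneg hh.le]

theorem norm_mul_exp_sub_approxPoly_le {c h : ℝ} (hs : 1 ≤ s) (hAu : 0 ≤ Au) (hCu : 0 ≤ Cu)
    (hAf : 0 ≤ Af) (hCf : 0 ≤ Cf) (hc : 0 < c) (hh : 0 < h) (hf : ContDiff ℝ ∞ f)
    (hu : ContDiff ℝ ∞ u) (h0 : f x₀ = 0) (h1 : fderiv ℝ f x₀ = 0) {V : Set 𝔼}
    (hub : GevreyBoundOn s Au Cu V u) (hfb : GevreyBoundOn s Af Cf V f) (k : ℕ) (x : 𝔼)
    (hV : ∀ t ∈ Set.Icc (0 : ℝ) 1, x₀ + t • x ∈ V) (G : ℂ)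
    (hG : ‖G‖ * Real.exp (‖gRem f x₀ (x₀ + x)‖ / h) ≤ Real.exp (-(c / (4 * h)) * ‖x‖ ^ 2)) :
    ‖G * (Complex.exp (Complex.I / h * gRem f x₀ (x₀ + x)) * u (x₀ + x) -
        approxPoly f u x₀ h k x)‖ ≤
      (2 * k + 1) * (remSize d s Au Cu Af Cf c h k * Real.exp (-(c / (8 * h)) * ‖x‖ ^ 2)) := by
  set b : ℝ := Af * (Cf * d) ^ 3 * 48 ^ (s - 1) with hb
  set y : ℝ := (Cu + Cf * 2 ^ (s - 1)) * d with hy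
  set g := gRem f x₀ (x₀ + x) with hg
  set T := ‖x‖ with hT
  have hb0 : 0 ≤ b := by positivity
  have hy0 : 0 ≤ y := by positivity
  have hR : ∀ μ l : ℕ, μ + l = 2 * k →
      (1 / h) ^ μ / μ.factorial * termSize s Au b y μ l T * Real.exp (-(c / (4 * h)) * T ^ 2) ≤
        remSize d s Au Cu Af Cf c h k * Real.exp (-(c / (8 * h)) * T ^ 2) := by
    intro μ l hμl
    have := termSize_mul_exp_le (T := T) hs hAu hb0 hy0 hc hh μ l
    rw [hμl] at this
    exact this
  have hts : ∀ μ l, 0 ≤ termSize s Au b y μ l T := fun μ l => by unfold termSize; positivity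
  have hG1 : ‖G‖ ≤ Real.exp (-(c / (4 * h)) * T ^ 2) :=
    (le_mul_of_one_le_right (norm_nonneg _) (Real.one_le_exp (by positivity))).trans hG
  -- One error from truncating the exponential series, and one Taylor error for each `μ < 2k`: `2k +
  -- 1` terms, all with `μ + l = 2k`.
  have hdec : G * (Complex.exp (Complex.I / h * g) * u (x₀ + x) - approxPoly f u x₀ h k x) =
      G * ((Complex.exp (Complex.I / h * g) -
        ∑ μ ∈ Finset.range (2 * k), (Complex.I / h * g) ^ μ / μ.factorial) * u (x₀ + x)) +
      ∑ μ ∈ Finset.range (2 * k), G * ((Complex.I / h) ^ μ / μ.factorial * (g ^ μ * u (x₀ + x) -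
        ∑ n ∈ Finset.range (2 * (k + μ)), tay x₀ n (fun y => gRem f x₀ y ^ μ * u y) x)) := by
    rw [← Finset.mul_sum, ← mul_add]
    congr 1
    simp only [mul_sub, Finset.sum_sub_distrib]
    rw [sub_mul, Finset.sum_mul, approxPoly]
    have : ∑ μ ∈ Finset.range (2 * k), (Complex.I / h * g) ^ μ / (μ.factorial : ℂ) * u (x₀ + x) =
        ∑ μ ∈ Finset.range (2 * k), (Complex.I / h) ^ μ / (μ.factorial : ℂ) *
          (g ^ μ * u (x₀ + x)) :=
      Finset.sum_congr rfl fun μ _ => by rw [mul_pow]; ring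
    rw [this]
    ring
  have hz : ‖Complex.I / h * g‖ = ‖g‖ / h := by
    rw [norm_mul, norm_div, Complex.norm_I, Complex.norm_real, Real.norm_of_nonneg hh.le]
    ring
  have hfirst : ‖G * ((Complex.exp (Complex.I / h * g) -
        ∑ μ ∈ Finset.range (2 * k), (Complex.I / h * g) ^ μ / μ.factorial) * u (x₀ + x))‖ ≤
      remSize d s Au Cu Af Cf c h k * Real.exp (-(c / (8 * h)) * T ^ 2) := by
    -- With `l = 0` the subtracted Taylor polynomial vanishes, so this bounds `|g|^{2k} |u|` itself.
    have h2 := norm_sub_sum_tay_gRem_pow_mul_le hs hAu hCu hAf hCf hf hu h0 h1 hub hfb (2 * k) 0 x hV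
    rw [Finset.sum_eq_zero fun n hn => tay_gRem_pow_mul_eq_zero hf hu h0 h1
      (by simpa using hn) x, sub_zero, norm_mul, norm_pow] at h2
    have h3 := norm_exp_sub_sum_le_pow_div_factorial (Complex.I / h * g) (2 * k)
    rw [hz] at h3
    refine le_trans ?_ (hR (2 * k) 0 rfl)
    rw [norm_mul, norm_mul]
    calc _ ≤ ‖G‖ * (((‖g‖ / h) ^ (2 * k) / (2 * k).factorial * Real.exp (‖g‖ / h)) * ‖u (x₀ + x)‖) := by
          gcongr
      _ = (1 / h) ^ (2 * k) / (2 * k).factorial * (‖g‖ ^ (2 * k) * ‖u (x₀ + x)‖) *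
          (‖G‖ * Real.exp (‖g‖ / h)) := by rw [div_eq_mul_one_div ‖g‖ h, mul_pow]; ring
      _ ≤ _ := by
          gcongr
          exact mul_nonneg (by positivity) (hts _ _)
  have hrest : ∀ μ ∈ Finset.range (2 * k), ‖G * ((Complex.I / h) ^ μ / μ.factorial *
      (g ^ μ * u (x₀ + x) -
        ∑ n ∈ Finset.range (2 * (k + μ)), tay x₀ n (fun y => gRem f x₀ y ^ μ * u y) x))‖ ≤
      remSize d s Au Cu Af Cf c h k * Real.exp (-(c / (8 * h)) * T ^ 2) := by
    intro μ hμ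
    obtain ⟨l, hl⟩ := Nat.exists_eq_add_of_le (Finset.mem_range.1 hμ).le
    have h2 := norm_sub_sum_tay_gRem_pow_mul_le hs hAu hCu hAf hCf hf hu h0 h1 hub hfb μ l x hV
    rw [show 3 * μ + l = 2 * (k + μ) by omega] at h2
    refine le_trans ?_ (hR μ l hl.symm)
    rw [norm_mul, norm_mul, norm_I_div_pow_div h hh, mul_comm]
    gcongr
    exact mul_nonneg (by positivity) (hts _ _)
  rw [hdec]
  refine (norm_add_le _ _).trans ((add_le_add hfirst (norm_sum_le_of_le _ hrest)).trans (le_of_eq ?_))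
  rw [Finset.sum_const, Finset.card_range, nsmul_eq_mul]
  push_cast
  ring

/-- For use outside the ball. There are at most `2k · 6k` terms, each of order only `√h^{μ+l}` with
`μ + l < 2k`. -/
theorem norm_mul_approxPoly_le {c h δ : ℝ} (hs : 1 ≤ s) (hAu : 0 ≤ Au) (hCu : 0 ≤ Cu)
    (hAf : 0 ≤ Af) (hCf : 0 ≤ Cf) (hc : 0 < c) (hh : 0 < h) (hf : ContDiff ℝ ∞ f)
    (hu : ContDiff ℝ ∞ u) (h0 : f x₀ = 0) (h1 : fderiv ℝ f x₀ = 0)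
    (hub : GevreyBoundOn s Au Cu {x₀} u) (hfb : GevreyBoundOn s Af Cf {x₀} f) (k : ℕ) (x : 𝔼)
    (htail : ∀ p : ℕ, Real.exp (-δ / h) ≤ (p.factorial : ℝ) ^ (s - 1 / 2) * √h ^ p) (G : ℂ)
    (hG : ‖G‖ ≤ Real.exp (-δ / h) * Real.exp (-(c / (4 * h)) * ‖x‖ ^ 2)) :
    ‖G * approxPoly f u x₀ h k x‖ ≤
      (12 * k ^ 2) * (remSize d s Au Cu Af Cf c h k * Real.exp (-(c / (8 * h)) * ‖x‖ ^ 2)) := by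
  set b : ℝ := Af * (Cf * d) ^ 3 * 48 ^ (s - 1) with hb
  set y : ℝ := (Cu + Cf * 2 ^ (s - 1)) * d with hy
  set T := ‖x‖ with hT
  have hb0 : 0 ≤ b := by positivity
  have hy0 : 0 ≤ y := by positivity
  have hg1 := one_le_growth hb0 hy0 c
  have hRpos : 0 ≤ remSize d s Au Cu Af Cf c h k * Real.exp (-(c / (8 * h)) * T ^ 2) := by
    unfold remSize
    positivity
  have hterm : ∀ μ ∈ Finset.range (2 * k), ∀ n ∈ Finset.range (2 * (k + μ)),
      ‖G * ((Complex.I / h) ^ μ / μ.factorial *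
        tay x₀ n (fun y => gRem f x₀ y ^ μ * u y) x)‖ ≤
      remSize d s Au Cu Af Cf c h k * Real.exp (-(c / (8 * h)) * T ^ 2) := by
    intro μ hμ n hn
    rcases lt_or_ge n (3 * μ) with hlt | hge
    · rw [tay_gRem_pow_mul_eq_zero hf hu h0 h1 hlt]
      simpa using hRpos
    · obtain ⟨l, rfl⟩ := Nat.exists_eq_add_of_le hge
      -- `p` counts the missing powers of `√h`; `htail` supplies them, and its `p!^{s-1/2}` combines
      -- with `(μ+l)!^{s-1/2}` into at most `(2k)!^{s-1/2}`.
      obtain ⟨p, hp⟩ : ∃ p, 2 * k = (μ + l) + p :=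
        Nat.exists_eq_add_of_le (by have := Finset.mem_range.1 hn; omega)
      have h2 := norm_tay_gRem_pow_mul_le hs hAu hCu hAf hCf hf hu h0 h1 hub hfb μ l x
      have h3 := termSize_mul_exp_le (T := T) hs hAu hb0 hy0 hc hh μ l
      have hts : 0 ≤ termSize s Au b y μ l T := by unfold termSize; positivity
      rw [norm_mul, norm_mul, norm_I_div_pow_div h hh]
      calc _ ≤ (Real.exp (-δ / h) * Real.exp (-(c / (4 * h)) * T ^ 2)) *
            ((1 / h) ^ μ / μ.factorial * termSize s Au b y μ l T) := by gcongr
        _ = Real.exp (-δ / h) * ((1 / h) ^ μ / μ.factorial * termSize s Au b y μ l T *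
            Real.exp (-(c / (4 * h)) * T ^ 2)) := by ring
        _ ≤ ((p.factorial : ℝ) ^ (s - 1 / 2) * √h ^ p) *
            (Au * (growth b y c ^ (μ + l) * ((μ + l).factorial : ℝ) ^ (s - 1 / 2) *
              √h ^ (μ + l)) * Real.exp (-(c / (8 * h)) * T ^ 2)) := by
            gcongr
            exact htail p
        _ = Au * (growth b y c ^ (μ + l) * (((μ + l).factorial : ℝ) ^ (s - 1 / 2) *
            (p.factorial : ℝ) ^ (s - 1 / 2)) * √h ^ (μ + l + p)) *
            Real.exp (-(c / (8 * h)) * T ^ 2) := by rw [pow_add]; ring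
        _ ≤ _ := by
            unfold remSize
            rw [← hp]
            have e1 : growth b y c ^ (μ + l) ≤ growth b y c ^ (2 * k) :=
              pow_le_pow_right₀ hg1 (by omega)
            have e2 : ((μ + l).factorial : ℝ) ^ (s - 1 / 2) * (p.factorial : ℝ) ^ (s - 1 / 2) ≤
                ((2 * k).factorial : ℝ) ^ (s - 1 / 2) := by
              rw [hp]
              exact factorial_mul_factorial_rpow_le (by linarith) _ _
            gcongr
  have hsum : G * approxPoly f u x₀ h k x = ∑ μ ∈ Finset.range (2 * k),
      ∑ n ∈ Finset.range (2 * (k + μ)), G * ((Complex.I / h) ^ μ / μ.factorial *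
        tay x₀ n (fun y => gRem f x₀ y ^ μ * u y) x) := by
    simp only [approxPoly, Finset.mul_sum]
  rw [hsum]
  set R := remSize d s Au Cu Af Cf c h k * Real.exp (-(c / (8 * h)) * T ^ 2)
  calc _ ≤ ∑ μ ∈ Finset.range (2 * k), (6 * k : ℝ) * R := by
        refine norm_sum_le_of_le _ fun μ hμ => ?_
        refine (norm_sum_le_of_le _ (hterm μ hμ)).trans ?_
        rw [Finset.sum_const, Finset.card_range, nsmul_eq_mul]
        gcongr
        have := Finset.mem_range.1 hμ
        exact_mod_cast (by omega : 2 * (k + μ) ≤ 6 * k)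
    _ = _ := by
        rw [Finset.sum_const, Finset.card_range, nsmul_eq_mul]
        push_cast
        ring

end Integrand

/-! ### The Gaussian integral of the polynomial model, and the final constant. -/

section MainSum

open PowerSeries

variable {f u : EuclideanSpace ℝ (Fin d) → ℂ} {x₀ : EuclideanSpace ℝ (Fin d)}
variable {s Au Cu Af Cf : ℝ}

theorem contDiff_quadOp_iterate {F : 𝔼 → ℂ} (hF : ContDiff ℝ ∞ F) (B : Matrix (Fin d) (Fin d) ℂ)
    (ν : ℕ) : ContDiff ℝ ∞ ((quadOp B)^[ν] F) := by
  induction ν with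
  | zero => exact hF
  | succ ν ih => rw [Function.iterate_succ_apply']; exact contDiff_quadOp ih B

theorem quadOp_smul_iterate {F : 𝔼 → ℂ} (hF : ContDiff ℝ ∞ F) (a : ℂ)
    (B : Matrix (Fin d) (Fin d) ℂ) (ν : ℕ) :
    (quadOp (a • B))^[ν] F = fun x => a ^ ν * (quadOp B)^[ν] F x := by
  induction ν with
  | zero => simp
  | succ ν ih =>
    rw [Function.iterate_succ_apply', ih, Function.iterate_succ_apply']
    have hν := contDiff_quadOp_iterate hF B ν
    funext x
    simp only [quadOp, pderiv_const_mul hν, pderiv_const_mul (contDiff_pderiv hν _), Finset.mul_sum]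
    refine Finset.sum_congr rfl fun i _ => Finset.sum_congr rfl fun j _ => ?_
    rw [Matrix.smul_apply, smul_eq_mul]
    ring

theorem quadOp_iterate_gRem_pow_mul_eq_zero (hs : 1 ≤ s) (hAu : 0 ≤ Au) (hCu : 0 ≤ Cu)
    (hAf : 0 ≤ Af) (hCf : 0 ≤ Cf) (hf : ContDiff ℝ ∞ f) (hu : ContDiff ℝ ∞ u) (h0 : f x₀ = 0)
    (h1 : fderiv ℝ f x₀ = 0) (hub : GevreyBoundOn s Au Cu {x₀} u)
    (hfb : GevreyBoundOn s Af Cf {x₀} f) (B : Matrix (Fin d) (Fin d) ℂ) {μ ν : ℕ}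
    (h : 2 * ν < 3 * μ) : (quadOp B)^[ν] (fun y => gRem f x₀ y ^ μ * u y) x₀ = 0 := by
  have hg := contDiff_gRem (x₀ := x₀) hf
  have hw := (wordBound_gRem hs hAf hCf le_rfl hfb hf h0 h1).pow_mul hg hu
    (wordBound_of_gevrey hs hAu hCu le_rfl hub hu) μ
  have := norm_quadOp_iterate_le (x₀ := x₀) (B := B) (c₀ := ∑ i, ∑ j, ‖B i j‖) (M := 0)
    (by positivity) le_rfl (fun i j => ?_) ν ((hg.pow μ).mul hu) (fun w hl => ?_)
  · simpa using this
  · exact (Finset.single_le_sum (f := fun j => ‖B i j‖) (fun _ _ => norm_nonneg _)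
      (Finset.mem_univ j)).trans (Finset.single_le_sum (f := fun i => ∑ j, ‖B i j‖)
      (fun _ _ => by positivity) (Finset.mem_univ i))
  · refine (hw w).trans (le_of_eq ?_)
    rw [hl, mul_pow, ← pow_mul, mul_assoc (X ^ (3 * μ)), coeff_X_pow_mul', if_neg (not_le.2 h),
      mul_zero]

theorem sum_range_two_mul_even {g : ℕ → ℂ} (hg : ∀ ν, g (2 * ν + 1) = 0) (N : ℕ) :
    ∑ n ∈ Finset.range (2 * N), g n = ∑ ν ∈ Finset.range N, g (2 * ν) := by
  induction N with
  | zero => simp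
  | succ N ih =>
    rw [mul_add_one, Finset.sum_range_succ, Finset.sum_range_succ, ih, hg, add_zero,
      Finset.sum_range_succ]

/-- Substitute `ν = j + μ`. The vanishing hypothesis removes `ν < μ`, and for fixed `j` it removes
`μ > 2j`. -/
theorem sum_range_triangle_eq {a : ℕ → ℕ → ℂ} (ha : ∀ μ ν, 2 * ν < 3 * μ → a μ ν = 0) (k : ℕ) :
    ∑ μ ∈ Finset.range (2 * k), ∑ ν ∈ Finset.range (k + μ), a μ ν =
      ∑ j ∈ Finset.range k, ∑ μ ∈ Finset.range (2 * j + 1), a μ (j + μ) := by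
  have h1 : ∀ μ, ∑ ν ∈ Finset.range (k + μ), a μ ν = ∑ j ∈ Finset.range k, a μ (j + μ) := by
    intro μ
    rw [add_comm k μ, Finset.sum_range_add, Finset.sum_eq_zero fun ν hν => ha μ ν (by
      have := Finset.mem_range.1 hν; omega), zero_add]
    simp only [add_comm]
  simp only [h1]
  rw [Finset.sum_comm]
  refine Finset.sum_congr rfl fun j hj => ?_
  have hj' := Finset.mem_range.1 hj
  refine (Finset.sum_subset (Finset.range_subset_range.2 (by omega)) fun μ _ hμ => ?_).symm
  exact ha μ (j + μ) (by have := Finset.mem_range.not.1 hμ; omega)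

theorem integral_gauss_mul_approxPoly (hs : 1 ≤ s) (hAu : 0 ≤ Au) (hCu : 0 ≤ Cu)
    (hAf : 0 ≤ Af) (hCf : 0 ≤ Cf) (hf : ContDiff ℝ ∞ f) (hu : ContDiff ℝ ∞ u) (h0 : f x₀ = 0)
    (h1 : fderiv ℝ f x₀ = 0) (hub : GevreyBoundOn s Au Cu {x₀} u)
    (hfb : GevreyBoundOn s Af Cf {x₀} f) {A : Matrix (Fin d) (Fin d) ℂ} {a : ℝ} (ha : 0 < a)
    (hA : ∀ x : 𝔼, a * ‖x‖ ^ 2 ≤ (quad A x).re) (hsym : ∀ i j, A i j = A j i) {h : ℝ} (hh : 0 < h)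
    (hinv : ((Complex.I * h) • (hess f x₀)⁻¹) * A = 1) (k : ℕ) :
    Integrable (fun x : 𝔼 => gauss A x * approxPoly f u x₀ h k x) ∧
    ∫ x : 𝔼, gauss A x * approxPoly f u x₀ h k x =
      (∫ x : 𝔼, gauss A x) * ∑ j ∈ Finset.range k, (h : ℂ) ^ j * Lop f x₀ j u := by
  have hgu : ∀ μ : ℕ, ContDiff ℝ ∞ fun y => gRem f x₀ y ^ μ * u y :=
    fun μ => ((contDiff_gRem hf).pow μ).mul hu
  have hint : ∀ μ n : ℕ, Integrable fun x : 𝔼 => (Complex.I / h) ^ μ / μ.factorial *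
      (gauss A x * tay x₀ n (fun y => gRem f x₀ y ^ μ * u y) x) := fun μ n =>
    (integrable_gauss_mul_tay ha hA x₀ n _).const_mul _
  have hexp : (fun x : 𝔼 => gauss A x * approxPoly f u x₀ h k x) = fun x =>
      ∑ μ ∈ Finset.range (2 * k), ∑ n ∈ Finset.range (2 * (k + μ)),
        (Complex.I / h) ^ μ / μ.factorial *
          (gauss A x * tay x₀ n (fun y => gRem f x₀ y ^ μ * u y) x) := by
    funext x
    simp only [approxPoly, Finset.mul_sum]
    exact Finset.sum_congr rfl fun μ _ => Finset.sum_congr rfl fun n _ => by ring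
  rw [hexp]
  refine ⟨integrable_finsetSum _ fun μ _ => integrable_finsetSum _ fun n _ => hint μ n, ?_⟩
  set J := ∫ x : 𝔼, gauss A x
  set q : ℕ → ℕ → ℂ := fun μ ν => (quadOp (hess f x₀)⁻¹)^[ν] (fun y => gRem f x₀ y ^ μ * u y) x₀
  have hμ : ∀ μ : ℕ, ∑ n ∈ Finset.range (2 * (k + μ)), (Complex.I / h) ^ μ / μ.factorial *
      ∫ x : 𝔼, gauss A x * tay x₀ n (fun y => gRem f x₀ y ^ μ * u y) x =
      J * ∑ ν ∈ Finset.range (k + μ), (Complex.I / h) ^ μ / μ.factorial *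
        ((2 ^ ν * (ν.factorial : ℂ))⁻¹ * ((Complex.I * h) ^ ν * q μ ν)) := by
    intro μ
    rw [sum_range_two_mul_even fun ν => by
      rw [integral_gauss_tay_odd ha hA hsym hinv x₀ ν (hgu μ), mul_zero], Finset.mul_sum]
    refine Finset.sum_congr rfl fun ν _ => ?_
    rw [integral_gauss_tay_even ha hA hsym hinv x₀ ν (hgu μ), quadOp_smul_iterate (hgu μ)]
    ring
  rw [integral_finsetSum _ fun μ _ => integrable_finsetSum _ fun n _ => hint μ n]
  simp only [fun μ => integral_finsetSum (Finset.range (2 * (k + μ))) fun n _ => hint μ n,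
    integral_const_mul, hμ]
  rw [← Finset.mul_sum, sum_range_triangle_eq (a := fun μ ν => (Complex.I / h) ^ μ / μ.factorial *
        ((2 ^ ν * (ν.factorial : ℂ))⁻¹ * ((Complex.I * h) ^ ν * q μ ν))) fun μ ν hμν => by
      simp only [q]
      rw [quadOp_iterate_gRem_pow_mul_eq_zero hs hAu hCu hAf hCf hf hu h0 h1 hub hfb _ hμν]
      simp]
  congr 1
  refine Finset.sum_congr rfl fun j _ => ?_
  rw [Lop, Finset.mul_sum]
  refine Finset.sum_congr rfl fun μ _ => ?_
  have hh0 : (h : ℂ) ≠ 0 := by exact_mod_cast hh.ne'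
  change (Complex.I / h) ^ μ / μ.factorial * ((2 ^ (j + μ) * ((j + μ).factorial : ℂ))⁻¹ *
    ((Complex.I * h) ^ (j + μ) * q μ (j + μ))) = (h : ℂ) ^ j * (Complex.I ^ (μ + (j + μ)) /
    (2 ^ (j + μ) * (μ.factorial : ℂ) * ((j + μ).factorial : ℂ)) * q μ (j + μ))
  -- The powers combine as `(i/h)^μ (ih)^{j+μ} = i^{μ+(j+μ)} h^j`.
  rw [div_pow, mul_pow, pow_add (h : ℂ), pow_add Complex.I μ]
  field_simp

theorem count_le_pow (k : ℕ) : 12 * k ^ 2 + 2 * k + 1 ≤ 16 ^ k := by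
  induction k with
  | zero => simp
  | succ n ih => rw [pow_succ 16]; nlinarith

/-- The constant of the expansion. -/
def expansionConst (d : ℕ) (s Au Cu Af Cf c : ℝ) : ℝ :=
  (1 + Au * (8 * Real.pi / c) ^ ((d : ℝ) / 2)) *
    (16 * growth (Af * (Cf * d) ^ 3 * 48 ^ (s - 1)) ((Cu + Cf * 2 ^ (s - 1)) * d) c ^ 2 * 4 ^ s)

theorem remSize_mul_le {c h : ℝ} (hs : 1 ≤ s) (hAu : 0 ≤ Au) (hCu : 0 ≤ Cu) (hAf : 0 ≤ Af)
    (hCf : 0 ≤ Cf) (hc : 0 < c) (hh : 0 < h) (k : ℕ) :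
    (12 * (k : ℝ) ^ 2 + 2 * k + 1) * (remSize d s Au Cu Af Cf c h k *
      (Real.pi / (c / (8 * h))) ^ ((d : ℝ) / 2)) ≤
    expansionConst d s Au Cu Af Cf c ^ (k + 1) * (k.factorial : ℝ) ^ (2 * s - 1) *
      h ^ ((k : ℝ) + (d : ℝ) / 2) := by
  set Γ := growth (Af * (Cf * d) ^ 3 * 48 ^ (s - 1)) ((Cu + Cf * 2 ^ (s - 1)) * d) c with hΓ
  have hΓ1 : 1 ≤ Γ := one_le_growth (by positivity) (by positivity) c
  have hpi := Real.pi_pos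
  set P : ℝ := Au * (8 * Real.pi / c) ^ ((d : ℝ) / 2) with hP
  have hP0 : 0 ≤ P := by positivity
  set Q : ℝ := 16 * Γ ^ 2 * 4 ^ s with hQ
  have hQ1 : 1 ≤ Q := by
    have : 1 ≤ Γ ^ 2 := one_le_pow₀ hΓ1
    have h4 : (1 : ℝ) ≤ 4 ^ s := Real.one_le_rpow (by norm_num) (by linarith)
    exact one_le_mul_of_one_le_of_one_le (by linarith) h4
  have e1 : (Real.pi / (c / (8 * h))) ^ ((d : ℝ) / 2) =
      (8 * Real.pi / c) ^ ((d : ℝ) / 2) * h ^ ((d : ℝ) / 2) := by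
    rw [← Real.mul_rpow (by positivity) hh.le]
    congr 1
    field_simp
  have e2 : √h ^ (2 * k) = h ^ k := by rw [pow_mul, Real.sq_sqrt hh.le]
  have e3 : h ^ ((k : ℝ) + (d : ℝ) / 2) = h ^ k * h ^ ((d : ℝ) / 2) := by
    rw [Real.rpow_add hh, Real.rpow_natCast]
  have hcount : (12 * (k : ℝ) ^ 2 + 2 * k + 1) ≤ 16 ^ k := by exact_mod_cast count_le_pow k
  calc _ ≤ 16 ^ k * (Au * (Γ ^ (2 * k) * ((4 ^ s) ^ k * (k.factorial : ℝ) ^ (2 * s - 1)) * h ^ k) *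
        ((8 * Real.pi / c) ^ ((d : ℝ) / 2) * h ^ ((d : ℝ) / 2))) := by
        rw [e1, remSize, e2]
        gcongr
        exact factorial_two_mul_rpow_le hs k
    _ = P * Q ^ k * (k.factorial : ℝ) ^ (2 * s - 1) * (h ^ k * h ^ ((d : ℝ) / 2)) := by
        rw [hP, hQ]
        simp only [mul_pow, ← pow_mul]
        ring
    _ ≤ ((1 + P) * Q) ^ (k + 1) * (k.factorial : ℝ) ^ (2 * s - 1) * (h ^ k * h ^ ((d : ℝ) / 2)) := by
        -- The extra power in `C^{k+1}` absorbs the prefactor `P`, which is not raised to the power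
        -- `k`.
        have p1 : P ≤ (1 + P) ^ (k + 1) :=
          (by linarith : P ≤ 1 + P).trans (le_self_pow₀ (by linarith) (by omega))
        have p2 : Q ^ k ≤ Q ^ (k + 1) := pow_le_pow_right₀ hQ1 (by omega)
        have p3 : P * Q ^ k ≤ ((1 + P) * Q) ^ (k + 1) := by
          rw [mul_pow (1 + P)]
          exact mul_le_mul p1 p2 (by positivity) (by positivity)
        exact mul_le_mul_of_nonneg_right (mul_le_mul_of_nonneg_right p3 (by positivity))
          (by positivity)
    _ = _ := by rw [e3]; rfl

end MainSum

/-! ### The expansion for globally smooth `f` and `u`. -/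

section MainEstimate

variable {f u : EuclideanSpace ℝ (Fin d) → ℂ} {x₀ : EuclideanSpace ℝ (Fin d)}
variable {s Au Cu Af Cf : ℝ}

theorem norm_integral_sub_expansion_le {c h r δ : ℝ} (hs : 1 ≤ s) (hAu : 0 ≤ Au) (hCu : 0 ≤ Cu)
    (hAf : 0 ≤ Af) (hCf : 0 ≤ Cf) (hc : 0 < c) (hh : 0 < h) (hr : 0 < r) (hf : ContDiff ℝ ∞ f)
    (hu : ContDiff ℝ ∞ u) (h0 : f x₀ = 0) (h1 : fderiv ℝ f x₀ = 0)
    (hub : GevreyBoundOn s Au Cu (Metric.ball x₀ r) u)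
    (hfb : GevreyBoundOn s Af Cf (Metric.ball x₀ r) f)
    (hH : ∀ x : 𝔼, c * ‖x‖ ^ 2 ≤ (quad (hess f x₀) x).im)
    (hg : ∀ x : 𝔼, ‖x‖ < r → ‖gRem f x₀ (x₀ + x)‖ ≤ (quad (hess f x₀) x).im / 4)
    (hδ : ∀ x : 𝔼, r ≤ ‖x‖ → 4 * δ ≤ (quad (hess f x₀) x).im)
    (htail : ∀ p : ℕ, Real.exp (-δ / h) ≤ (p.factorial : ℝ) ^ (s - 1 / 2) * √h ^ p) (k : ℕ) :
    ‖(∫ x in Metric.ball x₀ r, Complex.exp (Complex.I / (h : ℂ) * f x) * u x) -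
        detInvSqrt ((1 / (2 * (Real.pi : ℂ) * Complex.I * (h : ℂ))) • hess f x₀) *
          ∑ j ∈ Finset.range k, (h : ℂ) ^ j * Lop f x₀ j u‖ ≤
      expansionConst d s Au Cu Af Cf c ^ (k + 1) * (k.factorial : ℝ) ^ (2 * s - 1) *
        h ^ ((k : ℝ) + (d : ℝ) / 2) := by
  set H := hess f x₀ with hHdef
  have hpi := Real.pi_pos
  have hpic : (Real.pi : ℂ) ≠ 0 := by exact_mod_cast hpi.ne'
  have hhc : (h : ℂ) ≠ 0 := by exact_mod_cast hh.ne'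
  -- `A` is the matrix of the Gaussian `exp(iHx·x/(2h))`, and `B = A/(2π)` is the normalisation for
  -- which the Gaussian integral is `detInvSqrt B` without further factors.
  set A : Matrix (Fin d) (Fin d) ℂ := (-Complex.I / h) • H with hA
  set B : Matrix (Fin d) (Fin d) ℂ := (1 / (2 * (Real.pi : ℂ) * Complex.I * (h : ℂ))) • H with hB
  have hAB : A = (2 * Real.pi : ℂ) • B := by
    rw [hA, hB, smul_smul]
    congr 1
    field_simp
    rw [Complex.I_sq, neg_neg]
  have hreA : ∀ x : 𝔼, (quad A x).re = (quad H x).im / h := by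
    intro x
    rw [hA, quad_smul, show (-Complex.I / (h : ℂ)) = ((1 / h : ℝ) : ℂ) * -Complex.I by push_cast; ring,
      mul_assoc, Complex.re_ofReal_mul]
    simp
    ring
  have hreB : ∀ x : 𝔼, (quad B x).re = (quad H x).im / (2 * Real.pi * h) := by
    intro x
    have := hreA x
    rw [hAB, quad_smul, show (2 * Real.pi : ℂ) = ((2 * Real.pi : ℝ) : ℂ) by push_cast; rfl,
      Complex.re_ofReal_mul] at this
    field_simp at this ⊢
    linarith
  have hsymH : ∀ i j, H i j = H j i := hess_symm hf x₀
  have hsymA : ∀ i j, A i j = A j i := fun i j => by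
    rw [hA, Matrix.smul_apply, Matrix.smul_apply, hsymH i j]
  have hsymB : ∀ i j, B i j = B j i := fun i j => by
    rw [hB, Matrix.smul_apply, Matrix.smul_apply, hsymH i j]
  have hAre : ∀ x : 𝔼, c / h * ‖x‖ ^ 2 ≤ (quad A x).re := fun x => by
    rw [hreA, div_mul_eq_mul_div]
    gcongr
    exact hH x
  have hBre : ∀ x : 𝔼, c / (2 * Real.pi * h) * ‖x‖ ^ 2 ≤ (quad B x).re := fun x => by
    rw [hreB, div_mul_eq_mul_div]
    gcongr
    exact hH x
  have hch : 0 < c / h := by positivity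
  have hJ : ∫ x : 𝔼, gauss A x = detInvSqrt B := by
    rw [hAB]
    exact integral_gauss_eq_detInvSqrt (by positivity) hBre hsymB
  have hdetH : IsUnit H.det := by
    have hdB := det_segOne_ne_zero (by positivity) hBre hsymB (t := 1) (by simp)
    rw [segOne, Complex.ofReal_one, one_smul, add_sub_cancel, hB, Matrix.det_smul] at hdB
    exact isUnit_iff_ne_zero.2 (right_ne_zero_of_mul hdB)
  have hinv : ((Complex.I * h) • H⁻¹) * A = 1 := by
    rw [hA, Matrix.smul_mul, Matrix.mul_smul, smul_smul, Matrix.nonsing_inv_mul _ hdetH]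
    have : Complex.I * h * (-Complex.I / h) = 1 := by
      field_simp
      rw [Complex.I_sq, neg_neg]
    rw [this, one_smul]
  have hx₀ : x₀ ∈ Metric.ball x₀ r := Metric.mem_ball_self hr
  have hub0 : GevreyBoundOn s Au Cu {x₀} u := fun α y hy => hub α y ((Set.mem_singleton_iff.1 hy) ▸ hx₀)
  have hfb0 : GevreyBoundOn s Af Cf {x₀} f := fun α y hy => hfb α y ((Set.mem_singleton_iff.1 hy) ▸ hx₀)
  obtain ⟨hpint, hpeq⟩ := integral_gauss_mul_approxPoly hs hAu hCu hAf hCf hf hu h0 h1 hub0 hfb0 hch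
    hAre hsymA hh hinv k
  rw [hJ] at hpeq
  set Φ : 𝔼 → ℂ := fun x => Complex.exp (Complex.I / (h : ℂ) * f x) * u x with hΦ
  have hΦint : Integrable ((Metric.ball x₀ r).indicator Φ) := by
    refine IntegrableOn.integrable_indicator ?_ measurableSet_ball
    have hcont : Continuous Φ :=
      (Complex.continuous_exp.comp (continuous_const.mul hf.continuous)).mul hu.continuous
    exact (hcont.continuousOn.integrableOn_compact (isCompact_closedBall x₀ r)).mono_set
      Metric.ball_subset_closedBall
  have hΦeq : ∫ x in Metric.ball x₀ r, Φ x = ∫ x : 𝔼, (Metric.ball x₀ r).indicator Φ (x₀ + x) := by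
    rw [integral_add_left_eq_self fun x => (Metric.ball x₀ r).indicator Φ x,
      integral_indicator measurableSet_ball]
  rw [hΦeq, ← hpeq, ← integral_sub (hΦint.comp_add_left x₀) hpint]
  have hgnorm : ∀ x : 𝔼, ‖gauss A x‖ = Real.exp (-((quad H x).im / (2 * h))) := fun x => by
    rw [norm_gauss, hreA]
    congr 1
    field_simp
  have hpoint : ∀ x : 𝔼, ‖(Metric.ball x₀ r).indicator Φ (x₀ + x) -
      gauss A x * approxPoly f u x₀ h k x‖ ≤
      (12 * (k : ℝ) ^ 2 + 2 * k + 1) * (remSize d s Au Cu Af Cf c h k) *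
        Real.exp (-(c / (8 * h)) * ‖x‖ ^ 2) := by
    intro x
    have hRpos : 0 ≤ remSize d s Au Cu Af Cf c h k * Real.exp (-(c / (8 * h)) * ‖x‖ ^ 2) := by
      have := one_le_growth (b := Af * (Cf * d) ^ 3 * 48 ^ (s - 1))
        (y := (Cu + Cf * 2 ^ (s - 1)) * d) (by positivity) (by positivity) c
      unfold remSize
      positivity
    have hq4 : -((quad H x).im / (4 * h)) ≤ -(c / (4 * h)) * ‖x‖ ^ 2 := by
      have := div_le_div_of_nonneg_right (hH x) (by positivity : 0 ≤ 4 * h)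
      have e : c * ‖x‖ ^ 2 / (4 * h) = c / (4 * h) * ‖x‖ ^ 2 := by ring
      linarith
    rw [mul_assoc]
    by_cases hx : ‖x‖ < r
    · have hmem : x₀ + x ∈ Metric.ball x₀ r := by simpa using hx
      have hV : ∀ t ∈ Set.Icc (0 : ℝ) 1, x₀ + t • x ∈ Metric.ball x₀ r := by
        intro t ht
        rw [mem_ball_iff_norm, add_sub_cancel_left, norm_smul, Real.norm_of_nonneg ht.1]
        exact (mul_le_of_le_one_left (norm_nonneg x) ht.2).trans_lt hx
      have hfac : Φ (x₀ + x) = gauss A x *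
          (Complex.exp (Complex.I / h * gRem f x₀ (x₀ + x)) * u (x₀ + x)) := by
        change Complex.exp (Complex.I / (h : ℂ) * f (x₀ + x)) * u (x₀ + x) = _
        rw [← mul_assoc, gauss, ← Complex.exp_add]
        congr 2
        rw [gRem_eq, add_sub_cancel_left, hA, quad_smul, ← hHdef]
        ring
      rw [Set.indicator_of_mem hmem, hfac, ← mul_sub]
      refine (norm_mul_exp_sub_approxPoly_le hs hAu hCu hAf hCf hc hh hf hu h0 h1 hub hfb k x hV _
        ?_).trans ?_
      -- Of the decay `exp(-Im Hx·x/(2h))` half is spent on `e^{|g|/h}`.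
      · rw [hgnorm, ← Real.exp_add, Real.exp_le_exp]
        have h3 := div_le_div_of_nonneg_right (hg x hx) hh.le
        have e : (quad H x).im / 4 / h = (quad H x).im / (2 * h) - (quad H x).im / (4 * h) := by
          field_simp
          ring
        linarith
      · gcongr
        nlinarith [sq_nonneg (k : ℝ)]
    · have hmem : x₀ + x ∉ Metric.ball x₀ r := by simpa using hx
      rw [Set.indicator_of_notMem hmem, zero_sub, norm_neg]
      refine (norm_mul_approxPoly_le hs hAu hCu hAf hCf hc hh hf hu h0 h1 hub0 hfb0 k x htail _
        ?_).trans ?_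
      -- Outside the ball half of the decay is at most `e^{-δ/h}`.
      · rw [hgnorm, ← Real.exp_add, Real.exp_le_exp]
        have h3 := div_le_div_of_nonneg_right (hδ x (not_lt.1 hx)) (by positivity : 0 ≤ 4 * h)
        have e : (quad H x).im / (2 * h) = (quad H x).im / (4 * h) + (quad H x).im / (4 * h) := by
          field_simp
          ring
        have e2 : 4 * δ / (4 * h) = δ / h := by field_simp
        have e3 : -δ / h = -(δ / h) := by ring
        linarith
      · gcongr
        have : (0 : ℝ) ≤ k := by positivity
        linarith
  have hb : 0 < c / (8 * h) := by positivity
  refine (norm_integral_le_of_norm_le ((integrable_exp_neg_mul_sq_norm hb).const_mul _)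
    (Filter.Eventually.of_forall hpoint)).trans ?_
  rw [integral_const_mul, GaussianFourier.integral_rexp_neg_mul_sq_norm hb, mul_assoc,
    finrank_euclideanSpace_fin]
  exact remSize_mul_le hs hAu hCu hAf hCf hc hh k

end MainEstimate

/-! ### Cut-offs, coercivity, and the choice of the neighbourhood. -/

section Localization

/-- Multiply by a bump function that is one on the half ball. Agreement of germs, not just of
values, is what carries over derivatives and Gevrey bounds. -/
theorem exists_contDiff_eq_on_ball {W : Set 𝔼} (hW : IsOpen W) {F : 𝔼 → ℂ}
    (hF : ContDiffOn ℝ ∞ F W) {x₀ : 𝔼} {R : ℝ} (hR : 0 < R) (hRW : Metric.closedBall x₀ R ⊆ W) :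
    ∃ G : 𝔼 → ℂ, ContDiff ℝ ∞ G ∧ ∀ y ∈ Metric.ball x₀ (R / 2), F =ᶠ[nhds y] G := by
  let χ : ContDiffBump x₀ := ⟨R / 2, R, half_pos hR, half_lt_self hR⟩
  refine ⟨fun x => χ x • F x, ?_, fun y hy => ?_⟩
  · rw [contDiff_iff_contDiffAt]
    intro x
    by_cases hx : x ∈ W
    · exact χ.contDiff.contDiffAt.smul (hF.contDiffAt (hW.mem_nhds hx))
    · have h1 : x ∉ tsupport χ := fun h => hx (hRW (by rwa [χ.tsupport_eq] at h))
      have h2 := notMem_tsupport_iff_eventuallyEq.1 h1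
      refine (contDiffAt_const (c := (0 : ℂ))).congr_of_eventuallyEq ?_
      filter_upwards [h2] with y hy
      simp [hy]
  · filter_upwards [Metric.isOpen_ball.mem_nhds hy] with z hz
    rw [χ.one_of_mem_closedBall (Metric.ball_subset_closedBall hz), one_smul]

theorem im_quad_eq (H : Matrix (Fin d) (Fin d) ℂ) (x : 𝔼) :
    (quad H x).im = x.ofLp ⬝ᵥ (H.map Complex.im).mulVec x.ofLp := by
  simp only [quad, Complex.im_sum, dotProduct, Matrix.mulVec, Finset.mul_sum, Matrix.map_apply]
  refine Finset.sum_congr rfl fun i _ => Finset.sum_congr rfl fun j _ => ?_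
  rw [Complex.im_mul_ofReal, Complex.im_mul_ofReal]
  ring

theorem dotProduct_self_eq_norm_sq (x : 𝔼) : x.ofLp ⬝ᵥ x.ofLp = ‖x‖ ^ 2 := by
  rw [EuclideanSpace.real_norm_sq_eq]
  simp [dotProduct, sq]

theorem quad_real_smul (H : Matrix (Fin d) (Fin d) ℂ) (t : ℝ) (x : 𝔼) :
    quad H (t • x) = (t : ℂ) ^ 2 * quad H x := by
  simp only [quad, Finset.mul_sum]
  refine Finset.sum_congr rfl fun i _ => Finset.sum_congr rfl fun j _ => ?_
  simp
  ring

theorem exists_le_im_quad {H : Matrix (Fin d) (Fin d) ℂ} (hH : (H.map Complex.im).PosDef) :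
    ∃ m > 0, ∀ x : 𝔼, m * ‖x‖ ^ 2 ≤ (quad H x).im := by
  have hcont : Continuous fun x : 𝔼 => (quad H x).im :=
    Complex.continuous_im.comp (contDiff_quad H).continuous
  have hpos : ∀ x : 𝔼, x ≠ 0 → 0 < (quad H x).im := by
    intro x hx
    rw [im_quad_eq]
    have := hH.dotProduct_mulVec_pos (x := x.ofLp) (by simpa using hx)
    simpa using this
  have hscale : ∀ (m : ℝ), (∀ y ∈ Metric.sphere (0 : 𝔼) 1, m ≤ (quad H y).im) →
      ∀ x : 𝔼, m * ‖x‖ ^ 2 ≤ (quad H x).im := by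
    intro m hm x
    by_cases hx : x = 0
    · simp [hx, quad]
    · have hn : ‖x‖ ≠ 0 := norm_ne_zero_iff.2 hx
      have h1 := hm (‖x‖⁻¹ • x) (by simp [norm_smul, hn])
      have h2 : (quad H x).im = ‖x‖ ^ 2 * (quad H (‖x‖⁻¹ • x)).im := by
        rw [quad_real_smul, ← Complex.ofReal_pow, Complex.im_ofReal_mul, ← mul_assoc, ← mul_pow,
          mul_inv_cancel₀ hn, one_pow, one_mul]
      rw [h2, mul_comm]
      gcongr
  -- The unit sphere is empty exactly when `d = 0`; otherwise the minimum over it serves as `m`.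
  rcases (Metric.sphere (0 : 𝔼) 1).eq_empty_or_nonempty with he | hne
  · exact ⟨1, one_pos, hscale 1 fun y hy => by simp [he] at hy⟩
  · obtain ⟨y, hy, hmin⟩ := (isCompact_sphere (0 : 𝔼) 1).exists_isMinOn hne hcont.continuousOn
    refine ⟨(quad H y).im, hpos y fun h => ?_, hscale _ fun z hz => hmin hz⟩
    simp [h] at hy

theorem exists_radius {s : ℝ} (hs : 1 < s) {W : Set 𝔼} (hW : IsOpen W) {x₀ : 𝔼} (hx₀ : x₀ ∈ W)
    {f : 𝔼 → ℂ} (hf : IsGevrey s W f) (h0 : f x₀ = 0) (h1 : fderiv ℝ f x₀ = 0)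
    (hH : ((hess f x₀).map Complex.im).PosDef) :
    ∃ R > 0, Metric.closedBall x₀ R ⊆ W ∧ ∃ G : 𝔼 → ℂ, ContDiff ℝ ∞ G ∧
      (∀ y ∈ Metric.ball x₀ (R / 2), f =ᶠ[nhds y] G) ∧ ∃ r > 0, r ≤ R / 2 ∧ ∃ m > 0,
      (∀ x : 𝔼, m * ‖x‖ ^ 2 ≤ (quad (hess f x₀) x).im) ∧
      ∀ x : 𝔼, ‖x‖ < r → ‖gRem G x₀ (x₀ + x)‖ ≤ (quad (hess f x₀) x).im / 4 := by
  obtain ⟨R, hR, hRW⟩ := Metric.nhds_basis_closedBall.mem_iff.1 (hW.mem_nhds hx₀)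
  obtain ⟨G, hG, hfG⟩ := exists_contDiff_eq_on_ball hW hf.1 hR hRW
  obtain ⟨m, hm, hmH⟩ := exists_le_im_quad hH
  obtain ⟨A, hA, C, hC, hb⟩ := hf.2 _ (isCompact_closedBall x₀ R) hRW
  have hb' : GevreyBoundOn s A C (Metric.ball x₀ (R / 2)) G :=
    GevreyBoundOn.congr (fun α y hy => hb α y (Metric.ball_subset_closedBall
      (Metric.ball_subset_ball (by linarith) hy))) hfG
  have hxb : x₀ ∈ Metric.ball x₀ (R / 2) := Metric.mem_ball_self (half_pos hR)
  have hfG0 := hfG x₀ hxb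
  have hG0 : G x₀ = 0 := by rw [← hfG0.eq_of_nhds, h0]
  have hG1 : fderiv ℝ G x₀ = 0 := by rw [← hfG0.fderiv_eq, h1]
  set L : ℝ := A * (C * d) ^ 3 * 48 ^ (s - 1) with hL
  have hL0 : 0 ≤ L := by positivity
  -- The cubic bound `|g| ≤ L‖x‖³` falls below `m/4 ‖x‖²` once `‖x‖ ≤ m/(4(L+1))`.
  refine ⟨R, hR, hRW, G, hG, hfG, min (R / 2) (m / (4 * (L + 1))), by positivity, min_le_left _ _,
    m, hm, hmH, fun x hx => ?_⟩
  have hxR : ‖x‖ < R / 2 := hx.trans_le (min_le_left _ _)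
  have hxm : ‖x‖ < m / (4 * (L + 1)) := hx.trans_le (min_le_right _ _)
  have hV : ∀ t ∈ Set.Icc (0 : ℝ) 1, x₀ + t • x ∈ Metric.ball x₀ (R / 2) := by
    intro t ht
    rw [mem_ball_iff_norm, add_sub_cancel_left, norm_smul, Real.norm_of_nonneg ht.1]
    exact (mul_le_of_le_one_left (norm_nonneg x) ht.2).trans_lt hxR
  -- The remainder estimate of order zero is the cubic bound on `g`.
  have h2 := (hasGevreyExpansion_remSeries hs.le hA.le hC.le hG hG0 hG1 hb' x hV le_rfl).2 0
  simp only [Finset.range_zero, Finset.sum_empty, sub_zero, pow_zero, Nat.factorial_zero,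
    Nat.cast_one, Real.one_rpow, mul_one] at h2
  rw [lt_div_iff₀ (by positivity)] at hxm
  have h3 : 0 ≤ ‖x‖ ^ 2 := by positivity
  calc ‖gRem G x₀ (x₀ + x)‖ ≤ L * ‖x‖ * ‖x‖ ^ 2 := h2.trans (le_of_eq (by rw [hL]; ring))
    _ ≤ m / 4 * ‖x‖ ^ 2 := by
        gcongr
        nlinarith [norm_nonneg x]
    _ ≤ _ := by linarith [hmH x]

end Localization

end GevreyPhase

end

/-! ### Assembly of the two estimates. -/

theorem mainTheorem7 (d : ℕ) (s : ℝ) (hs : 1 < s) :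
    -- `K` and `M` give the constants: they depend only on `d`, `s` and their listed arguments
    ∃ (K : ℝ → ℝ → ℝ → ℝ → ℝ → ℝ) (M : ℝ → ℝ → ℝ → ℝ → ℝ),
      ∀ (W : Set (EuclideanSpace ℝ (Fin d))) (x₀ : EuclideanSpace ℝ (Fin d))
        (f : EuclideanSpace ℝ (Fin d) → ℂ),
        IsOpen W → x₀ ∈ W → GevreyPhase.IsGevrey s W f →
        f x₀ = 0 → fderiv ℝ f x₀ = 0 →
        ((GevreyPhase.hess f x₀).map Complex.im).PosDef →
        -- the expansion with its remainder estimate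
        (∃ (U : Set (EuclideanSpace ℝ (Fin d))) (h₀ : ℝ),
          IsOpen U ∧ x₀ ∈ U ∧ IsCompact (closure U) ∧ closure U ⊆ W ∧ 0 < h₀ ∧
          ∀ u : EuclideanSpace ℝ (Fin d) → ℂ, GevreyPhase.IsGevrey s W u →
            ∀ Au Cu Af Cf c : ℝ, 0 < Au → 0 < Cu → 0 < Af → 0 < Cf → 0 < c →
              GevreyPhase.GevreyBoundOn s Au Cu U u →
              GevreyPhase.GevreyBoundOn s Af Cf U f →
              (∀ v : Fin d → ℝ,
                c * (v ⬝ᵥ v) ≤ v ⬝ᵥ ((GevreyPhase.hess f x₀).map Complex.im).mulVec v) →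
              ∀ (k : ℕ) (h : ℝ), 0 < h → h < h₀ →
                ‖(∫ x in U, Complex.exp (Complex.I / (h : ℂ) * f x) * u x) -
                    GevreyPhase.detInvSqrt
                        ((1 / (2 * (Real.pi : ℂ) * Complex.I * (h : ℂ))) •
                          GevreyPhase.hess f x₀) *
                      ∑ j ∈ Finset.range k, (h : ℂ) ^ j * GevreyPhase.Lop f x₀ j u‖
                  ≤ K Au Cu Af Cf c ^ (k + 1) * (k.factorial : ℝ) ^ (2 * s - 1) *
                      h ^ ((k : ℝ) + (d : ℝ) / 2)) ∧
        -- the estimate of the coefficients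
        (∀ u : EuclideanSpace ℝ (Fin d) → ℂ, GevreyPhase.IsGevrey s W u →
          ∀ Au Cu Af Cf c₀ : ℝ, 0 < Au → 0 < Cu → 0 < Af → 0 < Cf → 0 < c₀ →
            GevreyPhase.GevreyBoundOn s Au Cu {x₀} u →
            GevreyPhase.GevreyBoundOn s Af Cf {x₀} f →
            (∀ i j, ‖(GevreyPhase.hess f x₀)⁻¹ i j‖ ≤ c₀) →
            ∀ j : ℕ, ‖GevreyPhase.Lop f x₀ j u‖
              ≤ 2 * Au * M Cu Af Cf c₀ ^ j * (j.factorial : ℝ) ^ (2 * s - 1)) := by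
  refine ⟨GevreyPhase.expansionConst d s, fun Cu Af Cf c₀ => 4 * (1 + d ^ 2 * c₀) ^ 3 *
      (1 + 2 * (Af * Cf ^ 3 * 48 ^ (s - 1))) ^ 2 * (1 + 2 * (Cu + Cf * 2 ^ (s - 1))) ^ 2 *
      256 * 4 ^ s, ?_⟩
  intro W x₀ f hW hx₀ hf h0 h1 hH
  obtain ⟨R, hR, hRW, F, hF, hfF, r, hr, hrR, m, hm, hmH, hg⟩ :=
    GevreyPhase.exists_radius hs hW hx₀ hf h0 h1 hH
  have hxb : x₀ ∈ Metric.ball x₀ (R / 2) := Metric.mem_ball_self (half_pos hR)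
  have hfF0 := hfF x₀ hxb
  have hF0 : F x₀ = 0 := by rw [← hfF0.eq_of_nhds, h0]
  have hF1 : fderiv ℝ F x₀ = 0 := by rw [← hfF0.fderiv_eq, h1]
  have hhess := GevreyPhase.hess_congr hfF0
  refine ⟨?_, ?_⟩
  -- `δ = m r²/4` uses the coercivity constant `m` found from `f`, not the prescribed `c`, so `U`
  -- and `h₀` depend neither on `u` nor on the listed constants.
  · obtain ⟨h₀, hh₀, htail⟩ := GevreyPhase.exists_exp_neg_div_le hs
      (by positivity : 0 < m * r ^ 2 / 4)
    have hcl : closure (Metric.ball x₀ r) ⊆ Metric.closedBall x₀ r := Metric.closure_ball_subset_closedBall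
    refine ⟨Metric.ball x₀ r, h₀, Metric.isOpen_ball, Metric.mem_ball_self hr,
      (isCompact_closedBall x₀ r).of_isClosed_subset isClosed_closure hcl,
      hcl.trans ((Metric.closedBall_subset_closedBall (by linarith)).trans hRW), hh₀, ?_⟩
    intro u hu Au Cu Af Cf c hAu hCu hAf hCf hc hub hfb hcH k h hh hhh₀
    obtain ⟨G, hG, huG⟩ := GevreyPhase.exists_contDiff_eq_on_ball hW hu.1 hR hRW
    have hsub : Metric.ball x₀ r ⊆ Metric.ball x₀ (R / 2) := Metric.ball_subset_ball hrR
    have key := GevreyPhase.norm_integral_sub_expansion_le (δ := m * r ^ 2 / 4) hs.le hAu.le hCu.le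
      hAf.le hCf.le hc hh hr hF hG hF0 hF1 (hub.congr fun y hy => huG y (hsub hy))
      (hfb.congr fun y hy => hfF y (hsub hy))
      (fun x => by
        rw [← hhess, GevreyPhase.im_quad_eq, ← GevreyPhase.dotProduct_self_eq_norm_sq]
        exact hcH x.ofLp)
      (by rw [← hhess]; exact hg)
      (fun x hx => by
        rw [← hhess]
        have h2 : m * r ^ 2 ≤ m * ‖x‖ ^ 2 :=
          mul_le_mul_of_nonneg_left (pow_le_pow_left₀ hr.le hx 2) hm.le
        linarith [hmH x])
      (htail h hh hhh₀) k
    have hint : ∫ x in Metric.ball x₀ r, Complex.exp (Complex.I / (h : ℂ) * f x) * u x =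
        ∫ x in Metric.ball x₀ r, Complex.exp (Complex.I / (h : ℂ) * F x) * G x :=
      setIntegral_congr_fun measurableSet_ball fun x hx => by
        simp only [(hfF x (hsub hx)).eq_of_nhds, (huG x (hsub hx)).eq_of_nhds]
    rw [hint, hhess]
    simp only [GevreyPhase.Lop_congr hfF0 (huG x₀ hxb)]
    exact key
  · intro u hu Au Cu Af Cf c₀ hAu hCu hAf hCf hc₀ hub hfb hinv j
    obtain ⟨G, hG, huG⟩ := GevreyPhase.exists_contDiff_eq_on_ball hW hu.1 hR hRW
    rw [GevreyPhase.Lop_congr hfF0 (huG x₀ hxb)]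
    refine GevreyPhase.norm_Lop_le hs.le hAu.le hCu.le hAf.le hCf.le hc₀.le hF hG hF0 hF1
      (hub.congr fun y hy => ?_) (hfb.congr fun y hy => ?_) (by rw [← hhess]; exact hinv) j
    · rw [Set.mem_singleton_iff.1 hy]; exact huG x₀ hxb
    · rw [Set.mem_singleton_iff.1 hy]; exact hfF0
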